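/- Let $\mathbb G=(A,\Delta)$ be a compact quantum group in the sense of Woronowicz: $A$ is a unital $C^*$-algebra and $\Delta:A\to A\otimes A$ (minimal tensor product) is a coassociative unital $*$-homomorphism such that $(A\otimes 1)\Delta(A)$ and $(1\otimes A)\Delta(A)$ span dense subspaces of $A\otimes A$. Let $\mathrm{Irred}(\mathbb G)$ be the set of equivalence classes of irreducible unitary corepresentations, with trivial class $e$, conjugation $\alpha\mapsto\bar\alpha$, dimension $d(\alpha)=\dim H_\alpha$, and fusion multiplicities $N_{\alpha,\beta}^{\gamma}$ (the multiplicity of $\gamma$ in $\alpha\otimes\beta$). The fusion algebra $F(\mathbb G)=\mathrm{span}_{\mathbb C}\,\mathrm{Irred}(\mathbb G)$ has product $\alpha\beta=\sum_\gamma N_{\alpha,\beta}^{\gamma}\gamma$, unit $e$, and conjugate-linear involution $\alpha^*=\bar\alpha$. Let $\ell^2(\mathrm{Irred}(\mathbb G))$ be the Hilbert space with orthonormal basis $\mathrm{Irred}(\mathbb G)$, and let $c_c(\mathrm{Irred}(\mathbb G))$, identified with $F(\mathbb G)$, be the linear span of this basis. A proper length function is a map $\ell:\mathrm{Irred}(\mathbb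 G)\to[0,\infty)$ with $\ell(e)=0$, $\ell(\bar\alpha)=\ell(\alpha)$, $\ell(\gamma)\le\ell(\alpha)+\ell(\beta)$ whenever $\gamma$ is a sub-corepresentation of $\alpha\otimes\beta$, with $\{\alpha:\ell(\alpha)\le N\}$ finite for every $N$, and with $\ell(\alpha)=0$ only for $\alpha=e$. Let $\tilde D_\ell$ be the operator with domain $c_c(\mathrm{Irred}(\mathbb G))$ given by $\tilde D_\ell(\alpha)=\ell(\alpha)\alpha$. We say that $\mathbb G$ has polynomial growth of order $s\ge 0$ with respect to $\ell$ if there is $c\ge 0$ with $$\sum_{\alpha:\ \ell(\alpha)\in(n-1,n]}d(\alpha)^2\le c\,n^s\qquad\text{for all integers } n\ge 1 .$$ **Theorem.** Let $\ell$ be a proper length function on $\mathbb G$, and suppose that $\mathbb G$ has polynomial growth of order $s$ with respect to $\ell$. Let $k>s$ be an integer. Then left multiplication by each $f\in F(\mathbb G)$ extends to a bounded operator $\pi(f)$ on $\ell^2(\mathrm{Irred}(\mathbb G))$; the $k$-fold iterated commutator $\delta^k(f)=[\tilde D_\ell,[\tilde D_\ell,\dots,[\tilde D_\ell,\pi(f)]\dots]]$,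 defined on $c_c(\mathrm{Irred}(\mathbb G))$, is bounded; and, with $L_\ell^k(f)=\|\delta^k(f)\|$, the pair $(F(\mathbb G),L_\ell^k)$ is a compact quantum metric space. The last assertion means the following. 1. Through the injective linear map $\pi$, which satisfies $\pi(e)=1$ and $\pi(f^*)=\pi(f)^*$, $F(\mathbb G)$ is a (not necessarily complete) operator system in $B(\ell^2(\mathrm{Irred}(\mathbb G)))$. 2. $L_\ell^k$ is a Lipschitz seminorm: a seminorm with values in $[0,\infty]$ and norm-dense domain of finiteness, with $L_\ell^k(f^*)=L_\ell^k(f)$, and with $L_\ell^k(f)=0$ if and only if $f\in\mathbb C e$. 3. $d(\varphi,\psi)=\sup\{|\varphi(f)-\psi(f)|:f\in F(\mathbb G),\ L_\ell^k(f)\le 1\}$ is a finite metric on the state space of this operator system (the unital positive linear functionals), and it induces the weak$^*$ topology. -/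

import Mathlib

open scoped TensorProduct ENNReal NNReal ComplexOrder Matrix

noncomputable section

namespace CQG

universe u v

/-! ### Compact quantum groups -/

/-- A state on a unital `*`-algebra over `ℂ`. -/
def IsState {A : Type u} [Ring A] [StarRing A] [Algebra ℂ A] (φ : A →ₗ[ℂ] ℂ) : Prop :=
  φ 1 = 1 ∧ ∀ a : A, 0 ≤ φ (star a * a)

/-- The functional `a ⊗ b ↦ φ a * ψ b` on the algebraic tensor product. -/
def prodFunctional {A B : Type u} [Ring A] [Algebra ℂ A] [Ring B] [Algebra ℂ B]
    (φ : A →ₗ[ℂ] ℂ) (ψ : B →ₗ[ℂ] ℂ) : A ⊗[ℂ] B →ₗ[ℂ] ℂ :=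
  LinearMap.mul' ℂ ℂ ∘ₗ TensorProduct.map φ ψ

/-- A realization of the `C⋆`-algebra `C` as the minimal (spatial) tensor product of `A` and `B`:
the completion of `A ⊗[ℂ] B` in the spatial norm. The set in `norm_sq` consists of the numbers
`‖(π_φ ⊗ π_ψ)(x) y‖ ^ 2`, where `π_φ`, `π_ψ` are the GNS representations of states `φ`, `ψ` and `y`
runs over the unit vectors coming from `A ⊗[ℂ] B` in the Hilbert space of `π_φ ⊗ π_ψ`. -/
structure MinTensor (A B C : Type u) [CStarAlgebra A] [CStarAlgebra B] [CStarAlgebra C] where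
  emb : A ⊗[ℂ] B →⋆ₐ[ℂ] C
  denseRange : DenseRange emb
  norm_sq : ∀ x : A ⊗[ℂ] B,
    IsLUB {r : ℝ | ∃ (φ : A →ₗ[ℂ] ℂ) (ψ : B →ₗ[ℂ] ℂ) (y : A ⊗[ℂ] B),
        IsState φ ∧ IsState ψ ∧ prodFunctional φ ψ (star y * y) = 1 ∧
        r = (prodFunctional φ ψ (star (x * y) * (x * y))).re}
      (‖emb x‖ ^ 2)

/-- A compact quantum group with underlying unital `C⋆`-algebra `A`. Here `A₂` and `A₃` are the
minimal tensor products `A ⊗ A` and `A ⊗ A ⊗ A`, the latter being presented both as `(A ⊗ A) ⊗ A`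
and as `A ⊗ (A ⊗ A)`. -/
structure CompactQuantumGroup (A : Type u) [CStarAlgebra A] where
  A₂ : Type u
  A₃ : Type u
  [instA₂ : CStarAlgebra A₂]
  [instA₃ : CStarAlgebra A₃]
  tensor : MinTensor A A A₂
  tensorLeft : MinTensor A₂ A A₃
  tensorRight : MinTensor A A₂ A₃
  tensor_assoc : ∀ a b c : A,
    tensorLeft.emb (tensor.emb (a ⊗ₜ b) ⊗ₜ c) = tensorRight.emb (a ⊗ₜ tensor.emb (b ⊗ₜ c))
  /-- the comultiplication `Δ` -/
  comul : A →⋆ₐ[ℂ] A₂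
  /-- the homomorphism `Δ ⊗ id` -/
  comulId : A₂ →⋆ₐ[ℂ] A₃
  comulId_tmul : ∀ a b : A, comulId (tensor.emb (a ⊗ₜ b)) = tensorLeft.emb (comul a ⊗ₜ b)
  /-- the homomorphism `id ⊗ Δ` -/
  idComul : A₂ →⋆ₐ[ℂ] A₃
  idComul_tmul : ∀ a b : A, idComul (tensor.emb (a ⊗ₜ b)) = tensorRight.emb (a ⊗ₜ comul b)
  coassoc : ∀ a : A, comulId (comul a) = idComul (comul a)
  cancel_left :
    Dense (Submodule.span ℂ {x : A₂ | ∃ a b : A, x = tensor.emb (a ⊗ₜ 1) * comul b} : Set A₂)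
  cancel_right :
    Dense (Submodule.span ℂ {x : A₂ | ∃ a b : A, x = tensor.emb (1 ⊗ₜ a) * comul b} : Set A₂)

attribute [instance] CompactQuantumGroup.instA₂ CompactQuantumGroup.instA₃

/-! ### Corepresentations -/

section Mor

variable {A : Type u} [CStarAlgebra A] {m n p : Type} [Fintype m] [Fintype n] [Fintype p]

/-- A scalar matrix, viewed as a matrix over `A`. -/
def scal (A : Type u) [CStarAlgebra A] {m n : Type} (T : Matrix m n ℂ) : Matrix m n A :=
  T.map (algebraMap ℂ A)

/-- The space of intertwiners from the matrix `v` to the matrix `w`. -/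
def Mor (v : Matrix n n A) (w : Matrix m m A) : Submodule ℂ (Matrix m n ℂ) where
  carrier := {T | scal A T * v = w * scal A T}
  zero_mem' := by
    have h : scal A (0 : Matrix m n ℂ) = 0 := Matrix.map_zero _ (map_zero _)
    change scal A (0 : Matrix m n ℂ) * v = w * scal A 0
    rw [h, Matrix.zero_mul, Matrix.mul_zero]
  add_mem' := by
    intro S T hS hT
    have h : scal A (S + T) = scal A S + scal A T := Matrix.map_add _ (map_add _) S T
    change scal A S * v = w * scal A S at hS
    change scal A T * v = w * scal A T at hT
    change scal A (S + T) * v = w * scal A (S + T)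
    rw [h, Matrix.add_mul, Matrix.mul_add, hS, hT]
  smul_mem' := by
    intro c T hT
    have h : scal A (c • T) = c • scal A T := by
      ext i j; simp [scal, Algebra.smul_def]
    change scal A T * v = w * scal A T at hT
    change scal A (c • T) * v = w * scal A (c • T)
    rw [h, Matrix.smul_mul, Matrix.mul_smul, hT]

theorem mem_Mor {v : Matrix n n A} {w : Matrix m m A} {T : Matrix m n ℂ} :
    T ∈ Mor v w ↔ scal A T * v = w * scal A T := Iff.rfl

theorem scal_mul {m n p : Type} [Fintype m] (S : Matrix p m ℂ) (T : Matrix m n ℂ) :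
    scal A (S * T) = scal A S * scal A T := Matrix.map_mul

theorem scal_one {n : Type} [DecidableEq n] : scal A (1 : Matrix n n ℂ) = 1 :=
  Matrix.map_one _ (map_zero _) (map_one _)

/-- Equivalence of finite-dimensional corepresentations: an invertible intertwiner exists. -/
def MatEquiv [DecidableEq m] [DecidableEq n] (v : Matrix n n A) (w : Matrix m m A) : Prop :=
  ∃ T ∈ Mor v w, ∃ S : Matrix n m ℂ, T * S = 1 ∧ S * T = 1

theorem MatEquiv.refl [DecidableEq n] (v : Matrix n n A) : MatEquiv v v :=
  ⟨1, by rw [mem_Mor, scal_one, Matrix.one_mul, Matrix.mul_one], 1, by simp, by simp⟩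

theorem MatEquiv.symm [DecidableEq m] [DecidableEq n] {v : Matrix n n A} {w : Matrix m m A} :
    MatEquiv v w → MatEquiv w v := by
  rintro ⟨T, hT, S, h1, h2⟩
  refine ⟨S, ?_, T, h2, h1⟩
  rw [mem_Mor] at hT ⊢
  have e1 : scal A T * scal A S = 1 := by rw [← scal_mul, h1, scal_one]
  have e2 : scal A S * scal A T = 1 := by rw [← scal_mul, h2, scal_one]
  calc scal A S * w = scal A S * w * (scal A T * scal A S) := by rw [e1, Matrix.mul_one]
    _ = scal A S * (w * scal A T) * scal A S := by simp only [Matrix.mul_assoc]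
    _ = scal A S * (scal A T * v) * scal A S := by rw [hT]
    _ = (scal A S * scal A T) * v * scal A S := by simp only [Matrix.mul_assoc]
    _ = v * scal A S := by rw [e2, Matrix.one_mul]

theorem MatEquiv.trans [DecidableEq m] [DecidableEq n] [DecidableEq p]
    {v : Matrix n n A} {w : Matrix m m A} {x : Matrix p p A} :
    MatEquiv v w → MatEquiv w x → MatEquiv v x := by
  rintro ⟨T, hT, S, h1, h2⟩ ⟨T', hT', S', h1', h2'⟩
  refine ⟨T' * T, ?_, S * S', ?_, ?_⟩
  · rw [mem_Mor] at *
    rw [scal_mul, Matrix.mul_assoc, hT, ← Matrix.mul_assoc, hT', Matrix.mul_assoc]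
  · rw [Matrix.mul_assoc, ← Matrix.mul_assoc T, h1, Matrix.one_mul, h1']
  · rw [Matrix.mul_assoc, ← Matrix.mul_assoc S', h2', Matrix.one_mul, h2]

/-- Tensor product of corepresentations: `(v ⊗ w)_{(i,k),(j,l)} = v_{ij} w_{kl}`. -/
def tensorMat (v : Matrix m m A) (w : Matrix n n A) : Matrix (m × n) (m × n) A :=
  Matrix.of fun i j => v i.1 j.1 * w i.2 j.2

/-- The conjugate corepresentation, with matrix coefficients `v_{ij}^*`. -/
def conjMat (v : Matrix n n A) : Matrix n n A := v.map star

end Mor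

namespace CompactQuantumGroup

variable {A : Type u} [CStarAlgebra A] (G : CompactQuantumGroup A)

/-- Irreducible (finite-dimensional) unitary corepresentations, in matrix form. -/
structure IrrCorep where
  dim : ℕ
  dim_pos : 0 < dim
  mat : Matrix (Fin dim) (Fin dim) A
  unitary : mat * matᴴ = 1 ∧ matᴴ * mat = 1
  comul_mat : ∀ i j, G.comul (mat i j) = ∑ k, G.tensor.emb (mat i k ⊗ₜ mat k j)
  irreducible : ∀ T ∈ Mor mat mat, ∃ c : ℂ, T = c • (1 : Matrix (Fin dim) (Fin dim) ℂ)

instance irrSetoid : Setoid G.IrrCorep where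
  r v w := MatEquiv v.mat w.mat
  iseqv := ⟨fun v => MatEquiv.refl v.mat, MatEquiv.symm, MatEquiv.trans⟩

/-- The set of equivalence classes of irreducible unitary corepresentations. -/
def Irred : Type u := Quotient G.irrSetoid

/-- A representative of a class. -/
def rep (α : G.Irred) : G.IrrCorep := Quotient.out α

/-- The dimension `d(α) = dim H_α`. -/
def dim (α : G.Irred) : ℕ := (G.rep α).dim

/-- The trivial corepresentation. -/
def trivCorep : G.IrrCorep where
  dim := 1
  dim_pos := one_pos
  mat := 1
  unitary := by simp
  comul_mat := by
    intro i j
    have h : (1 : A) ⊗ₜ[ℂ] (1 : A) = 1 := Algebra.TensorProduct.one_def.symm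
    obtain rfl := Subsingleton.elim i 0
    obtain rfl := Subsingleton.elim j 0
    simp [h]
  irreducible := by
    intro T _
    refine ⟨T 0 0, ?_⟩
    ext i j
    simp [Subsingleton.elim i 0, Subsingleton.elim j 0]

/-- The class `e` of the trivial corepresentation. -/
def triv : G.Irred := Quotient.mk _ G.trivCorep

/-- `β` is the class of the conjugate corepresentation of `α`. -/
def IsConj (α β : G.Irred) : Prop := MatEquiv (conjMat (G.rep α).mat) (G.rep β).mat

open Classical in
/-- The conjugation `α ↦ ᾱ` on classes. (The conjugate of an irreducible unitary corepresentation
is always equivalent to a unique irreducible unitary one, so the second case does not occur.) -/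
def conj (α : G.Irred) : G.Irred := if h : ∃ β, G.IsConj α β then h.choose else α

/-- The multiplicity `N_{α,β}^γ` of `γ` in `α ⊗ β`: the dimension of the space of intertwiners. -/
def mult (α β γ : G.Irred) : ℕ :=
  Module.finrank ℂ (Mor (G.rep γ).mat (tensorMat (G.rep α).mat (G.rep β).mat))

/-! ### The fusion algebra -/

/-- The fusion algebra `F(G) = span {α | α ∈ Irred(G)}`. -/
def FusionAlgebra : Type u := G.Irred →₀ ℂ

instance : AddCommGroup G.FusionAlgebra := inferInstanceAs (AddCommGroup (G.Irred →₀ ℂ))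

instance : Module ℂ G.FusionAlgebra := inferInstanceAs (Module ℂ (G.Irred →₀ ℂ))

/-- The basis element of the fusion algebra given by a class. -/
def basisElem (α : G.Irred) : G.FusionAlgebra := Finsupp.single α (1 : ℂ)

/-- The linear map out of `F(G)` with prescribed values on the basis `Irred(G)`. -/
def liftBasis {M : Type v} [AddCommGroup M] [Module ℂ M] (g : G.Irred → M) :
    G.FusionAlgebra →ₗ[ℂ] M := Finsupp.linearCombination ℂ g

theorem liftBasis_basisElem {M : Type v} [AddCommGroup M] [Module ℂ M] (g : G.Irred → M)
    (α : G.Irred) : G.liftBasis g (G.basisElem α) = g α :=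
  (Finsupp.linearCombination_single ℂ (1 : ℂ) α).trans (one_smul ℂ (g α))

/-- The left multiplication `π₀(f)` on `c_c(Irred(G)) = F(G)`, bilinear with
`α β = ∑_γ N_{α,β}^γ γ`; the sum is finite, since `α ⊗ β` is finite-dimensional. -/
def leftMul : G.FusionAlgebra →ₗ[ℂ] Module.End ℂ G.FusionAlgebra :=
  G.liftBasis fun α => G.liftBasis fun β => ∑ᶠ γ, (G.mult α β γ : ℂ) • G.basisElem γ

instance : Mul G.FusionAlgebra := ⟨fun f g => G.leftMul f g⟩

instance : One G.FusionAlgebra := ⟨G.basisElem G.triv⟩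

/-- The involution: conjugate-linear with `α^* = ᾱ`. -/
instance : Star G.FusionAlgebra :=
  ⟨fun f => Finsupp.mapDomain G.conj (Finsupp.mapRange star (star_zero ℂ) f)⟩

/-- The Hilbert space `ℓ²(Irred(G))` with orthonormal basis `Irred(G)`. -/
abbrev L2 : Type u := lp (fun _ : G.Irred => ℂ) 2

open Classical in
/-- The inclusion of `c_c(Irred(G)) = F(G)` in `ℓ²(Irred(G))`. -/
def toL2 : G.FusionAlgebra →ₗ[ℂ] G.L2 := G.liftBasis fun α => lp.single 2 α (1 : ℂ)

/-! ### Length functions, growth, and the Lipschitz seminorms -/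

/-- Length functions on `G`. -/
structure IsLength (ℓ : G.Irred → ℝ) : Prop where
  nonneg : ∀ α, 0 ≤ ℓ α
  triv : ℓ G.triv = 0
  conj : ∀ α, ℓ (G.conj α) = ℓ α
  sub : ∀ α β γ, G.mult α β γ ≠ 0 → ℓ γ ≤ ℓ α + ℓ β

/-- Properness: the sets `{ℓ ≤ N}` are finite and `ℓ` vanishes only at `e`. -/
def IsProperLength (ℓ : G.Irred → ℝ) : Prop :=
  (∀ N : ℝ, {α | ℓ α ≤ N}.Finite) ∧ ∀ α, ℓ α = 0 → α = G.triv

/-- Polynomial growth of order `s` with respect to `ℓ`. -/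
def HasPolynomialGrowth (ℓ : G.Irred → ℝ) (s : ℝ) : Prop :=
  0 ≤ s ∧ ∃ c : ℝ, 0 ≤ c ∧ ∀ n : ℕ, 1 ≤ n →
    ∑' α : {α : G.Irred // (n : ℝ) - 1 < ℓ α ∧ ℓ α ≤ n}, (G.dim α : ℝ≥0∞) ^ 2 ≤
      ENNReal.ofReal (c * (n : ℝ) ^ s)

/-- The Dirac operator on its domain `c_c(Irred(G))`: `α ↦ ℓ(α) α`. -/
def dirac (ℓ : G.Irred → ℝ) : Module.End ℂ G.FusionAlgebra :=
  G.liftBasis fun α => (ℓ α : ℂ) • G.basisElem α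

/-- The iterated commutator `δ^k(f) = [D, [D, … [D, π(f)] … ]]` on the domain `c_c(Irred(G))`. -/
def iterComm (ℓ : G.Irred → ℝ) (k : ℕ) (f : G.FusionAlgebra) : Module.End ℂ G.FusionAlgebra :=
  (fun T => G.dirac ℓ * T - T * G.dirac ℓ)^[k] (G.leftMul f)

/-- The operator norm, in `[0,∞]`, of an operator in `ℓ²(Irred(G))` with domain
`c_c(Irred(G))`. -/
def opENorm (T : Module.End ℂ G.FusionAlgebra) : ℝ≥0∞ :=
  ⨆ (ξ : G.FusionAlgebra) (_ : ‖G.toL2 ξ‖ ≤ 1), ‖G.toL2 (T ξ)‖ₑ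

/-- The seminorm `L_ℓ^k(f) = ‖δ^k(f)‖`. -/
def lip (ℓ : G.Irred → ℝ) (k : ℕ) (f : G.FusionAlgebra) : ℝ≥0∞ := G.opENorm (G.iterComm ℓ k f)

end CompactQuantumGroup

/-! ### Compact quantum metric spaces -/

section Metric

variable {E : Type u} [AddCommGroup E] [Module ℂ E] [One E] [Star E]
  {H : Type v} [NormedAddCommGroup H] [InnerProductSpace ℂ H] [CompleteSpace H]

/-- The vector space `E` with its unit and involution is a (not necessarily complete) concrete
operator system through its realization `ρ` by bounded operators on `H`. -/
structure IsOperatorSystem (ρ : E →ₗ[ℂ] (H →L[ℂ] H)) : Prop where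
  injective : Function.Injective ρ
  map_one : ρ 1 = 1
  map_star : ∀ a, ρ (star a) = ContinuousLinearMap.adjoint (ρ a)

/-- The state space of the operator system `ρ : E → B(H)`: unital positive functionals. -/
def StateSpace (ρ : E →ₗ[ℂ] (H →L[ℂ] H)) : Type u :=
  {φ : E →ₗ[ℂ] ℂ // φ 1 = 1 ∧ ∀ a, (ρ a).IsPositive → 0 ≤ φ a}

/-- The weak* topology on the state space. -/
abbrev weakStar (ρ : E →ₗ[ℂ] (H →L[ℂ] H)) : TopologicalSpace (StateSpace ρ) :=
  TopologicalSpace.induced (fun φ a => φ.1 a) (inferInstance : TopologicalSpace (E → ℂ))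

/-- The Monge–Kantorovich distance `sup {|φ(a) - ψ(a)| : L(a) ≤ 1}`. -/
def mkDist (ρ : E →ₗ[ℂ] (H →L[ℂ] H)) (L : E → ℝ≥0∞) (φ ψ : StateSpace ρ) : ℝ≥0∞ :=
  ⨆ (a : E) (_ : L a ≤ 1), ‖φ.1 a - ψ.1 a‖ₑ

/-- The (extended pseudo-)metric structure on the state space given by `mkDist`. -/
abbrev mkMetric (ρ : E →ₗ[ℂ] (H →L[ℂ] H)) (L : E → ℝ≥0∞) : PseudoEMetricSpace (StateSpace ρ) where
  edist := mkDist ρ L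
  edist_self φ := by simp [mkDist]
  edist_comm φ ψ := by
    simp only [mkDist]
    refine iSup_congr fun a => iSup_congr fun _ => ?_
    rw [← enorm_neg, neg_sub]
  edist_triangle φ ψ χ := by
    refine iSup₂_le fun a ha => ?_
    calc ‖φ.1 a - χ.1 a‖ₑ = ‖(φ.1 a - ψ.1 a) + (ψ.1 a - χ.1 a)‖ₑ := by rw [sub_add_sub_cancel]
      _ ≤ ‖φ.1 a - ψ.1 a‖ₑ + ‖ψ.1 a - χ.1 a‖ₑ := enorm_add_le _ _
      _ ≤ mkDist ρ L φ ψ + mkDist ρ L ψ χ :=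
        add_le_add (le_iSup₂ (f := fun a (_ : L a ≤ 1) => ‖φ.1 a - ψ.1 a‖ₑ) a ha)
          (le_iSup₂ (f := fun a (_ : L a ≤ 1) => ‖ψ.1 a - χ.1 a‖ₑ) a ha)

/-- Lipschitz seminorms on an operator system. -/
structure IsLipSeminorm (ρ : E →ₗ[ℂ] (H →L[ℂ] H)) (L : E → ℝ≥0∞) : Prop where
  add_le : ∀ a b, L (a + b) ≤ L a + L b
  smul : ∀ (c : ℂ) a, L (c • a) = ‖c‖ₑ * L a
  dense_dom : ∀ a, ∀ ε : ℝ, 0 < ε → ∃ b, L b < ⊤ ∧ ‖ρ a - ρ b‖ < ε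
  map_star : ∀ a, L (star a) = L a
  ker : ∀ a, L a = 0 ↔ ∃ c : ℂ, a = c • (1 : E)

/-- `(E, L)`, with `E` realized by `ρ` as an operator system, is a compact quantum metric space:
`L` is a Lipschitz seminorm and its Monge–Kantorovich distance is a (finite) metric inducing the
weak* topology on the state space. -/
structure IsCompactQuantumMetricSpace (ρ : E →ₗ[ℂ] (H →L[ℂ] H)) (L : E → ℝ≥0∞) : Prop where
  operatorSystem : IsOperatorSystem ρ
  lipSeminorm : IsLipSeminorm ρ L
  dist_lt_top : ∀ φ ψ : StateSpace ρ, mkDist ρ L φ ψ < ⊤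
  eq_of_dist : ∀ φ ψ : StateSpace ρ, mkDist ρ L φ ψ = 0 → φ = ψ
  topology_eq : (mkMetric ρ L).toUniformSpace.toTopologicalSpace = weakStar ρ

end Metric

end CQG

end

/-!
Everything rests on two estimates in the fusion algebra. In the basis `Irred(G)`, the operator
`δᵏ(α)` has the matrix `(ℓ(γ) - ℓ(β))ᵏ N_{α,β}^γ`. Counting dimensions gives
`∑_γ N_{α,β}^γ d(γ) ≤ d(α) d(β)`, and Frobenius reciprocity `N_{ᾱ,β}^γ = N_{α,γ}^β` gives the same
bound for sums over `β`, so Schur's test with the weight `d` yields `‖π(α)‖ ≤ d(α)`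
(`norm_toL2_leftMul_basisElem_le`). Where `N_{α,β}^γ ≠ 0`, subadditivity of `ℓ` gives
`|ℓ(γ) - ℓ(β)| ≤ ℓ(α)`, whence `‖δᵏ(α)‖ ≤ ℓ(α)ᵏ d(α)` (`norm_toL2_iterComm_basisElem_le`). In the
other direction, `δᵏ(f)e = ∑_α f_α ℓ(α)ᵏ α`, so that `∑_α |f_α|² ℓ(α)²ᵏ ≤ L(f)²`
(`sum_norm_coord_sq_le`); this identifies the kernel of `L`.

States of the operator system satisfy `|φ(α)| ≤ 2 ‖π(α)‖ ≤ 2 d(α)`, and by the Cauchy–Schwarz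
inequality (`mkDist_le`)
`d(φ, ψ)² ≤ ∑_{α ≠ e} |φ(α) - ψ(α)|² ℓ(α)⁻²ᵏ ≤ 16 ∑_{α ≠ e} d(α)² ℓ(α)⁻²ᵏ`.
The growth condition makes the last series converge (`summable_dim_sq_mul_inv`). The distance is
therefore finite, and dominated convergence shows that weak* convergence of states implies
convergence in distance. The converse holds because `L` is finite on the whole fusion algebra
(`isCompactQuantumMetricSpace_of_tendsto`).

The fusion rules need the conjugate of an irreducible corepresentation to be equivalent to a unitary
one (`exists_isConj`), and this needs the Haar state. For one state `ω`, a Cesàro limit of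
convolution powers is `ω`-invariant; a state invariant under an average of states is invariant under
each of them; weak* compactness does the rest (`exists_isHaar`). The Haar state turns a unitary
corepresentation `v` into the matrix `E = ∑ᵢ h(vⱼᵢ⋆ vₖᵢ)`; with `w` the conjugate of `v`, invariance
says `w E w⋆ = E`. The density of `(1 ⊗ A) Δ(A)` makes `E` positive definite, although `h` need not
be faithful (`IsHaar.posDef_modularMatrix`). The same for the co-opposite quantum group gives a
positive definite matrix preserved by `w⋆`, and conjugating by a square root of it makes `w` unitary
(`IsUnitaryCorep.exists_conj`). Slice maps on the minimal tensor product, on which the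
convolutions are built, are bounded because the minimal norm is computed by product states
(`MinTensor.norm_algSlice_le`).
-/

noncomputable section

namespace CQG

universe u v

/-! ### States -/

namespace IsState

section StarAlgebra

variable {A : Type u} [Ring A] [StarRing A] [Algebra ℂ A] [StarModule ℂ A] {φ : A →ₗ[ℂ] ℂ}

theorem map_star (h : IsState φ) (a : A) : φ (star a) = star (φ a) := by
  have real : ∀ b : A, (φ (star b * b)).im = 0 := fun b => (Complex.nonneg_iff.1 (h.2 b)).2.symm
  have h1 := real (1 + a)
  have h2 := real (1 + Complex.I • a)
  have h3 := real a
  simp only [star_add, star_one, star_smul, mul_add, add_mul, one_mul, mul_one, map_add,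
    smul_mul_assoc, mul_smul_comm, map_smul, h.1, Complex.add_im, h3, smul_eq_mul,
    Complex.mul_im, Complex.mul_re] at h1 h2
  simp at h1 h2
  apply Complex.ext
  · simp; linarith
  · simp; linarith

/-- A null vector for a state is annihilated by all left multiples. -/
theorem map_mul_eq_zero (h : IsState φ) {a : A} (ha : φ (star a * a) = 0) (b : A) :
    φ (b * a) = 0 := by
  set z := φ (b * a) with hz
  obtain ⟨hN, hN'⟩ := Complex.nonneg_iff.1 (h.2 (star b))
  set N := φ (star (star b) * star b) with hNdef
  -- positivity at `a - s z b⋆` reads `|z|² (s² N - 2 s) ≥ 0`; `s = 1 / (N + 1)` forces `z = 0`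
  set s : ℝ := 1 / (N.re + 1) with hs
  have key := (Complex.nonneg_iff.1 (h.2 (a - ((s : ℂ) * z) • star b))).1
  have hz' : φ (star a * star b) = star z := by rw [← star_mul, h.map_star]
  have e : φ (star (a - ((s : ℂ) * z) • star b) * (a - ((s : ℂ) * z) • star b)) =
      -((s : ℂ) * z) * star z - (s * star z) * z + (s * star z) * (s * z) * N := by
    simp only [star_sub, star_smul, sub_mul, mul_sub, smul_mul_assoc, mul_smul_comm, map_sub,
      map_smul, ha, hz', smul_eq_mul, star_star, ← hz, hNdef, star_mul']
    simp
    ring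
  rw [e] at key
  have hN0 : N = (N.re : ℂ) := Complex.ext rfl hN'.symm
  have e2 : -((s : ℂ) * z) * star z - (s * star z) * z + (s * star z) * (s * z) * N =
      ((Complex.normSq z * (s ^ 2 * N.re - 2 * s) : ℝ) : ℂ) := by
    have := Complex.mul_conj z
    rw [hN0]
    push_cast
    rw [← this]
    simp
    ring
  rw [e2, Complex.ofReal_re] at key
  have hneg : s ^ 2 * N.re - 2 * s < 0 := by
    have hp : 0 < N.re + 1 := by linarith
    have hs0 : 0 < s := by positivity
    have : s * (N.re + 1) = 1 := by rw [hs]; field_simp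
    nlinarith
  have : Complex.normSq z = 0 := by
    have := Complex.normSq_nonneg z
    nlinarith
  exact Complex.normSq_eq_zero.1 this

theorem norm_sq_le (h : IsState φ) (a : A) : ‖φ a‖ ^ 2 ≤ (φ (star a * a)).re := by
  have key := (Complex.nonneg_iff.1 (h.2 (a - φ a • 1))).1
  have e : φ (star (a - φ a • 1) * (a - φ a • 1)) = φ (star a * a) - φ a * star (φ a) := by
    simp only [star_sub, star_smul, sub_mul, mul_sub, smul_mul_assoc, mul_smul_comm, map_sub,
      map_smul, smul_eq_mul, star_one, mul_one, one_mul, h.map_star, h.1]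
    ring
  have e2 := Complex.mul_conj (φ a)
  rw [e, show star (φ a) = (starRingEnd ℂ) (φ a) from rfl, e2, Complex.sub_re, Complex.ofReal_re,
    Complex.normSq_eq_norm_sq] at key
  linarith

end StarAlgebra

section CStar

variable {A : Type u} [CStarAlgebra A] {φ : A →ₗ[ℂ] ℂ}

theorem norm_le (h : IsState φ) (a : A) : ‖φ a‖ ≤ ‖a‖ := by
  let := CStarAlgebra.spectralOrder A
  have := CStarAlgebra.spectralOrderedRing A
  have h1 : star a * a ≤ algebraMap ℝ A (‖a‖ ^ 2) := by
    have := IsSelfAdjoint.le_algebraMap_norm_self (IsSelfAdjoint.star_mul_self a)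
    rwa [CStarRing.norm_star_mul_self, ← sq] at this
  obtain ⟨c, hc⟩ := CStarAlgebra.nonneg_iff_eq_star_mul_self.1 (sub_nonneg.2 h1)
  have h2 := (Complex.nonneg_iff.1 (h.2 c)).1
  have h3 := h.norm_sq_le a
  have h4 : φ (algebraMap ℝ A (‖a‖ ^ 2)) = ((‖a‖ ^ 2 : ℝ) : ℂ) := by
    rw [IsScalarTower.algebraMap_apply ℝ ℂ A, Algebra.algebraMap_eq_smul_one, map_smul, h.1]
    simp
  rw [← hc, map_sub, h4, Complex.sub_re, Complex.ofReal_re] at h2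
  exact abs_le_of_sq_le_sq' (by linarith) (norm_nonneg _) |>.2

theorem continuous (h : IsState φ) : Continuous φ :=
  AddMonoidHomClass.continuous_of_bound φ 1 fun a => by simpa using h.norm_le a

/-- A unital contractive functional is a state. -/
theorem of_norm_le (h1 : φ 1 = 1) (hn : ∀ a, ‖φ a‖ ≤ ‖a‖) : IsState φ := by
  let := CStarAlgebra.spectralOrder A
  have := CStarAlgebra.spectralOrderedRing A
  have hreal : ∀ b : A, IsSelfAdjoint b → (φ b).im = 0 := by
    intro b hb
    -- `|φ b + i t|² ≤ ‖b + i t‖² ≤ ‖b‖² + t²` for all real `t`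
    have key : ∀ t : ℝ, ((φ b).im + t) ^ 2 ≤ ‖b‖ ^ 2 + t ^ 2 := by
      intro t
      have e1 : φ (b + (t * Complex.I : ℂ) • 1) = φ b + t * Complex.I := by simp [h1]
      have e2 : star (b + (t * Complex.I : ℂ) • (1 : A)) * (b + (t * Complex.I : ℂ) • 1) =
          b * b + ((t ^ 2 : ℝ) : ℂ) • 1 := by
        have e3 : (t * (Complex.I * (t * Complex.I)) : ℂ) = -(t ^ 2 : ℝ) := by
          have := Complex.I_mul_I
          push_cast
          linear_combination (t : ℂ) ^ 2 * this
        simp [hb.star_eq, mul_add, add_mul, smul_smul, mul_assoc, e3]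
      have e3 : ‖b + (t * Complex.I : ℂ) • (1 : A)‖ ^ 2 ≤ ‖b‖ ^ 2 + t ^ 2 := by
        rw [sq, ← CStarRing.norm_star_mul_self, e2]
        refine (norm_add_le _ _).trans (add_le_add ((norm_mul_le _ _).trans (by rw [sq])) ?_)
        rw [norm_smul]
        rcases subsingleton_or_nontrivial A with hA | hA
        · simp [Subsingleton.elim (1 : A) 0, sq_nonneg]
        · simp
      have e4 := hn (b + (t * Complex.I : ℂ) • 1)
      rw [e1] at e4
      have e5 : ((φ b).im + t) ^ 2 ≤ ‖φ b + t * Complex.I‖ ^ 2 := by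
        rw [← Complex.normSq_eq_norm_sq, Complex.normSq_apply]
        simp
        nlinarith [mul_self_nonneg (φ b).re]
      exact e5.trans ((pow_le_pow_left₀ (norm_nonneg _) e4 2).trans e3)
    -- for this `t` the cross term `2 t Im φ(b) = 2 (‖b‖² + 1)` is too large
    by_contra hne
    have := key ((‖b‖ ^ 2 + 1) / (φ b).im)
    have h3 : (φ b).im * ((‖b‖ ^ 2 + 1) / (φ b).im) = ‖b‖ ^ 2 + 1 := by field_simp
    nlinarith [sq_nonneg (φ b).im, sq_nonneg ‖b‖]
  refine ⟨h1, fun a => ?_⟩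
  have hb := IsSelfAdjoint.star_mul_self a
  set b := star a * a with hbdef
  have hb0 : 0 ≤ b := star_mul_self_nonneg a
  have hb1 := IsSelfAdjoint.le_algebraMap_norm_self hb
  have h2 : ‖algebraMap ℝ A ‖b‖ - b‖ ≤ ‖b‖ := by
    refine (CStarAlgebra.norm_le_norm_of_nonneg_of_le (sub_nonneg.2 hb1)
      (sub_le_self _ hb0)).trans ?_
    rcases subsingleton_or_nontrivial A with hA | hA
    · simp [Subsingleton.elim (algebraMap ℝ A ‖b‖) 0]
    · simp
  have h4 : φ (algebraMap ℝ A ‖b‖) = ((‖b‖ : ℝ) : ℂ) := by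
    rw [IsScalarTower.algebraMap_apply ℝ ℂ A, Algebra.algebraMap_eq_smul_one, map_smul, h1]
    simp
  have h5 := (Complex.re_le_norm _).trans ((hn _).trans h2)
  rw [map_sub, h4, Complex.sub_re, Complex.ofReal_re] at h5
  exact Complex.nonneg_iff.2 ⟨by linarith, (hreal b hb).symm⟩

end CStar

end IsState

section Existence

variable {A : Type u} [CStarAlgebra A]

/-- A state taking a given spectral value: a character of the commutative `C⋆`-algebra generated by
`a`, extended by the Hahn–Banach theorem. -/
theorem exists_isState_apply_eq [Nontrivial A] {a : A} (ha : IsSelfAdjoint a) {z : ℂ}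
    (hz : z ∈ spectrum ℂ a) :
    ∃ φ : A →ₗ[ℂ] ℂ, IsState φ ∧ φ a = z := by
  have : IsStarNormal a := ha.isStarNormal
  let S := StarAlgebra.elemental ℂ a
  have : Nontrivial S := ⟨⟨0, 1, fun h => zero_ne_one (congrArg Subtype.val h)⟩⟩
  let a' : S := ⟨a, StarAlgebra.elemental.self_mem ℂ a⟩
  have hz' : z ∈ spectrum ℂ a' := by
    rwa [StarSubalgebra.spectrum_eq (hS := StarAlgebra.elemental.isClosed ℂ a)]
  obtain ⟨χ, hχ⟩ := WeakDual.CharacterSpace.mem_spectrum_iff_exists.1 hz'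
  let p : Subspace ℂ A := Subalgebra.toSubmodule S.toSubalgebra
  let f : p →L[ℂ] ℂ := LinearMap.mkContinuous
    { toFun := fun x => χ (⟨x.1, x.2⟩ : S)
      map_add' := fun x y => map_add χ (⟨x.1, x.2⟩ : S) ⟨y.1, y.2⟩
      map_smul' := fun c x => map_smul χ c (⟨x.1, x.2⟩ : S) } 1
    (fun x => by
      rw [one_mul]
      have := spectrum.norm_le_norm_of_mem (AlgHom.apply_mem_spectrum χ (⟨x.1, x.2⟩ : S))
      exact this)
  obtain ⟨g, hg, hgn⟩ := exists_extension_norm_eq p f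
  have hf : ‖f‖ ≤ 1 := LinearMap.mkContinuous_norm_le _ zero_le_one _
  refine ⟨g.toLinearMap, IsState.of_norm_le ?_ ?_, ?_⟩
  · exact (hg ⟨1, S.one_mem⟩).trans (map_one χ)
  · intro x
    refine (g.le_opNorm x).trans ?_
    rw [hgn]
    exact mul_le_of_le_one_left (norm_nonneg _) hf
  · exact (hg ⟨a, a'.2⟩).trans hχ

theorem exists_isState_norm_eq [Nontrivial A] {a : A} (ha : IsSelfAdjoint a) :
    ∃ φ : A →ₗ[ℂ] ℂ, IsState φ ∧ ‖φ a‖ = ‖a‖ := by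
  obtain ⟨z, hz, hz'⟩ := spectrum.exists_nnnorm_eq_spectralRadius a
  rw [ha.spectralRadius_eq_nnnorm] at hz'
  obtain ⟨φ, hφ, h⟩ := exists_isState_apply_eq ha hz
  refine ⟨φ, hφ, ?_⟩
  rw [h]
  exact congrArg NNReal.toReal (ENNReal.coe_inj.1 hz')

/-- States separate the points of a `C⋆`-algebra. -/
theorem eq_of_isState {x y : A} (h : ∀ φ : A →ₗ[ℂ] ℂ, IsState φ → φ x = φ y) : x = y := by
  rcases subsingleton_or_nontrivial A with hA | hA
  · exact Subsingleton.elim _ _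
  have sa : ∀ b : A, IsSelfAdjoint b → (∀ φ : A →ₗ[ℂ] ℂ, IsState φ → φ b = 0) → b = 0 := by
    intro b hb h0
    obtain ⟨φ, hφ, hn⟩ := exists_isState_norm_eq hb
    rw [h0 φ hφ, norm_zero] at hn
    exact norm_eq_zero.1 hn.symm
  have h0 : ∀ φ : A →ₗ[ℂ] ℂ, IsState φ → φ (x - y) = 0 := fun φ hφ => by
    rw [map_sub, h φ hφ, sub_self]
  have h1 : (x - y) + star (x - y) = 0 := by
    refine sa _ (IsSelfAdjoint.add_star_self _) fun φ hφ => ?_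
    rw [map_add, hφ.map_star, h0 φ hφ]; simp
  have h2 : Complex.I • ((x - y) - star (x - y)) = 0 := by
    refine sa _ ?_ fun φ hφ => ?_
    · rw [isSelfAdjoint_iff]
      simp only [star_smul, star_sub, star_star, Complex.star_def, Complex.conj_I, smul_sub,
        neg_smul]
      abel
    · rw [map_smul, map_sub, hφ.map_star, h0 φ hφ]; simp
  have h3 : (x - y) - star (x - y) = 0 := (smul_eq_zero.1 h2).resolve_left Complex.I_ne_zero
  have h4 : (2 : ℂ) • (x - y) = 0 := by
    rw [two_smul]
    calc (x - y) + (x - y) = ((x - y) + star (x - y)) + ((x - y) - star (x - y)) := by abel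
      _ = 0 := by rw [h1, h3, add_zero]
  exact sub_eq_zero.1 ((smul_eq_zero.1 h4).resolve_left two_ne_zero)

/-- The norm of a `C⋆`-algebra is determined by its states. -/
theorem norm_sq_le_of_isState {y : A} {C : ℝ} (hC : 0 ≤ C)
    (h : ∀ φ : A →ₗ[ℂ] ℂ, IsState φ → (φ (star y * y)).re ≤ C) : ‖y‖ ^ 2 ≤ C := by
  rcases subsingleton_or_nontrivial A with hA | hA
  · simpa [Subsingleton.elim y 0] using hC
  obtain ⟨φ, hφ, hn⟩ := exists_isState_norm_eq (IsSelfAdjoint.star_mul_self y)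
  rw [sq, ← CStarRing.norm_star_mul_self, ← hn]
  obtain ⟨h1, h2⟩ := Complex.nonneg_iff.1 (hφ.2 y)
  have : φ (star y * y) = ((φ (star y * y)).re : ℂ) := Complex.ext rfl h2.symm
  rw [this, Complex.norm_real, Real.norm_of_nonneg h1]
  exact h φ hφ

end Existence

/-! ### Slice maps on minimal tensor products -/

section AlgSlice

variable {A B : Type u} [CStarAlgebra A] [CStarAlgebra B]

theorem prodFunctional_tmul (φ : A →ₗ[ℂ] ℂ) (ψ : B →ₗ[ℂ] ℂ) (a : A) (b : B) :
    prodFunctional φ ψ (a ⊗ₜ b) = φ a * ψ b := by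
  simp [prodFunctional]

/-- The slice map `a ⊗ b ↦ ψ(b) a` on the algebraic tensor product. -/
def algSlice (A : Type u) [CStarAlgebra A] (ψ : B →ₗ[ℂ] ℂ) : A ⊗[ℂ] B →ₗ[ℂ] A :=
  (TensorProduct.rid ℂ A).toLinearMap ∘ₗ LinearMap.lTensor A ψ

@[simp]
theorem algSlice_tmul (ψ : B →ₗ[ℂ] ℂ) (a : A) (b : B) :
    algSlice A ψ (a ⊗ₜ b) = ψ b • a := by
  simp [algSlice]

theorem map_algSlice (φ : A →ₗ[ℂ] ℂ) (ψ : B →ₗ[ℂ] ℂ) (x : A ⊗[ℂ] B) :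
    φ (algSlice A ψ x) = prodFunctional φ ψ x := by
  induction x with
  | zero => simp
  | tmul a b => rw [algSlice_tmul, prodFunctional_tmul, map_smul, smul_eq_mul, mul_comm]
  | add x y hx hy => rw [map_add, map_add, map_add, hx, hy]

theorem algSlice_mul_left (ψ : B →ₗ[ℂ] ℂ) (a : A) (x : A ⊗[ℂ] B) :
    algSlice A ψ ((a ⊗ₜ 1) * x) = a * algSlice A ψ x := by
  induction x with
  | zero => simp
  | tmul c b => simp
  | add x y hx hy => rw [mul_add, map_add, map_add, hx, hy, mul_add]

theorem algSlice_mul_right (ψ : B →ₗ[ℂ] ℂ) (a : A) (x : A ⊗[ℂ] B) :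
    algSlice A ψ (x * (a ⊗ₜ 1)) = algSlice A ψ x * a := by
  induction x with
  | zero => simp
  | tmul c b => simp
  | add x y hx hy => rw [add_mul, map_add, map_add, hx, hy, add_mul]

theorem algSlice_star {ψ : B →ₗ[ℂ] ℂ} (hψ : IsState ψ) (x : A ⊗[ℂ] B) :
    algSlice A ψ (star x) = star (algSlice A ψ x) := by
  induction x with
  | zero => simp
  | tmul c b => simp [hψ.map_star]
  | add x y hx hy => rw [star_add, map_add, map_add, hx, hy, star_add]

/-- The Gram matrix `(ψ(bᵢ⋆ bⱼ))` is positive semidefinite. -/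
theorem posSemidef_gram_of_isState {ψ : B →ₗ[ℂ] ℂ} (hψ : IsState ψ) {n : Type} [Fintype n]
    (b : n → B) : (Matrix.of fun i j => ψ (star (b i) * b j)).PosSemidef := by
  refine Matrix.PosSemidef.of_dotProduct_mulVec_nonneg ?_ fun x => ?_
  · ext i j
    rw [Matrix.conjTranspose_apply, Matrix.of_apply, Matrix.of_apply, ← hψ.map_star, star_mul,
      star_star]
  · have := hψ.2 (∑ j, x j • b j)
    simp only [star_sum, Finset.sum_mul_sum, star_smul, smul_mul_smul_comm, map_sum, map_smul,
      smul_eq_mul] at this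
    simp only [dotProduct, Matrix.mulVec, Matrix.of_apply, Finset.mul_sum, Pi.star_apply]
    refine this.trans_eq (Finset.sum_congr rfl fun i _ => Finset.sum_congr rfl fun j _ => ?_)
    ring

/-- Slicing by a state preserves positivity, on the algebraic tensor product. -/
theorem exists_algSlice_star_mul_self {ψ : B →ₗ[ℂ] ℂ} (hψ : IsState ψ) (x : A ⊗[ℂ] B) :
    ∃ (m : ℕ) (c : Fin m → A), algSlice A ψ (star x * x) = ∑ k, star (c k) * c k := by
  obtain ⟨n, a, b, rfl⟩ : ∃ (n : ℕ) (a : Fin n → A) (b : Fin n → B), x = ∑ i, a i ⊗ₜ b i := by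
    induction x with
    | zero => exact ⟨0, 0, 0, by simp⟩
    | tmul a b => exact ⟨1, fun _ => a, fun _ => b, by simp⟩
    | add x y hx hy =>
      obtain ⟨n, a, b, rfl⟩ := hx
      obtain ⟨m, c, d, rfl⟩ := hy
      exact ⟨n + m, Fin.append a c, Fin.append b d, by simp [Fin.sum_univ_add]⟩
  obtain ⟨m, v, hv⟩ := Matrix.posSemidef_iff_eq_sum_vecMulVec.1 (posSemidef_gram_of_isState hψ b)
  have hv' : ∀ i j, ψ (star (b i) * b j) = ∑ k, v k i * star (v k j) := fun i j => by
    have := congrFun (congrFun hv i) j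
    simpa [Matrix.sum_apply, Matrix.vecMulVec_apply] using this
  refine ⟨m, fun k => ∑ j, star (v k j) • a j, ?_⟩
  simp only [star_sum, TensorProduct.star_tmul, Finset.sum_mul_sum, map_sum,
    Algebra.TensorProduct.tmul_mul_tmul, algSlice_tmul, hv', Finset.sum_smul, star_smul, star_star,
    smul_mul_smul_comm]
  rw [Finset.sum_comm' (t' := Finset.univ) (s' := fun _ => Finset.univ) (by simp)]
  conv_rhs => rw [Finset.sum_comm]
  conv_lhs => rw [Finset.sum_comm]
  refine Finset.sum_congr rfl fun i _ => ?_
  rw [Finset.sum_comm]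

theorem prodFunctional_nonneg {φ : A →ₗ[ℂ] ℂ} {ψ : B →ₗ[ℂ] ℂ} (hφ : IsState φ) (hψ : IsState ψ)
    (x : A ⊗[ℂ] B) : 0 ≤ prodFunctional φ ψ (star x * x) := by
  obtain ⟨m, c, hc⟩ := exists_algSlice_star_mul_self hψ x
  rw [← map_algSlice, hc, map_sum]
  exact Finset.sum_nonneg fun k _ => hφ.2 (c k)

theorem comm_star (x : A ⊗[ℂ] B) : Algebra.TensorProduct.comm ℂ A B (star x) =
    star (Algebra.TensorProduct.comm ℂ A B x) := by
  induction x with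
  | zero => simp
  | tmul a b => simp
  | add x y hx hy => rw [star_add, map_add, map_add, hx, hy, star_add]

theorem comm_comm (x : A ⊗[ℂ] B) :
    Algebra.TensorProduct.comm ℂ B A (Algebra.TensorProduct.comm ℂ A B x) = x := by
  induction x with
  | zero => simp
  | tmul a b => simp
  | add x y hx hy => rw [map_add, map_add, hx, hy]

/-- The flip `a ⊗ b ↦ b ⊗ a` as a `*`-homomorphism. -/
def commStarAlgHom (A B : Type u) [CStarAlgebra A] [CStarAlgebra B] :
    A ⊗[ℂ] B →⋆ₐ[ℂ] B ⊗[ℂ] A where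
  toAlgHom := (Algebra.TensorProduct.comm ℂ A B).toAlgHom
  map_star' := comm_star

theorem prodFunctional_comm (φ : A →ₗ[ℂ] ℂ) (ψ : B →ₗ[ℂ] ℂ) (x : A ⊗[ℂ] B) :
    prodFunctional ψ φ (Algebra.TensorProduct.comm ℂ A B x) = prodFunctional φ ψ x := by
  induction x with
  | zero => simp
  | tmul a b => simp [prodFunctional_tmul, mul_comm]
  | add x y hx hy => rw [map_add, map_add, map_add, hx, hy]

end AlgSlice

namespace MinTensor

variable {A B C : Type u} [CStarAlgebra A] [CStarAlgebra B] [CStarAlgebra C] (M : MinTensor A B C)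

theorem prodFunctional_le {φ : A →ₗ[ℂ] ℂ} {ψ : B →ₗ[ℂ] ℂ} (hφ : IsState φ) (hψ : IsState ψ)
    (x : A ⊗[ℂ] B) : (prodFunctional φ ψ (star x * x)).re ≤ ‖M.emb x‖ ^ 2 :=
  (M.norm_sq x).1 ⟨φ, ψ, 1, hφ, hψ, by
    simp [Algebra.TensorProduct.one_def, prodFunctional_tmul, hφ.1, hψ.1], by simp⟩

/-- Slicing by a state is contractive for the minimal tensor norm, so it extends to the
completion. -/
theorem norm_algSlice_le {ψ : B →ₗ[ℂ] ℂ} (hψ : IsState ψ) (x : A ⊗[ℂ] B) :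
    ‖algSlice A ψ x‖ ≤ ‖M.emb x‖ := by
  have h : ‖algSlice A ψ x‖ ^ 2 ≤ ‖M.emb x‖ ^ 2 := by
    refine norm_sq_le_of_isState (by positivity) fun φ hφ => ?_
    refine le_trans ?_ (M.prodFunctional_le hφ hψ x)
    -- positivity of `φ ⊗ ψ` at `x - s ⊗ 1`, where `s` is the slice of `x`
    set s := algSlice A ψ x with hs
    have key := (Complex.nonneg_iff.1 (prodFunctional_nonneg hφ hψ (x - s ⊗ₜ 1))).1
    rw [star_sub, TensorProduct.star_tmul, star_one, mul_sub, sub_mul, sub_mul, ← map_algSlice,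
      map_sub, map_sub, map_sub, map_sub, map_sub, algSlice_mul_right, algSlice_mul_left,
      algSlice_mul_left, algSlice_star hψ, ← hs, algSlice_tmul, hψ.1, one_smul, sub_self,
      map_zero, sub_zero, Complex.sub_re, map_algSlice] at key
    linarith
  exact abs_le_of_sq_le_sq' h (norm_nonneg _) |>.2

/-- The slice map `id ⊗ ψ` by a state `ψ` on the minimal tensor product. -/
def slice (ψ : B →ₗ[ℂ] ℂ) : C →L[ℂ] A :=
  (algSlice A ψ).extendOfNorm (M.emb : A ⊗[ℂ] B →ₗ[ℂ] C)

theorem slice_emb {ψ : B →ₗ[ℂ] ℂ} (hψ : IsState ψ) (x : A ⊗[ℂ] B) :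
    M.slice ψ (M.emb x) = algSlice A ψ x :=
  LinearMap.extendOfNorm_eq (e := (M.emb : A ⊗[ℂ] B →ₗ[ℂ] C)) M.denseRange
    ⟨1, fun x => by simpa using M.norm_algSlice_le hψ x⟩ x

theorem slice_tmul {ψ : B →ₗ[ℂ] ℂ} (hψ : IsState ψ) (a : A) (b : B) :
    M.slice ψ (M.emb (a ⊗ₜ b)) = ψ b • a := by
  rw [M.slice_emb hψ, algSlice_tmul]

/-- Continuous linear maps on the minimal tensor product agree if they agree on elementary
tensors. -/
theorem ext_tmul {E : Type*} [NormedAddCommGroup E] [NormedSpace ℂ E] {f g : C →L[ℂ] E}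
    (h : ∀ a b, f (M.emb (a ⊗ₜ b)) = g (M.emb (a ⊗ₜ b))) : f = g := by
  refine ContinuousLinearMap.coeFn_injective
    (M.denseRange.equalizer f.continuous g.continuous (funext fun x => ?_))
  induction x with
  | zero => simp
  | tmul a b => exact h a b
  | add x y hx hy => simpa using congrArg₂ (· + ·) hx hy

theorem slice_mul_left {ψ : B →ₗ[ℂ] ℂ} (hψ : IsState ψ) (a : A) (z : C) :
    M.slice ψ (M.emb (a ⊗ₜ 1) * z) = a * M.slice ψ z := by
  refine M.denseRange.induction_on z (isClosed_eq (by fun_prop) (by fun_prop)) fun x => ?_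
  rw [← map_mul, M.slice_emb hψ, M.slice_emb hψ, algSlice_mul_left]

theorem slice_mul_right {ψ : B →ₗ[ℂ] ℂ} (hψ : IsState ψ) (a : A) (z : C) :
    M.slice ψ (z * M.emb (a ⊗ₜ 1)) = M.slice ψ z * a := by
  refine M.denseRange.induction_on z (isClosed_eq (by fun_prop) (by fun_prop)) fun x => ?_
  rw [← map_mul, M.slice_emb hψ, M.slice_emb hψ, algSlice_mul_right]

theorem slice_star {ψ : B →ₗ[ℂ] ℂ} (hψ : IsState ψ) (z : C) :
    M.slice ψ (star z) = star (M.slice ψ z) := by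
  refine M.denseRange.induction_on z (isClosed_eq (by fun_prop) (by fun_prop)) fun x => ?_
  rw [← map_star, M.slice_emb hψ, M.slice_emb hψ, algSlice_star hψ]

theorem slice_one {ψ : B →ₗ[ℂ] ℂ} (hψ : IsState ψ) : M.slice ψ 1 = 1 := by
  rw [← map_one M.emb, Algebra.TensorProduct.one_def, M.slice_tmul hψ, hψ.1, one_smul]

/-- The product state `φ ⊗ ψ` on the minimal tensor product. -/
theorem isState_slice {φ : A →ₗ[ℂ] ℂ} {ψ : B →ₗ[ℂ] ℂ} (hφ : IsState φ) (hψ : IsState ψ) :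
    IsState (φ ∘ₗ (M.slice ψ : C →ₗ[ℂ] A)) := by
  refine ⟨by simp [M.slice_one hψ, hφ.1], fun z => ?_⟩
  have hc := hφ.continuous
  refine M.denseRange.induction_on z ?_ fun x => ?_
  · exact isClosed_Ici.preimage (hc.comp ((M.slice ψ).continuous.comp (by fun_prop)))
  · have := prodFunctional_nonneg hφ hψ x
    rwa [← map_algSlice, ← M.slice_emb hψ, map_mul, map_star] at this

/-- The minimal tensor product with the two factors exchanged. -/
def swap : MinTensor B A C where
  emb := M.emb.comp (commStarAlgHom B A)
  denseRange := by
    change Dense (Set.range (M.emb ∘ Algebra.TensorProduct.comm ℂ B A))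
    rw [(Algebra.TensorProduct.comm ℂ B A).surjective.range_comp]
    exact M.denseRange
  norm_sq := fun x => by
    refine cast (congrArg (IsLUB · _) ?_) (M.norm_sq (Algebra.TensorProduct.comm ℂ B A x))
    ext r
    symm
    constructor
    · rintro ⟨φ, ψ, y, hφ, hψ, hy, rfl⟩
      refine ⟨ψ, φ, Algebra.TensorProduct.comm ℂ B A y, hψ, hφ, ?_, ?_⟩
      · rw [← comm_star, ← map_mul, prodFunctional_comm, hy]
      · rw [← map_mul, ← comm_star, ← map_mul, prodFunctional_comm]
    · rintro ⟨φ, ψ, y, hφ, hψ, hy, rfl⟩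
      refine ⟨ψ, φ, Algebra.TensorProduct.comm ℂ A B y, hψ, hφ, ?_, ?_⟩
      · rw [← comm_star, ← map_mul, prodFunctional_comm, hy]
      · obtain ⟨x, rfl⟩ := (Algebra.TensorProduct.comm ℂ A B).surjective x
        rw [← map_mul, ← comm_star, ← map_mul, prodFunctional_comm]
        rw [comm_comm]

@[simp]
theorem swap_emb_tmul (a : A) (b : B) : M.swap.emb (b ⊗ₜ a) = M.emb (a ⊗ₜ b) := by
  rfl

end MinTensor

/-! ### Convolution by states -/

/-- A `*`-homomorphism of `C⋆`-algebras as a continuous linear map. -/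
def starHomCLM {B C : Type u} [CStarAlgebra B] [CStarAlgebra C] (f : B →⋆ₐ[ℂ] C) : B →L[ℂ] C :=
  LinearMap.mkContinuous (f : B →ₗ[ℂ] C) 1 fun x => by
    simpa using NonUnitalStarAlgHom.norm_apply_le f x

@[simp]
theorem starHomCLM_apply {B C : Type u} [CStarAlgebra B] [CStarAlgebra C] (f : B →⋆ₐ[ℂ] C)
    (x : B) : starHomCLM f x = f x := rfl

namespace CompactQuantumGroup

variable {A : Type u} [CStarAlgebra A] (G : CompactQuantumGroup A)

/-- The co-opposite compact quantum group: the same comultiplication, with the two legs of the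
tensor products exchanged. -/
def cop : CompactQuantumGroup A where
  A₂ := G.A₂
  A₃ := G.A₃
  tensor := G.tensor.swap
  tensorLeft := G.tensorRight.swap
  tensorRight := G.tensorLeft.swap
  tensor_assoc := fun a b c => by simp [G.tensor_assoc]
  comul := G.comul
  comulId := G.idComul
  comulId_tmul := fun a b => by simp [G.idComul_tmul]
  idComul := G.comulId
  idComul_tmul := fun a b => by simp [G.comulId_tmul]
  coassoc := fun a => (G.coassoc a).symm
  cancel_left := by simpa using G.cancel_right
  cancel_right := by simpa using G.cancel_left

/-- The right convolution operator `a ↦ (id ⊗ ω) Δ(a)`. -/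
def convRight (ω : A →ₗ[ℂ] ℂ) : A →L[ℂ] A :=
  (G.tensor.slice ω).comp (starHomCLM G.comul)

/-- The left convolution operator `a ↦ (ω ⊗ id) Δ(a)`. -/
def convLeft (ω : A →ₗ[ℂ] ℂ) : A →L[ℂ] A :=
  (G.tensor.swap.slice ω).comp (starHomCLM G.comul)

theorem convRight_apply (ω : A →ₗ[ℂ] ℂ) (a : A) :
    G.convRight ω a = G.tensor.slice ω (G.comul a) := rfl

theorem convLeft_apply (ω : A →ₗ[ℂ] ℂ) (a : A) :
    G.convLeft ω a = G.tensor.swap.slice ω (G.comul a) := rfl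

theorem convRight_star {ω : A →ₗ[ℂ] ℂ} (hω : IsState ω) (a : A) :
    G.convRight ω (star a) = star (G.convRight ω a) := by
  rw [convRight_apply, map_star, MinTensor.slice_star _ hω, convRight_apply]

theorem isState_convRight {φ ω : A →ₗ[ℂ] ℂ} (hφ : IsState φ) (hω : IsState ω) :
    IsState (φ ∘ₗ (G.convRight ω : A →ₗ[ℂ] A)) := by
  have h := G.tensor.isState_slice hφ hω
  refine ⟨?_, fun a => ?_⟩
  · have := h.1
    rw [← map_one G.comul] at this
    exact this
  · have := h.2 (G.comul a)
    rw [← map_star, ← map_mul] at this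
    exact this

theorem isState_convLeft {φ ω : A →ₗ[ℂ] ℂ} (hφ : IsState φ) (hω : IsState ω) :
    IsState (φ ∘ₗ (G.convLeft ω : A →ₗ[ℂ] A)) :=
  G.cop.isState_convRight hφ hω

/-- Slicing in either order gives the product functional. -/
theorem slice_slice {B C : Type u} [CStarAlgebra B] [CStarAlgebra C] (M : MinTensor A B C)
    {φ : A →ₗ[ℂ] ℂ} {ψ : B →ₗ[ℂ] ℂ} (hφ : IsState φ) (hψ : IsState ψ) (z : C) :
    φ (M.slice ψ z) = ψ (M.swap.slice φ z) := by
  have hφc := hφ.continuous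
  have hψc := hψ.continuous
  have := M.ext_tmul (f := (⟨φ, hφc⟩ : A →L[ℂ] ℂ).comp (M.slice ψ))
    (g := (⟨ψ, hψc⟩ : B →L[ℂ] ℂ).comp (M.swap.slice φ)) fun a b => by
      have h1 := M.slice_tmul hψ a b
      have h2 := M.swap.slice_tmul hφ b a
      rw [M.swap_emb_tmul] at h2
      simp [h1, h2, mul_comm]
  exact congrArg (fun f : C →L[ℂ] ℂ => f z) this

theorem map_convRight {φ ω : A →ₗ[ℂ] ℂ} (hφ : IsState φ) (hω : IsState ω) (a : A) :
    φ (G.convRight ω a) = ω (G.convLeft φ a) :=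
  slice_slice G.tensor hφ hω _

/-- Coassociativity: left and right convolution operators commute. -/
theorem convLeft_convRight {φ ψ : A →ₗ[ℂ] ℂ} (hφ : IsState φ) (hψ : IsState ψ) (a : A) :
    G.convLeft φ (G.convRight ψ a) = G.convRight ψ (G.convLeft φ a) := by
  have h1 : ∀ z, G.comul (G.tensor.slice ψ z) = G.tensorLeft.slice ψ (G.comulId z) := fun z => by
    have := G.tensor.ext_tmul
      (f := (starHomCLM G.comul).comp
        (G.tensor.slice ψ))
      (g := (G.tensorLeft.slice ψ).comp (starHomCLM G.comulId)) fun a b => by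
        simp [G.tensor.slice_tmul hψ, G.comulId_tmul, G.tensorLeft.slice_tmul hψ]
    exact congrArg (fun f : G.A₂ →L[ℂ] G.A₂ => f z) this
  have h2 : ∀ z, G.comul (G.tensor.swap.slice φ z) = G.tensorRight.swap.slice φ (G.idComul z) :=
    fun z => by
    have := G.tensor.swap.ext_tmul
      (f := (starHomCLM G.comul).comp
        (G.tensor.swap.slice φ))
      (g := (G.tensorRight.swap.slice φ).comp (starHomCLM G.idComul)) fun a b => by
        have e1 := G.tensor.swap.slice_tmul hφ a b
        have e2 := G.tensorRight.swap.slice_tmul hφ (G.comul a) b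
        rw [G.tensor.swap_emb_tmul] at e1
        rw [G.tensorRight.swap_emb_tmul] at e2
        simp [e1, e2, G.idComul_tmul]
    exact congrArg (fun f : G.A₂ →L[ℂ] G.A₂ => f z) this
  have h3 : (G.tensor.swap.slice φ).comp (G.tensorLeft.slice ψ) =
      (G.tensor.slice ψ).comp (G.tensorRight.swap.slice φ) := by
    refine G.tensorLeft.ext_tmul fun z c => ?_
    rw [ContinuousLinearMap.comp_apply, G.tensorLeft.slice_tmul hψ]
    refine G.tensor.denseRange.induction_on z ?_ fun x => ?_
    · have hc : Continuous fun z : G.A₂ => G.tensorLeft.emb (z ⊗ₜ c) := by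
        have h : Continuous fun z : G.A₂ => G.tensorLeft.emb (z ⊗ₜ 1) := by
          let f : G.A₂ →⋆ₐ[ℂ] G.A₃ := G.tensorLeft.emb.comp
            { (Algebra.TensorProduct.includeLeft : G.A₂ →ₐ[ℂ] G.A₂ ⊗[ℂ] A) with
              map_star' := fun x => by simp }
          exact (starHomCLM f).continuous
        have h' : (fun z : G.A₂ => G.tensorLeft.emb (z ⊗ₜ c)) =
            fun z => G.tensorLeft.emb (z ⊗ₜ 1) * G.tensorLeft.emb (1 ⊗ₜ c) := by
          funext z
          rw [← map_mul]; simp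
        rw [h']
        exact h.mul continuous_const
      exact isClosed_eq (by fun_prop) (by fun_prop)
    · induction x with
      | zero => simp
      | tmul a b =>
        have e1 := G.tensor.swap.slice_tmul hφ b a
        have e2 := G.tensorRight.swap.slice_tmul hφ (G.tensor.emb (b ⊗ₜ c)) a
        rw [MinTensor.swap_emb_tmul] at e1 e2
        rw [G.tensor_assoc, ContinuousLinearMap.comp_apply, e2, map_smul, map_smul, e1,
          G.tensor.slice_tmul hψ, smul_comm]
      | add x y hx hy =>
        simp only [map_add, smul_add, TensorProduct.add_tmul] at hx hy ⊢
        rw [hx, hy]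
  rw [convLeft_apply, convRight_apply, h1, G.coassoc]
  rw [convRight_apply, convLeft_apply, h2]
  exact congrArg (fun f : G.A₃ →L[ℂ] A => f (G.idComul (G.comul a))) h3

end CompactQuantumGroup

/-! ### The Haar state -/

theorem MinTensor.swap_swap {A B C : Type u} [CStarAlgebra A] [CStarAlgebra B]
    [CStarAlgebra C] (M : MinTensor A B C) : M.swap.swap = M := by
  have h : M.swap.swap.emb = M.emb := StarAlgHom.ext fun x => congrArg M.emb (comm_comm x)
  cases M
  simp only [MinTensor.swap] at h ⊢
  congr

theorem CompactQuantumGroup.cop_convLeft {A : Type u} [CStarAlgebra A] (G : CompactQuantumGroup A)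
    (ω : A →ₗ[ℂ] ℂ) : G.cop.convLeft ω = G.convRight ω := by
  have : G.cop.tensor.swap = G.tensor := G.tensor.swap_swap
  rw [convLeft, this]
  rfl

section StateLimits

variable {A : Type u} [CStarAlgebra A]

/-- Weak* compactness of the state space: pointwise limits of states along ultrafilters exist and
are states. -/
theorem exists_isState_tendsto {I : Type*} (U : Ultrafilter I) (φ : I → A →ₗ[ℂ] ℂ)
    (hφ : ∀ i, IsState (φ i)) :
    ∃ h : A →ₗ[ℂ] ℂ, IsState h ∧ ∀ a, Filter.Tendsto (fun i => φ i a) U (nhds (h a)) := by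
  have hex : ∀ a : A, ∃ z : ℂ, Filter.Tendsto (fun i => φ i a) U (nhds z) := fun a => by
    obtain ⟨z, -, hz⟩ := (isCompact_closedBall (0 : ℂ) ‖a‖).ultrafilter_le_nhds
      (U.map fun i => φ i a) (by
        simp only [Ultrafilter.coe_map, Filter.le_principal_iff, Filter.mem_map]
        exact Filter.Eventually.of_forall fun i => by simpa using (hφ i).norm_le a)
    exact ⟨z, hz⟩
  choose h hh using hex
  refine ⟨⟨⟨h, fun a b => ?_⟩, fun c a => ?_⟩, ⟨?_, fun a => ?_⟩, hh⟩
  · refine tendsto_nhds_unique (hh (a + b)) ?_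
    simpa using (hh a).add (hh b)
  · refine tendsto_nhds_unique (hh (c • a)) ?_
    simpa using (hh a).const_mul c
  · refine tendsto_nhds_unique (hh 1) ?_
    simp [(hφ _).1]
  · exact isClosed_Ici.mem_of_tendsto (hh (star a * a))
      (Filter.Eventually.of_forall fun i => (hφ i).2 a)

theorem isState_average {I : Type*} {F : Finset I} (hF : F.Nonempty) {φ : I → A →ₗ[ℂ] ℂ}
    (hφ : ∀ i, IsState (φ i)) : IsState ((F.card : ℂ)⁻¹ • ∑ i ∈ F, φ i) := by
  have hc : (F.card : ℂ) ≠ 0 := by simpa using hF.ne_empty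
  refine ⟨by simp [LinearMap.sum_apply, (hφ _).1, hc], fun a => ?_⟩
  rw [LinearMap.smul_apply, LinearMap.sum_apply, smul_eq_mul]
  have : (0 : ℂ) ≤ (F.card : ℂ)⁻¹ := by
    rw [show ((F.card : ℂ)⁻¹) = (((F.card : ℝ)⁻¹ : ℝ) : ℂ) by push_cast; rfl]
    exact_mod_cast inv_nonneg.2 (Nat.cast_nonneg _)
  exact mul_nonneg this (Finset.sum_nonneg fun i _ => (hφ i).2 a)

end StateLimits

theorem MinTensor.exists_isState {A B C : Type u} [CStarAlgebra A] [CStarAlgebra B]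
    [CStarAlgebra C] (M : MinTensor A B C) : ∃ φ : A →ₗ[ℂ] ℂ, IsState φ := by
  by_contra! hne
  -- without states the set in `norm_sq` is empty, and the empty set has no supremum in `ℝ`
  have h : ‖M.emb 0‖ ^ 2 ≤ ‖M.emb 0‖ ^ 2 - 1 := (isLUB_le_iff (M.norm_sq 0)).2 (by
    rintro r ⟨φ, -, -, hφ, -⟩
    exact absurd hφ (hne φ))
  linarith

namespace CompactQuantumGroup

variable {A : Type u} [CStarAlgebra A] (G : CompactQuantumGroup A)

/-- A Cesàro limit of the convolution powers of `ω` is invariant under convolution by `ω` on both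
sides. -/
theorem exists_conv_invariant {ω : A →ₗ[ℂ] ℂ} (hω : IsState ω) :
    ∃ h : A →ₗ[ℂ] ℂ, IsState h ∧ (∀ a, h (G.convRight ω a) = h a) ∧
      ∀ a, h (G.convLeft ω a) = h a := by
  let R : A →ₗ[ℂ] A := G.convRight ω
  have hR : ∀ a, R a = G.convRight ω a := fun _ => rfl
  let p : ℕ → A →ₗ[ℂ] ℂ := fun k => ω ∘ₗ (R ^ k)
  have hp : ∀ k, IsState (p k) := by
    intro k
    induction k with
    | zero => exact hω
    | succ k ih =>
      have e : p (k + 1) = p k ∘ₗ (G.convRight ω : A →ₗ[ℂ] A) := by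
        ext a; simp [p, pow_succ, R]
      rw [e]
      exact G.isState_convRight ih hω
  have hpR : ∀ k a, p k (G.convRight ω a) = p (k + 1) a := fun k a => by simp [p, pow_succ, R]
  have hpL : ∀ k a, p k (G.convLeft ω a) = p (k + 1) a := by
    intro k
    have comm : ∀ k a, (R ^ k) (G.convLeft ω a) = G.convLeft ω ((R ^ k) a) := by
      intro k
      induction k with
      | zero => intro a; rfl
      | succ k ih =>
        intro a
        rw [pow_succ, Module.End.mul_apply, Module.End.mul_apply, hR,
          ← G.convLeft_convRight hω hω, ih, hR]
    intro a
    change ω ((R ^ k) _) = ω ((R ^ (k + 1)) a)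
    rw [comm, ← G.map_convRight hω hω, pow_succ', Module.End.mul_apply, hR]
  let q : ℕ → A →ₗ[ℂ] ℂ := fun n => ((Finset.range (n + 1)).card : ℂ)⁻¹ •
    ∑ k ∈ Finset.range (n + 1), p k
  have hq : ∀ n, IsState (q n) := fun n => isState_average (by simp) hp
  obtain ⟨h, hh, hlim⟩ := exists_isState_tendsto (Filter.hyperfilter ℕ) q hq
  have main : ∀ T : A → A, (∀ k a, p k (T a) = p (k + 1) a) → ∀ a, h (T a) = h a := by
    intro T hT a
    have hdiff : ∀ n, q n (T a) - q n a = ((n : ℂ) + 1)⁻¹ * (p (n + 1) a - p 0 a) := fun n => by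
      simp only [q, Finset.card_range, LinearMap.smul_apply, LinearMap.sum_apply, hT, smul_eq_mul,
        ← mul_sub, ← Finset.sum_sub_distrib, Finset.sum_range_sub (fun k => p k a)]
      push_cast
      rfl
    have h0 : Filter.Tendsto (fun n => q n (T a) - q n a) (Filter.hyperfilter ℕ) (nhds 0) := by
      refine Filter.Tendsto.mono_left ?_ Nat.hyperfilter_le_atTop
      refine squeeze_zero_norm (a := fun n : ℕ => 1 / ((n : ℝ) + 1) * (2 * ‖a‖)) (fun n => ?_) ?_
      · rw [hdiff, norm_mul, norm_inv, one_div]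
        have e : ‖(n : ℂ) + 1‖ = (n : ℝ) + 1 := by
          rw [show (n : ℂ) + 1 = ((n + 1 : ℕ) : ℂ) by push_cast; rfl, Complex.norm_natCast]
          push_cast; rfl
        rw [e]
        gcongr
        refine (norm_sub_le _ _).trans ?_
        linarith [(hp (n + 1)).norm_le a, (hp 0).norm_le a]
      · simpa using tendsto_one_div_add_atTop_nhds_zero_nat.mul_const (2 * ‖a‖)
    have := tendsto_nhds_unique h0 ((hlim (T a)).sub (hlim a))
    exact sub_eq_zero.1 this.symm
  exact ⟨h, hh, main _ hpR, main _ hpL⟩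

/-- Right convolutions compose to the convolution by the product `(ρ ⊗ h) Δ = h ∘ convLeft ρ`. -/
theorem convRight_convRight {h ρ : A →ₗ[ℂ] ℂ} (hh : IsState h) (hρ : IsState ρ) (a : A) :
    G.convRight ρ (G.convRight h a) = G.convRight (h ∘ₗ (G.convLeft ρ : A →ₗ[ℂ] A)) a := by
  refine eq_of_isState fun φ hφ => ?_
  rw [G.map_convRight hφ hρ, G.convLeft_convRight hφ hh, G.map_convRight hρ hh,
    G.map_convRight hφ (G.isState_convLeft hh hρ)]
  rfl

/-- A state invariant under convolution by an average of states is left invariant under each of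
them. This is where the density of `(A ⊗ 1) Δ(A)` enters. -/
theorem convLeft_invariant_of_average {I : Type*} {F : Finset I} {φ : I → A →ₗ[ℂ] ℂ}
    (hφ : ∀ i, IsState (φ i)) {i : I} (hi : i ∈ F) {h : A →ₗ[ℂ] ℂ} (hh : IsState h)
    (hR : ∀ a, h (G.convRight ((F.card : ℂ)⁻¹ • ∑ i ∈ F, φ i) a) = h a)
    (hL : ∀ a, h (G.convLeft ((F.card : ℂ)⁻¹ • ∑ i ∈ F, φ i) a) = h a) (x : A) :
    h (G.convLeft (φ i) x) = h x := by
  have hF : F.Nonempty := ⟨i, hi⟩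
  have hω := isState_average hF hφ
  set ω := (F.card : ℂ)⁻¹ • ∑ i ∈ F, φ i with hωdef
  have hc : (F.card : ℂ)⁻¹ ≠ 0 := by simpa using hF.ne_empty
  set h' : A →ₗ[ℂ] ℂ := h ∘ₗ (G.convLeft (φ i) : A →ₗ[ℂ] A) with hh'def
  have hh' : IsState h' := G.isState_convLeft hh (hφ i)
  have main : ∀ c a, h (c * G.convRight h' a) = h (c * G.convRight h a) := by
    intro c a
    set b := G.convRight h a with hb
    have hωb : G.convRight ω b = b := by
      rw [hb, G.convRight_convRight hh hω]
      congr 2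
      exact LinearMap.ext hL
    -- `(h ⊗ ω)(X⋆ X) = 0` for `X = Δ(b) - b ⊗ 1`
    set X := G.comul b - G.tensor.emb (b ⊗ₜ 1) with hX
    have hsX : star X = G.comul (star b) - G.tensor.emb (star b ⊗ₜ 1) := by
      rw [hX, star_sub, ← map_star G.comul, ← map_star G.tensor.emb, TensorProduct.star_tmul,
        star_one]
    have h0 : h (G.tensor.slice ω (star X * X)) = 0 := by
      have e : G.tensor.slice ω (star X * X) = G.convRight ω (star b * b) - star b * b := by
        rw [hsX, hX, mul_sub, sub_mul, sub_mul, map_sub, map_sub, map_sub,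
          G.tensor.slice_mul_left hω, G.tensor.slice_mul_right hω, G.tensor.slice_mul_left hω,
          ← map_mul, G.tensor.slice_tmul hω, hω.1, one_smul, ← convRight_apply,
          ← convRight_apply, ← convRight_apply, hωb, G.convRight_star hω, hωb, sub_self, sub_zero]
      rw [e, map_sub, hR, sub_self]
    have h1 : h (G.tensor.slice (φ i) (star X * X)) = 0 := by
      have hnn : ∀ j ∈ F, 0 ≤ h (G.tensor.slice (φ j) (star X * X)) := fun j _ =>
        (G.tensor.isState_slice hh (hφ j)).2 X
      rw [slice_slice _ hh hω, hωdef, LinearMap.smul_apply, LinearMap.sum_apply, smul_eq_mul] at h0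
      have h0' := (mul_eq_zero.1 h0).resolve_left hc
      rw [Finset.sum_congr rfl fun j _ => (slice_slice G.tensor hh (hφ j) _).symm] at h0'
      exact (Finset.sum_eq_zero_iff_of_nonneg hnn).1 h0' i hi
    have h2 := (G.tensor.isState_slice hh (hφ i)).map_mul_eq_zero h1 (G.tensor.emb (c ⊗ₜ 1))
    rw [LinearMap.comp_apply, ContinuousLinearMap.coe_coe, G.tensor.slice_mul_left (hφ i), hX,
      map_sub, ← convRight_apply, G.tensor.slice_tmul (hφ i), (hφ i).1, one_smul, mul_sub, map_sub,
      sub_eq_zero, hb, G.convRight_convRight hh (hφ i)] at h2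
    exact h2
  have hhc := hh.continuous
  have heq : (fun z => h (G.tensor.slice h' z)) = fun z => h (G.tensor.slice h z) := by
    refine Continuous.ext_on G.cancel_left (by fun_prop) (by fun_prop) fun z hz => ?_
    induction hz using Submodule.span_induction with
    | mem z hz =>
      obtain ⟨a, b, rfl⟩ := hz
      simp only [G.tensor.slice_mul_left hh', G.tensor.slice_mul_left hh]
      exact main a b
    | zero => simp
    | add x y _ _ hx hy => simp only [map_add] at hx hy ⊢; rw [hx, hy]
    | smul c x _ hx => simp only [map_smul] at hx ⊢; rw [hx]
  have := congrFun heq (G.tensor.emb (1 ⊗ₜ x))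
  simp only [G.tensor.slice_tmul hh', G.tensor.slice_tmul hh, map_smul, hh.1, smul_eq_mul,
    mul_one] at this
  exact this

/-- Finitely many states have a common left invariant state, namely an invariant state of their
average; weak* compactness passes to all states at once. -/
theorem exists_left_invariant :
    ∃ h : A →ₗ[ℂ] ℂ, IsState h ∧ ∀ ρ : A →ₗ[ℂ] ℂ, IsState ρ → ∀ a, h (G.convLeft ρ a) = h a := by
  classical
  obtain ⟨φ₀, hφ₀⟩ := G.tensor.exists_isState
  let S := {φ : A →ₗ[ℂ] ℂ // IsState φ}
  have hfin : ∀ F : Finset S, ∃ h : A →ₗ[ℂ] ℂ, IsState h ∧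
      ∀ ρ ∈ F, ∀ a, h (G.convLeft ρ.1 a) = h a := by
    intro F
    rcases F.eq_empty_or_nonempty with rfl | hF
    · exact ⟨φ₀, hφ₀, by simp⟩
    · obtain ⟨h, hh, hR, hL⟩ := G.exists_conv_invariant
        (isState_average hF (φ := fun i : S => i.1) fun i => i.2)
      exact ⟨h, hh, fun ρ hρ a =>
        G.convLeft_invariant_of_average (fun i : S => i.2) hρ hh hR hL a⟩
  choose h hh hinv using hfin
  obtain ⟨k, hk, hlim⟩ := exists_isState_tendsto (Ultrafilter.of Filter.atTop) h hh
  refine ⟨k, hk, fun ρ hρ a => ?_⟩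
  refine tendsto_nhds_unique ((hlim _).congr' ?_) (hlim a)
  refine Ultrafilter.of_le _ ?_
  filter_upwards [Filter.eventually_ge_atTop {(⟨ρ, hρ⟩ : S)}] with F hF
  exact hinv F ⟨ρ, hρ⟩ (hF (Finset.mem_singleton_self _)) a

/-- The Haar state: a two-sided invariant state. -/
structure IsHaar (h : A →ₗ[ℂ] ℂ) : Prop where
  isState : IsState h
  convRight_eq : ∀ a, G.convRight h a = h a • 1
  convLeft_eq : ∀ a, G.convLeft h a = h a • 1

/-- A left invariant and a right invariant state coincide, since each absorbs the other under
convolution. -/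
theorem exists_isHaar : ∃ h : A →ₗ[ℂ] ℂ, G.IsHaar h := by
  obtain ⟨h, hh, hinv⟩ := G.exists_left_invariant
  obtain ⟨h', hh', hinv'⟩ := G.cop.exists_left_invariant
  have e : h' = h := by
    ext a
    rw [← hinv h' hh' a, ← G.map_convRight hh' hh, ← hinv' h hh a,
      G.cop_convLeft]
  subst e
  refine ⟨h', hh, fun a => eq_of_isState fun φ hφ => ?_, fun a => eq_of_isState fun φ hφ => ?_⟩
  · rw [G.map_convRight hφ hh, hinv φ hφ, map_smul, hφ.1, smul_eq_mul, mul_one]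
  · rw [← G.map_convRight hh hφ, map_smul, hφ.1, smul_eq_mul, mul_one]
    rw [← G.cop_convLeft]
    exact hinv' φ hφ a

theorem IsHaar.cop {h : A →ₗ[ℂ] ℂ} (hh : G.IsHaar h) : G.cop.IsHaar h :=
  ⟨hh.1, hh.3, fun a => by rw [G.cop_convLeft]; exact hh.2 a⟩

end CompactQuantumGroup

/-! ### Conjugate corepresentations -/

section Scal

variable {A : Type u} [CStarAlgebra A] {m n : Type}

theorem scal_apply (T : Matrix m n ℂ) (i : m) (j : n) : scal A T i j = algebraMap ℂ A (T i j) := rfl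

theorem scal_conjTranspose (T : Matrix m n ℂ) : (scal A T)ᴴ = scal A Tᴴ := by
  ext i j
  rw [Matrix.conjTranspose_apply, scal_apply, scal_apply, Matrix.conjTranspose_apply,
    algebraMap_star_comm]

theorem scal_map {B : Type u} [CStarAlgebra B] (f : A →⋆ₐ[ℂ] B) (T : Matrix m n ℂ) :
    (scal A T).map f = scal B T := by
  ext i j
  exact AlgHomClass.commutes f (T i j)

end Scal

namespace CompactQuantumGroup

variable {A : Type u} [CStarAlgebra A] (G : CompactQuantumGroup A) {n : Type} [Fintype n]

/-- Finite-dimensional unitary corepresentations in matrix form. -/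
structure IsUnitaryCorep [DecidableEq n] (v : Matrix n n A) : Prop where
  mul_conjTranspose : v * vᴴ = 1
  conjTranspose_mul : vᴴ * v = 1
  comul_mat : ∀ i j, G.comul (v i j) = ∑ k, G.tensor.emb (v i k ⊗ₜ v k j)

theorem emb_mul_emb (a b c d : A) :
    G.tensor.emb (a ⊗ₜ b) * G.tensor.emb (c ⊗ₜ d) = G.tensor.emb ((a * c) ⊗ₜ (b * d)) := by
  rw [← map_mul, Algebra.TensorProduct.tmul_mul_tmul]

theorem star_emb (a b : A) : star (G.tensor.emb (a ⊗ₜ b)) = G.tensor.emb (star a ⊗ₜ star b) := by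
  rw [← map_star, TensorProduct.star_tmul]

theorem comul_star_mat {v : Matrix n n A}
    (hv : ∀ i j, G.comul (v i j) = ∑ k, G.tensor.emb (v i k ⊗ₜ v k j)) (i j : n) :
    G.comul (star (v i j)) = ∑ k, G.tensor.emb (star (v i k) ⊗ₜ star (v k j)) := by
  rw [map_star, hv, star_sum]
  simp_rw [star_emb]

/-- The adjoint matrix of a unitary corepresentation is one of the co-opposite quantum group. -/
theorem IsUnitaryCorep.cop [DecidableEq n] {v : Matrix n n A} (hv : G.IsUnitaryCorep v) :
    G.cop.IsUnitaryCorep vᴴ := by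
  refine ⟨by simpa using hv.2, by simpa using hv.1, fun i j => ?_⟩
  exact (G.comul_star_mat hv.3 j i).trans
    (Finset.sum_congr rfl fun k _ => (G.tensor.swap_emb_tmul _ _).symm)

/-- The matrix with entries `∑ᵢ h(vⱼᵢ⋆ vₖᵢ)` attached to a corepresentation `v`. -/
def modularMatrix (h : A →ₗ[ℂ] ℂ) (v : Matrix n n A) : Matrix n n ℂ :=
  Matrix.of fun j k => ∑ i, h (star (v j i) * v k i)

variable {G} {h : A →ₗ[ℂ] ℂ}

/-- Invariance of the Haar state, applied to `∑ᵢ vⱼᵢ⋆ vₖᵢ`: in terms of the modular matrix `E` and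
the conjugate `w` of `v`, this reads `w E w⋆ = E`. -/
theorem IsHaar.sum_modularMatrix [DecidableEq n] (hh : G.IsHaar h) {v : Matrix n n A}
    (hv : G.IsUnitaryCorep v) (j k : n) :
    ∑ a, ∑ b, modularMatrix h v a b • (star (v j a) * v k b) = modularMatrix h v j k • (1 : A) := by
  have key : ∀ i, ∑ a, ∑ b, h (star (v a i) * v b i) • (star (v j a) * v k b) =
      h (star (v j i) * v k i) • (1 : A) := fun i => by
    rw [← hh.convRight_eq, convRight_apply, map_mul, G.comul_star_mat hv.3, hv.3,
      Finset.sum_mul_sum]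
    simp only [emb_mul_emb, map_sum, G.tensor.slice_tmul hh.isState]
  simp only [modularMatrix, Matrix.of_apply, Finset.sum_smul, ← key]
  rw [Finset.sum_comm (s := Finset.univ (α := n)) (t := Finset.univ (α := n))
    (f := fun i a => ∑ b, h (star (v a i) * v b i) • (star (v j a) * v k b))]
  refine Finset.sum_congr rfl fun a _ => ?_
  rw [Finset.sum_comm]

/-- The product `h ⊗ h` on the dense set spanned by `(1 ⊗ A) Δ(A)`. -/
theorem IsHaar.slice_mul_comul (hh : G.IsHaar h) (c y : A) :
    h (G.tensor.slice h (G.tensor.emb (1 ⊗ₜ c) * G.comul y)) = h c * h y := by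
  rw [slice_slice _ hh.isState hh.isState, ← G.tensor.swap_emb_tmul,
    G.tensor.swap.slice_mul_left hh.isState, ← convLeft_apply, hh.convLeft_eq, mul_smul_comm,
    mul_one, map_smul, smul_eq_mul, mul_comm]

/-- If the Haar state annihilates `A aₖ` for the row `aₖ = ∑ᵢ ξᵢ vᵢₖ`, then `ξ = 0`. The Haar state
need not be faithful on `A`; the density of `(1 ⊗ A) Δ(A)` is used instead, through
`vₘᵢ⋆ ⊗ 1 = ∑ₖ (1 ⊗ vᵢₖ) Δ(vₘₖ⋆)`. -/
theorem IsHaar.eq_zero_of_row [DecidableEq n] (hh : G.IsHaar h) {v : Matrix n n A}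
    (hv : G.IsUnitaryCorep v) (ξ : n → ℂ) (hξ : ∀ k x, h (x * ∑ i, ξ i • v i k) = 0) : ξ = 0 := by
  have hleg : ∀ m i, G.tensor.emb (star (v m i) ⊗ₜ 1) =
      ∑ k, G.tensor.emb (1 ⊗ₜ v i k) * G.comul (star (v m k)) := fun m i => by
    simp only [G.comul_star_mat hv.3, Finset.mul_sum, emb_mul_emb, one_mul]
    rw [Finset.sum_comm]
    have e : ∀ l, ∑ k, v i k * star (v l k) = (1 : Matrix n n A) i l := fun l => by
      rw [← hv.mul_conjTranspose, Matrix.mul_apply]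
      rfl
    simp only [← map_sum, ← TensorProduct.tmul_sum, e]
    rw [Finset.sum_eq_single i (fun l _ hl => by rw [Matrix.one_apply_ne' hl]; simp) (by simp)]
    rw [Matrix.one_apply_eq]
  -- `(h ⊗ h)((∑ᵢ ξᵢ vₘᵢ⋆ ⊗ 1) z)` vanishes on `(1 ⊗ A) Δ(A)`, hence everywhere
  have hdense : ∀ m, (fun z => ∑ i, ξ i • h (G.tensor.slice h
      (G.tensor.emb (star (v m i) ⊗ₜ 1) * z))) = fun _ => 0 := by
    intro m
    have hhc := hh.isState.continuous
    refine Continuous.ext_on G.cancel_right (by fun_prop) (by fun_prop) fun z hz => ?_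
    induction hz using Submodule.span_induction with
    | mem z hz =>
      obtain ⟨a, b, rfl⟩ := hz
      have e : ∀ i, h (G.tensor.slice h (G.tensor.emb (star (v m i) ⊗ₜ 1) *
          (G.tensor.emb (1 ⊗ₜ a) * G.comul b))) = ∑ k, h (a * v i k) * h (star (v m k) * b) := by
        intro i
        rw [← mul_assoc, emb_mul_emb, one_mul, mul_one,
          show (star (v m i) ⊗ₜ[ℂ] a : A ⊗[ℂ] A) = (1 ⊗ₜ a) * (star (v m i) ⊗ₜ 1) by simp,
          map_mul G.tensor.emb, hleg, Finset.mul_sum, Finset.sum_mul, map_sum, map_sum]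
        refine Finset.sum_congr rfl fun k _ => ?_
        rw [← mul_assoc, emb_mul_emb, one_mul, mul_assoc, ← map_mul, hh.slice_mul_comul]
      simp only [e, Finset.smul_sum]
      rw [Finset.sum_comm]
      refine Finset.sum_eq_zero fun k _ => ?_
      have := hξ k a
      simp only [Finset.mul_sum, mul_smul_comm, map_sum, map_smul] at this
      simp only [← smul_mul_assoc]
      rw [← Finset.sum_mul, this, zero_mul]
    | zero => simp
    | add x y _ _ hx hy =>
      simp only [mul_add, map_add, smul_add, Finset.sum_add_distrib] at hx hy ⊢
      rw [hx, hy, add_zero]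
    | smul c x _ hx =>
      simp only [mul_smul_comm, map_smul] at hx ⊢
      simp only [smul_comm _ c, ← Finset.smul_sum, hx, smul_zero]
  have hrow : ∀ m x, ∑ i, ξ i * h (star (v m i) * x) = 0 := fun m x => by
    have := congrFun (hdense m) (G.tensor.emb (x ⊗ₜ 1))
    simpa [emb_mul_emb, G.tensor.slice_tmul hh.isState, hh.isState.1] using this
  have horth : ∀ i j, ∑ m, star (v m i) * v m j = (1 : Matrix n n A) i j := fun i j => by
    rw [← hv.conjTranspose_mul, Matrix.mul_apply]
    rfl
  have hcol : ∀ j, ξ j = 0 := fun j => by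
    have h1 : ∑ m, ∑ i, ξ i * h (star (v m i) * v m j) = 0 :=
      Finset.sum_eq_zero fun m _ => hrow m _
    rw [Finset.sum_comm] at h1
    simp only [← Finset.mul_sum, ← map_sum, horth] at h1
    rw [Finset.sum_eq_single j (fun l _ hl => by rw [Matrix.one_apply_ne hl]; simp) (by simp),
      Matrix.one_apply_eq, hh.isState.1, mul_one] at h1
    exact h1
  exact funext hcol

theorem IsHaar.posDef_modularMatrix [DecidableEq n] (hh : G.IsHaar h) {v : Matrix n n A}
    (hv : G.IsUnitaryCorep v) : (modularMatrix h v).PosDef := by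
  refine Matrix.PosDef.of_dotProduct_mulVec_pos ?_ fun x hx => ?_
  · ext j k
    simp only [Matrix.conjTranspose_apply, modularMatrix, Matrix.of_apply, star_sum,
      ← hh.isState.map_star, star_mul, star_star]
  · have e' : ∀ i, h (star (∑ k, x k • v k i) * ∑ k, x k • v k i) =
        ∑ j, ∑ k, star (x j) * x k * h (star (v j i) * v k i) := fun i => by
      simp only [star_sum, Finset.sum_mul_sum, star_smul, smul_mul_smul_comm, map_sum, map_smul,
        smul_eq_mul]
    have e : star x ⬝ᵥ (modularMatrix h v *ᵥ x) =
        ∑ i, h (star (∑ k, x k • v k i) * ∑ k, x k • v k i) := by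
      simp_rw [e']
      simp only [dotProduct, Matrix.mulVec, modularMatrix, Matrix.of_apply, Pi.star_apply,
        Finset.mul_sum, Finset.sum_mul]
      conv_rhs => rw [Finset.sum_comm]
      refine Finset.sum_congr rfl fun j _ => ?_
      conv_rhs => rw [Finset.sum_comm]
      exact Finset.sum_congr rfl fun k _ => Finset.sum_congr rfl fun i _ => by ring
    have hnn : ∀ i ∈ Finset.univ, 0 ≤ h (star (∑ k, x k • v k i) * ∑ k, x k • v k i) :=
      fun i _ => hh.isState.2 _
    rw [e]
    refine lt_of_le_of_ne (Finset.sum_nonneg hnn) fun h0 => hx ?_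
    have h1 := (Finset.sum_eq_zero_iff_of_nonneg hnn).1 h0.symm
    exact hh.eq_zero_of_row hv x fun k y =>
      hh.isState.map_mul_eq_zero (h1 k (Finset.mem_univ k)) y

variable (G)

/-- The leg embedding `a ↦ a ⊗ 1`. -/
def leg₁ : A →⋆ₐ[ℂ] G.A₂ :=
  G.tensor.emb.comp
    { (Algebra.TensorProduct.includeLeft : A →ₐ[ℂ] A ⊗[ℂ] A) with
      map_star' := fun x => by simp }

/-- The leg embedding `a ↦ 1 ⊗ a`. -/
def leg₂ : A →⋆ₐ[ℂ] G.A₂ :=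
  G.tensor.emb.comp
    { (Algebra.TensorProduct.includeRight : A →ₐ[ℂ] A ⊗[ℂ] A) with
      map_star' := fun x => by simp }

theorem leg₁_mul_leg₂ (a b : A) : G.leg₁ a * G.leg₂ b = G.tensor.emb (a ⊗ₜ b) :=
  (G.emb_mul_emb a 1 1 b).trans (by rw [one_mul, mul_one])

/-- The corepresentation identity `Δ(v) = v₁₂ v₁₃` in matrix form. -/
theorem comul_mat_iff {v : Matrix n n A} :
    (∀ i j, G.comul (v i j) = ∑ k, G.tensor.emb (v i k ⊗ₜ v k j)) ↔
      v.map G.comul = v.map G.leg₁ * v.map G.leg₂ := by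
  simp only [← Matrix.ext_iff, Matrix.map_apply, Matrix.mul_apply, leg₁_mul_leg₂]

theorem map_scal_mul {B : Type u} [CStarAlgebra B] (f : A →⋆ₐ[ℂ] B) (S T : Matrix n n ℂ)
    (v : Matrix n n A) : (scal A S * v * scal A T).map f = scal B S * v.map f * scal B T := by
  rw [Matrix.map_mul, Matrix.map_mul, scal_map, scal_map]

theorem comul_mat_conj [DecidableEq n] {v : Matrix n n A}
    (hv : ∀ i j, G.comul (v i j) = ∑ k, G.tensor.emb (v i k ⊗ₜ v k j)) {S T : Matrix n n ℂ}
    (hTS : T * S = 1) (i j : n) :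
    G.comul ((scal A S * v * scal A T) i j) =
      ∑ k, G.tensor.emb ((scal A S * v * scal A T) i k ⊗ₜ (scal A S * v * scal A T) k j) := by
  revert i j
  rw [comul_mat_iff] at hv ⊢
  have e : scal G.A₂ T * scal G.A₂ S = 1 := by rw [← scal_mul, hTS, scal_one]
  rw [map_scal_mul, map_scal_mul, map_scal_mul, hv]
  calc scal G.A₂ S * (v.map G.leg₁ * v.map G.leg₂) * scal G.A₂ T
      = scal G.A₂ S * v.map G.leg₁ * (1 : Matrix n n G.A₂) * v.map G.leg₂ * scal G.A₂ T := by
        rw [mul_one]; simp only [mul_assoc]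
    _ = _ := by rw [← e]; simp only [mul_assoc]

variable {G}

theorem scal_mul_apply (T : Matrix n n ℂ) (v w : Matrix n n A) (i j : n) :
    (v * scal A T * w) i j = ∑ a, ∑ b, T a b • (v i a * w b j) := by
  simp only [Matrix.mul_apply, Finset.sum_mul, scal_apply]
  rw [Finset.sum_comm]
  refine Finset.sum_congr rfl fun a _ => Finset.sum_congr rfl fun b _ => ?_
  rw [← Algebra.commutes, mul_assoc, Algebra.smul_def]

theorem IsHaar.conjMat_mul_modularMatrix [DecidableEq n] (hh : G.IsHaar h) {v : Matrix n n A}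
    (hv : G.IsUnitaryCorep v) :
    conjMat v * scal A (modularMatrix h v) * (conjMat v)ᴴ = scal A (modularMatrix h v) := by
  ext i j
  rw [scal_mul_apply, scal_apply, Algebra.algebraMap_eq_smul_one, ← hh.sum_modularMatrix hv]
  simp [conjMat]

theorem IsHaar.conjTranspose_conjMat_mul_modularMatrix [DecidableEq n] (hh : G.IsHaar h)
    {v : Matrix n n A} (hv : G.IsUnitaryCorep v) :
    (conjMat v)ᴴ * scal A (modularMatrix h vᴴ) * conjMat v = scal A (modularMatrix h vᴴ) := by
  ext i j
  rw [scal_mul_apply, scal_apply, Algebra.algebraMap_eq_smul_one,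
    ← hh.cop.sum_modularMatrix hv.cop]
  simp [conjMat]

open scoped MatrixOrder in
theorem exists_eq_conjTranspose_mul_self [DecidableEq n] {E : Matrix n n ℂ} (hE : E.PosDef) :
    ∃ Q R : Matrix n n ℂ, E = Qᴴ * Q ∧ Q * R = 1 ∧ R * Q = 1 := by
  obtain ⟨y, hy, rfl⟩ := CStarAlgebra.isStrictlyPositive_iff_eq_star_mul_self.mp
    hE.isStrictlyPositive
  lift y to (Matrix n n ℂ)ˣ using hy
  exact ⟨y, ↑y⁻¹, rfl, y.mul_inv, y.inv_mul⟩

/-- The conjugate of a unitary corepresentation is equivalent to a unitary one: the two modular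
matrices are positive definite, which makes the conjugate invertible and, after conjugation by a
square root of one of them, isometric. -/
theorem IsUnitaryCorep.exists_conj [DecidableEq n] {v : Matrix n n A} (hv : G.IsUnitaryCorep v) :
    ∃ Q R : Matrix n n ℂ, Q * R = 1 ∧ R * Q = 1 ∧
      G.IsUnitaryCorep (scal A Q * conjMat v * scal A R) := by
  obtain ⟨h, hh⟩ := G.exists_isHaar
  obtain ⟨Q, R, hE, hQR, hRQ⟩ :=
    exists_eq_conjTranspose_mul_self (hh.cop.posDef_modularMatrix hv.cop)
  obtain ⟨Q', R', hE', hQR', hRQ'⟩ :=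
    exists_eq_conjTranspose_mul_self (hh.posDef_modularMatrix hv)
  have h1 := hh.conjTranspose_conjMat_mul_modularMatrix hv
  have h2 := hh.conjMat_mul_modularMatrix hv
  rw [hE] at h1
  set w := conjMat v with hw
  set E := modularMatrix h v with hEdef
  refine ⟨Q, R, hQR, hRQ, ?_⟩
  have hQR₁ : scal A Q * scal A R = 1 := by rw [← scal_mul, hQR, scal_one]
  have hRQ₁ : scal A R * scal A Q = 1 := by rw [← scal_mul, hRQ, scal_one]
  have hEinv : E * (R' * R'ᴴ) = 1 := by
    rw [hE']
    calc Q'ᴴ * Q' * (R' * R'ᴴ) = Q'ᴴ * (Q' * R') * R'ᴴ := by simp only [mul_assoc]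
      _ = 1 := by rw [hQR', mul_one, ← Matrix.conjTranspose_mul, hRQ', Matrix.conjTranspose_one]
  have hEinv₁ : scal A E * scal A (R' * R'ᴴ) = 1 := by rw [← scal_mul, hEinv, scal_one]
  have hl : (scal A Q * w * scal A R)ᴴ * (scal A Q * w * scal A R) = 1 := by
    rw [Matrix.conjTranspose_mul, Matrix.conjTranspose_mul, scal_conjTranspose, scal_conjTranspose]
    calc scal A Rᴴ * (wᴴ * scal A Qᴴ) * (scal A Q * w * scal A R)
        = scal A Rᴴ * (wᴴ * (scal A Qᴴ * scal A Q) * w) * scal A R := by simp only [mul_assoc]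
      _ = (scal A Rᴴ * scal A Qᴴ) * (scal A Q * scal A R) := by
          rw [← scal_mul, h1, scal_mul]; simp only [mul_assoc]
      _ = 1 := by
          rw [hQR₁, ← scal_mul, ← Matrix.conjTranspose_mul, hQR, Matrix.conjTranspose_one, scal_one,
            mul_one]
  -- `E w* E⁻¹` is a right inverse of `w`, so the isometry of `hl` is unitary
  have hr : (scal A Q * w * scal A R) *
      (scal A Q * (scal A E * wᴴ * scal A (R' * R'ᴴ)) * scal A R) = 1 := by
    calc (scal A Q * w * scal A R) * (scal A Q * (scal A E * wᴴ * scal A (R' * R'ᴴ)) * scal A R)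
        = scal A Q * w * (scal A R * scal A Q) * (scal A E * wᴴ * scal A (R' * R'ᴴ)) *
            scal A R := by
          simp only [mul_assoc]
      _ = scal A Q * (w * scal A E * wᴴ) * scal A (R' * R'ᴴ) * scal A R := by
          rw [hRQ₁, mul_one]; simp only [mul_assoc]
      _ = 1 := by rw [h2, mul_assoc (scal A Q), hEinv₁, mul_one, hQR₁]
  refine ⟨?_, hl, fun i j => G.comul_mat_conj (fun i j => ?_) hRQ i j⟩
  · rwa [left_inv_eq_right_inv hl hr]
  · exact G.comul_star_mat hv.comul_mat i j

theorem IrrCorep.isUnitaryCorep (v : G.IrrCorep) : G.IsUnitaryCorep v.mat :=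
  ⟨v.unitary.1, v.unitary.2, v.comul_mat⟩

/-- Entrywise conjugation of intertwiners. It reverses products in `A`, which is harmless because
one factor of each product is a scalar. -/
theorem mem_Mor_conjMat {v w : Matrix n n A} {T : Matrix n n ℂ}
    (hT : T ∈ Mor (conjMat v) (conjMat w)) : T.map star ∈ Mor v w := by
  rw [mem_Mor] at hT ⊢
  ext i j
  have := congrArg star (congrFun (congrFun hT i) j)
  simp only [Matrix.mul_apply, scal_apply, conjMat, Matrix.map_apply, star_sum, star_mul, star_star,
    ← algebraMap_star_comm] at this ⊢
  simp only [Algebra.commutes] at this ⊢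
  exact this

variable (G) in
/-- The conjugate of an irreducible corepresentation is equivalent to a unitary one, which is again
irreducible since conjugation carries intertwiners to intertwiners. -/
theorem exists_isConj (α : G.Irred) : ∃ β, G.IsConj α β := by
  let v := G.rep α
  obtain ⟨Q, R, hQR, hRQ, hu⟩ := v.isUnitaryCorep.exists_conj
  have hQR₁ : scal A Q * scal A R = 1 := by rw [← scal_mul, hQR, scal_one]
  have hRQ₁ : scal A R * scal A Q = 1 := by rw [← scal_mul, hRQ, scal_one]
  have hQ : Q ∈ Mor (conjMat v.mat) (scal A Q * conjMat v.mat * scal A R) := by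
    rw [mem_Mor, mul_assoc, hRQ₁, mul_one]
  let w : G.IrrCorep :=
    { dim := v.dim
      dim_pos := v.dim_pos
      mat := scal A Q * conjMat v.mat * scal A R
      unitary := ⟨hu.1, hu.2⟩
      comul_mat := hu.3
      irreducible := fun T hT => by
        have hT' : R * T * Q ∈ Mor (conjMat v.mat) (conjMat v.mat) := by
          rw [mem_Mor] at hT ⊢
          rw [scal_mul, scal_mul]
          calc scal A R * scal A T * scal A Q * conjMat v.mat
              = scal A R * (scal A T * (scal A Q * conjMat v.mat * (scal A R * scal A Q))) := by
                rw [hRQ₁]; simp only [mul_assoc, mul_one]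
            _ = scal A R * (scal A T * (scal A Q * conjMat v.mat * scal A R)) * scal A Q := by
                simp only [mul_assoc]
            _ = (scal A R * scal A Q) * conjMat v.mat * (scal A R * scal A T * scal A Q) := by
                rw [hT]; simp only [mul_assoc]
            _ = conjMat v.mat * (scal A R * scal A T * scal A Q) := by rw [hRQ₁, one_mul]
        obtain ⟨c, hc⟩ := v.irreducible _ (mem_Mor_conjMat hT')
        refine ⟨star c, ?_⟩
        have hc' : R * T * Q = star c • (1 : Matrix _ _ ℂ) := by
          ext i j
          have := congrArg star (congrFun (congrFun hc i) j)
          simpa [Matrix.one_apply, apply_ite] using this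
        calc T = (Q * R) * T * (Q * R) := by rw [hQR, one_mul, mul_one]
          _ = Q * (R * T * Q) * R := by simp only [mul_assoc]
          _ = star c • (1 : Matrix _ _ ℂ) := by
            rw [hc', Matrix.mul_smul, Matrix.smul_mul, mul_one, hQR] }
  have hw : MatEquiv (G.rep (Quotient.mk _ w)).mat w.mat := Quotient.mk_out w
  exact ⟨Quotient.mk _ w, MatEquiv.trans ⟨Q, hQ, R, hQR, hRQ⟩ hw.symm⟩

variable (G) in
theorem isConj_conj (α : G.Irred) : G.IsConj α (G.conj α) := by
  have h := G.exists_isConj α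
  rw [conj, dif_pos h]
  exact h.choose_spec

end CompactQuantumGroup

/-! ### Fusion rules -/

section Mor

variable {A : Type u} [CStarAlgebra A] {m n p q : Type} [Fintype m] [Fintype n] [Fintype p]
  [Fintype q]

theorem mul_mem_Mor {v : Matrix n n A} {w : Matrix m m A} {x : Matrix p p A} {S : Matrix p m ℂ}
    {T : Matrix m n ℂ} (hS : S ∈ Mor w x) (hT : T ∈ Mor v w) : S * T ∈ Mor v x := by
  rw [mem_Mor] at *
  rw [scal_mul, Matrix.mul_assoc, hT, ← Matrix.mul_assoc, hS, Matrix.mul_assoc]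

theorem conjTranspose_mem_Mor [DecidableEq m] [DecidableEq n] {v : Matrix n n A}
    {w : Matrix m m A} (hv : v * vᴴ = 1) (hw : wᴴ * w = 1) {T : Matrix m n ℂ}
    (hT : T ∈ Mor v w) : Tᴴ ∈ Mor w v := by
  rw [mem_Mor] at *
  have h := congrArg Matrix.conjTranspose hT
  rw [Matrix.conjTranspose_mul, Matrix.conjTranspose_mul, scal_conjTranspose] at h
  calc scal A Tᴴ * w = v * (vᴴ * scal A Tᴴ) * w := by rw [← Matrix.mul_assoc, hv, Matrix.one_mul]
    _ = v * scal A Tᴴ * (wᴴ * w) := by rw [h]; simp only [Matrix.mul_assoc]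
    _ = v * scal A Tᴴ := by rw [hw, Matrix.mul_one]

/-- The adjoint is a conjugate-linear bijection between `Mor(v, w)` and `Mor(w, v)`. -/
theorem finrank_Mor_comm [DecidableEq m] [DecidableEq n] {v : Matrix n n A}
    {w : Matrix m m A} (hv : v * vᴴ = 1 ∧ vᴴ * v = 1) (hw : w * wᴴ = 1 ∧ wᴴ * w = 1) :
    Module.finrank ℂ (Mor v w) = Module.finrank ℂ (Mor w v) := by
  let j : Mor v w ≃+ Mor w v :=
    { toFun := fun T => ⟨T.1ᴴ, conjTranspose_mem_Mor hv.1 hw.2 T.2⟩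
      invFun := fun T => ⟨T.1ᴴ, conjTranspose_mem_Mor hw.1 hv.2 T.2⟩
      left_inv := fun T => Subtype.ext (Matrix.conjTranspose_conjTranspose T.1)
      right_inv := fun T => Subtype.ext (Matrix.conjTranspose_conjTranspose T.1)
      map_add' := fun S T => Subtype.ext (Matrix.conjTranspose_add S.1 T.1) }
  exact congrArg Cardinal.toNat (rank_eq_of_equiv_equiv (starRingEnd ℂ) j
    (Function.Involutive.bijective Complex.conj_conj) fun c T =>
      Subtype.ext (Matrix.conjTranspose_smul c T.1))

theorem finrank_le_of_injective {E F : Type*} [AddCommGroup E] [Module ℂ E] [AddCommGroup F]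
    [Module ℂ F] [FiniteDimensional ℂ F] {V : Submodule ℂ E} {W : Submodule ℂ F} (f : E →ₗ[ℂ] F)
    (hf : ∀ x ∈ V, f x ∈ W) (hinj : Function.Injective f) :
    Module.finrank ℂ V ≤ Module.finrank ℂ W :=
  LinearMap.finrank_le_finrank_of_injective (f := f.restrict hf) fun _ _ hxy =>
    Subtype.ext (hinj (congrArg Subtype.val hxy))

theorem finrank_Mor_congr_left [DecidableEq m] [DecidableEq n] {v : Matrix n n A}
    {v' : Matrix m m A} (h : MatEquiv v v') (w : Matrix p p A) :
    Module.finrank ℂ (Mor v w) = Module.finrank ℂ (Mor v' w) := by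
  have key : ∀ {m n : Type} [Fintype m] [Fintype n] [DecidableEq m] [DecidableEq n]
      {v : Matrix n n A} {v' : Matrix m m A}, MatEquiv v v' →
      Module.finrank ℂ (Mor v' w) ≤ Module.finrank ℂ (Mor v w) := by
    rintro m n _ _ _ _ v v' ⟨T, hT, S, hTS, -⟩
    refine finrank_le_of_injective (E := Matrix p m ℂ) (F := Matrix p n ℂ)
      ⟨⟨(· * T), fun X Y => Matrix.add_mul X Y T⟩, fun c X => Matrix.smul_mul c X T⟩
      (fun X hX => mul_mem_Mor hX hT)
      fun X Y hXY => ?_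
    have : X * T * S = Y * T * S := congrArg (· * S) hXY
    rwa [Matrix.mul_assoc, Matrix.mul_assoc, hTS, Matrix.mul_one, Matrix.mul_one] at this
  exact le_antisymm (key h.symm) (key h)

theorem finrank_Mor_congr_right [DecidableEq m] [DecidableEq n] {w : Matrix n n A}
    {w' : Matrix m m A} (h : MatEquiv w w') (v : Matrix p p A) :
    Module.finrank ℂ (Mor v w) = Module.finrank ℂ (Mor v w') := by
  have key : ∀ {m n : Type} [Fintype m] [Fintype n] [DecidableEq m] [DecidableEq n]
      {w : Matrix n n A} {w' : Matrix m m A}, MatEquiv w w' →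
      Module.finrank ℂ (Mor v w) ≤ Module.finrank ℂ (Mor v w') := by
    rintro m n _ _ _ _ w w' ⟨T, hT, S, -, hST⟩
    refine finrank_le_of_injective (E := Matrix n p ℂ) (F := Matrix m p ℂ)
      ⟨⟨(T * ·), Matrix.mul_add T⟩, fun c X => Matrix.mul_smul T c X⟩
      (fun X hX => mul_mem_Mor hT hX)
      fun X Y hXY => ?_
    have : S * (T * X) = S * (T * Y) := congrArg (S * ·) hXY
    rwa [← Matrix.mul_assoc, ← Matrix.mul_assoc, hST, Matrix.one_mul, Matrix.one_mul] at this
  exact le_antisymm (key h) (key h.symm)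

theorem tensorMat_unitary [DecidableEq m] [DecidableEq n] {v : Matrix m m A} {w : Matrix n n A}
    (hv : v * vᴴ = 1 ∧ vᴴ * v = 1) (hw : w * wᴴ = 1 ∧ wᴴ * w = 1) :
    tensorMat v w * (tensorMat v w)ᴴ = 1 ∧ (tensorMat v w)ᴴ * tensorMat v w = 1 := by
  have e1 : ∀ i j, ∑ k, v i k * star (v j k) = (1 : Matrix m m A) i j := fun i j => by
    rw [← hv.1]; rfl
  have e2 : ∀ i j, ∑ k, star (v k i) * v k j = (1 : Matrix m m A) i j := fun i j => by
    rw [← hv.2]; rfl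
  have e3 : ∀ i j, ∑ k, w i k * star (w j k) = (1 : Matrix n n A) i j := fun i j => by
    rw [← hw.1]; rfl
  have e4 : ∀ i j, ∑ k, star (w k i) * w k j = (1 : Matrix n n A) i j := fun i j => by
    rw [← hw.2]; rfl
  constructor
  · ext ⟨i, k⟩ ⟨j, l⟩
    have : ∀ a b, v i a * w k b * (star (w l b) * star (v j a)) =
        v i a * (w k b * star (w l b)) * star (v j a) := fun a b => by simp only [mul_assoc]
    simp only [Matrix.mul_apply, Matrix.conjTranspose_apply, tensorMat, Matrix.of_apply, star_mul,
      Fintype.sum_prod_type, this, ← Finset.mul_sum, ← Finset.sum_mul, e3]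
    by_cases hkl : k = l
    · subst hkl
      simp only [Matrix.one_apply_eq, mul_one, e1]
      simp [Matrix.one_apply, Prod.ext_iff]
    · simp [Prod.ext_iff, hkl]
  · ext ⟨i, k⟩ ⟨j, l⟩
    have : ∀ a b, star (w b k) * star (v a i) * (v a j * w b l) =
        star (w b k) * (star (v a i) * v a j) * w b l := fun a b => by simp only [mul_assoc]
    simp only [Matrix.mul_apply, Matrix.conjTranspose_apply, tensorMat, Matrix.of_apply, star_mul,
      Fintype.sum_prod_type, this]
    rw [Finset.sum_comm]
    simp only [← Finset.mul_sum, ← Finset.sum_mul, e2]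
    by_cases hij : i = j
    · subst hij
      simp only [Matrix.one_apply_eq, mul_one, e4]
      simp [Matrix.one_apply, Prod.ext_iff]
    · simp [Prod.ext_iff, hij]

open scoped Kronecker in
theorem MatEquiv.tensorMat [DecidableEq m] [DecidableEq n] [DecidableEq p] [DecidableEq q]
    {v : Matrix m m A} {v' : Matrix n n A} {w : Matrix p p A} {w' : Matrix q q A}
    (hv : MatEquiv v v') (hw : MatEquiv w w') :
    MatEquiv (CQG.tensorMat v w) (CQG.tensorMat v' w') := by
  obtain ⟨T, hT, T', h1, h2⟩ := hv
  obtain ⟨S, hS, S', h3, h4⟩ := hw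
  refine ⟨T ⊗ₖ S, ?_, T' ⊗ₖ S', ?_, ?_⟩
  · rw [mem_Mor] at *
    ext ⟨i, k⟩ ⟨j, l⟩
    have hT' := congrFun (congrFun hT i) j
    have hS' := congrFun (congrFun hS k) l
    simp only [Matrix.mul_apply, scal_apply] at hT' hS'
    have e1 : ∀ a b, algebraMap ℂ A (T i a * S k b) * (v a j * w b l) =
        (algebraMap ℂ A (T i a) * v a j) * (algebraMap ℂ A (S k b) * w b l) := fun a b => by
      simp only [Algebra.algebraMap_eq_smul_one, smul_mul_assoc, one_mul, mul_smul_comm, smul_smul,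
        mul_comm]
    have e2 : ∀ a b, (v' i a * w' k b) * algebraMap ℂ A (T a j * S b l) =
        (v' i a * algebraMap ℂ A (T a j)) * (w' k b * algebraMap ℂ A (S b l)) := fun a b => by
      rw [map_mul, mul_assoc, mul_assoc, ← mul_assoc (w' k b), ← mul_assoc (algebraMap ℂ A (T a j)),
        Algebra.commutes (T a j)]
    simp only [Matrix.mul_apply, scal_apply, Matrix.kroneckerMap_apply, CQG.tensorMat,
      Matrix.of_apply, Fintype.sum_prod_type, e1, e2, ← Finset.sum_mul_sum, hT', hS']
  · rw [← Matrix.mul_kronecker_mul, h1, h3, Matrix.one_kronecker_one]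
  · rw [← Matrix.mul_kronecker_mul, h2, h4, Matrix.one_kronecker_one]

theorem MatEquiv.card_eq [DecidableEq m] [DecidableEq n] {v : Matrix m m A} {w : Matrix n n A}
    (h : MatEquiv v w) : Fintype.card m = Fintype.card n := by
  obtain ⟨T, -, S, h1, h2⟩ := h
  exact Matrix.square_of_invertible S T h2 h1

theorem matEquiv_tensorMat_one_left [DecidableEq n] (w : Matrix n n A) :
    MatEquiv (tensorMat (1 : Matrix (Fin 1) (Fin 1) A) w) w := by
  refine ⟨Matrix.of fun i j => if i = j.2 then 1 else 0, ?_,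
    Matrix.of fun i j => if i.2 = j then 1 else 0, ?_, ?_⟩
  · rw [mem_Mor]
    ext i ⟨j, l⟩
    simp [Matrix.mul_apply, scal_apply, tensorMat, Fintype.sum_prod_type, Subsingleton.elim j 0,
      apply_ite (algebraMap ℂ A)]
  · ext i j
    rcases eq_or_ne i j with rfl | h
    · simp [Matrix.mul_apply, Fintype.sum_prod_type]
    · simp [Matrix.mul_apply, Fintype.sum_prod_type, h]
  · ext ⟨i, k⟩ ⟨j, l⟩
    simp [Matrix.mul_apply, Matrix.one_apply, Prod.ext_iff, Subsingleton.elim i j]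

theorem matEquiv_tensorMat_one_right [DecidableEq n] (w : Matrix n n A) :
    MatEquiv (tensorMat w (1 : Matrix (Fin 1) (Fin 1) A)) w := by
  refine ⟨Matrix.of fun i j => if i = j.1 then 1 else 0, ?_,
    Matrix.of fun i j => if i.1 = j then 1 else 0, ?_, ?_⟩
  · rw [mem_Mor]
    ext i ⟨j, l⟩
    simp [Matrix.mul_apply, scal_apply, tensorMat, Fintype.sum_prod_type, Subsingleton.elim l 0,
      apply_ite (algebraMap ℂ A)]
  · ext i j
    rcases eq_or_ne i j with rfl | h
    · simp [Matrix.mul_apply, Fintype.sum_prod_type]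
    · simp [Matrix.mul_apply, Fintype.sum_prod_type, h]
  · ext ⟨i, k⟩ ⟨j, l⟩
    simp [Matrix.mul_apply, Matrix.one_apply, Prod.ext_iff, Subsingleton.elim k l]

/-- Frobenius reciprocity `Mor(ū ⊗ w, x) ≅ Mor(w, u ⊗ x)`: reshape the intertwiner; only the
unitarity of `u` is used. -/
theorem finrank_Mor_conjMat_tensorMat [DecidableEq n] {u : Matrix n n A}
    (hu : u * uᴴ = 1 ∧ uᴴ * u = 1) (w : Matrix p p A) (x : Matrix q q A) :
    Module.finrank ℂ (Mor (tensorMat (conjMat u) w) x) =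
      Module.finrank ℂ (Mor w (tensorMat u x)) := by
  have e1 : ∀ i j, ∑ k, u i k * star (u j k) = (1 : Matrix n n A) i j := fun i j => by
    rw [← hu.1]; rfl
  have e2 : ∀ i j, ∑ k, star (u k i) * u k j = (1 : Matrix n n A) i j := fun i j => by
    rw [← hu.2]; rfl
  have mem₁ : ∀ S : Matrix q (n × p) ℂ, S ∈ Mor (tensorMat (conjMat u) w) x ↔
      ∀ c l b, ∑ j, star (u j l) * ∑ b', algebraMap ℂ A (S c (j, b')) * w b' b =
        ∑ c', x c c' * algebraMap ℂ A (S c' (l, b)) := fun S => by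
    have e : ∀ c l b (a : n) (b' : p), algebraMap ℂ A (S c (a, b')) * (star (u a l) * w b' b) =
        star (u a l) * (algebraMap ℂ A (S c (a, b')) * w b' b) := fun c l b a b' => by
      rw [← mul_assoc, Algebra.commutes, mul_assoc]
    rw [mem_Mor, ← Matrix.ext_iff]
    simp only [Matrix.mul_apply, scal_apply, tensorMat, conjMat, Matrix.map_apply, Matrix.of_apply,
      Fintype.sum_prod_type, Prod.forall, e, Finset.mul_sum]
  have mem₂ : ∀ S : Matrix (n × q) p ℂ, S ∈ Mor w (tensorMat u x) ↔
      ∀ i c b, ∑ b', algebraMap ℂ A (S (i, c) b') * w b' b =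
        ∑ l, u i l * ∑ c', x c c' * algebraMap ℂ A (S (l, c') b) := fun S => by
    rw [mem_Mor, ← Matrix.ext_iff]
    simp only [Matrix.mul_apply, scal_apply, tensorMat, Matrix.of_apply,
      Fintype.sum_prod_type, Prod.forall, Finset.mul_sum, mul_assoc]
  have inv₁ : ∀ f : n → A, ∀ i, ∑ l, u i l * ∑ j, star (u j l) * f j = f i := fun f i => by
    simp only [Finset.mul_sum, ← mul_assoc]
    rw [Finset.sum_comm]
    simp only [← Finset.sum_mul, e1]
    simp [Matrix.one_apply]
  have inv₂ : ∀ f : n → A, ∀ i, ∑ l, star (u l i) * ∑ j, u l j * f j = f i := fun f i => by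
    simp only [Finset.mul_sum, ← mul_assoc]
    rw [Finset.sum_comm]
    simp only [← Finset.sum_mul, e2]
    simp [Matrix.one_apply]
  let F : Matrix q (n × p) ℂ →ₗ[ℂ] Matrix (n × q) p ℂ :=
    { toFun := fun S => Matrix.of fun i b => S i.2 (i.1, b)
      map_add' := fun _ _ => rfl
      map_smul' := fun _ _ => rfl }
  let F' : Matrix (n × q) p ℂ →ₗ[ℂ] Matrix q (n × p) ℂ :=
    { toFun := fun S => Matrix.of fun c j => S (j.1, c) j.2
      map_add' := fun _ _ => rfl
      map_smul' := fun _ _ => rfl }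
  refine le_antisymm (finrank_le_of_injective F (fun S hS => ?_) fun S T h => ?_)
    (finrank_le_of_injective F' (fun S hS => ?_) fun S T h => ?_)
  · rw [mem₁] at hS
    rw [mem₂]
    intro i c b
    change ∑ b', algebraMap ℂ A (S c (i, b')) * w b' b =
      ∑ l, u i l * ∑ c', x c c' * algebraMap ℂ A (S c' (l, b))
    simp only [← hS, inv₁]
  · exact congrArg F' h
  · rw [mem₂] at hS
    rw [mem₁]
    intro c l b
    change ∑ j, star (u j l) * ∑ b', algebraMap ℂ A (S (j, c) b') * w b' b =
      ∑ c', x c c' * algebraMap ℂ A (S (l, c') b)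
    simp only [hS, inv₂]
  · exact congrArg F h

end Mor

/-! ### Multiplicities of irreducible corepresentations -/

namespace CompactQuantumGroup

variable {A : Type u} [CStarAlgebra A] {G : CompactQuantumGroup A}

/-- Schur's lemma. -/
theorem IrrCorep.matEquiv_of_ne_zero (v w : G.IrrCorep) {T : Matrix (Fin w.dim) (Fin v.dim) ℂ}
    (hT : T ∈ Mor v.mat w.mat) (h0 : T ≠ 0) : MatEquiv v.mat w.mat := by
  have hT' := conjTranspose_mem_Mor v.unitary.1 w.unitary.2 hT
  obtain ⟨c, hc⟩ := v.irreducible _ (mul_mem_Mor hT' hT)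
  obtain ⟨d, hd⟩ := w.irreducible _ (mul_mem_Mor hT hT')
  have hc0 : c ≠ 0 := by
    rintro rfl
    rw [zero_smul] at hc
    exact h0 (Matrix.conjTranspose_mul_self_eq_zero.1 hc)
  have hcd : d = c := by
    have h1 : T * (Tᴴ * T) = (T * Tᴴ) * T := (Matrix.mul_assoc _ _ _).symm
    rw [hc, hd, Matrix.mul_smul, Matrix.mul_one, Matrix.smul_mul, Matrix.one_mul] at h1
    have h2 : (c - d) • T = 0 := by rw [sub_smul, h1, sub_self]
    exact (sub_eq_zero.1 ((smul_eq_zero.1 h2).resolve_right h0)).symm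
  refine ⟨T, hT, c⁻¹ • Tᴴ, ?_, ?_⟩
  · rw [Matrix.mul_smul, hd, smul_smul, hcd, inv_mul_cancel₀ hc0, one_smul]
  · rw [Matrix.smul_mul, hc, smul_smul, inv_mul_cancel₀ hc0, one_smul]

theorem IrrCorep.finrank_Mor_self (v : G.IrrCorep) : Module.finrank ℂ (Mor v.mat v.mat) = 1 := by
  have h1 : (1 : Matrix (Fin v.dim) (Fin v.dim) ℂ) ∈ Mor v.mat v.mat := by
    rw [mem_Mor, scal_one, one_mul, mul_one]
  have : Nonempty (Fin v.dim) := ⟨⟨0, v.dim_pos⟩⟩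
  refine (finrank_eq_one_iff_of_nonzero' (⟨1, h1⟩ : Mor v.mat v.mat) fun h =>
    one_ne_zero (congrArg Subtype.val h)).2 fun T => ?_
  obtain ⟨c, hc⟩ := v.irreducible T.1 T.2
  exact ⟨c, Subtype.ext hc.symm⟩

theorem eq_of_matEquiv {α β : G.Irred} (h : MatEquiv (G.rep α).mat (G.rep β).mat) : α = β := by
  have : G.rep α ≈ G.rep β := h
  rw [← Quotient.out_eq α, ← Quotient.out_eq β]
  exact Quotient.sound this

open Classical in
theorem finrank_Mor_rep (α β : G.Irred) :
    Module.finrank ℂ (Mor (G.rep α).mat (G.rep β).mat) = if α = β then 1 else 0 := by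
  split_ifs with h
  · subst h
    exact (G.rep α).finrank_Mor_self
  · have : Mor (G.rep α).mat (G.rep β).mat = ⊥ := by
      refine (Submodule.eq_bot_iff _).2 fun T hT => ?_
      by_contra h0
      exact h (eq_of_matEquiv ((G.rep α).matEquiv_of_ne_zero (G.rep β) hT h0))
    rw [this, finrank_bot]

theorem rep_triv : MatEquiv (G.rep G.triv).mat (1 : Matrix (Fin 1) (Fin 1) A) :=
  Quotient.mk_out G.trivCorep

open Classical in
theorem mult_triv_left (β γ : G.Irred) : G.mult G.triv β γ = if γ = β then 1 else 0 := by
  rw [← finrank_Mor_rep, mult]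
  exact finrank_Mor_congr_right ((rep_triv.tensorMat (MatEquiv.refl _)).trans
    (matEquiv_tensorMat_one_left _)) _

open Classical in
theorem mult_triv_right (β γ : G.Irred) : G.mult β G.triv γ = if γ = β then 1 else 0 := by
  rw [← finrank_Mor_rep, mult]
  exact finrank_Mor_congr_right (((MatEquiv.refl _).tensorMat rep_triv).trans
    (matEquiv_tensorMat_one_right _)) _

/-- Frobenius reciprocity `N_{ᾱ,β}^γ = N_{α,γ}^β`. -/
theorem mult_conj (α β γ : G.Irred) : G.mult (G.conj α) β γ = G.mult α γ β := by
  have hα := (G.rep α).unitary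
  have hβ := (G.rep β).unitary
  have hγ := (G.rep γ).unitary
  rw [mult, finrank_Mor_comm hγ (tensorMat_unitary (G.rep _).unitary hβ),
    ← finrank_Mor_congr_left ((G.isConj_conj α).tensorMat (MatEquiv.refl _)),
    finrank_Mor_conjMat_tensorMat hα]
  rfl

theorem dim_conj (α : G.Irred) : G.dim (G.conj α) = G.dim α := by
  simpa [dim] using (G.isConj_conj α).card_eq.symm

theorem dim_pos (α : G.Irred) : 0 < G.dim α := (G.rep α).dim_pos

/-- The isotypic components of a unitary corepresentation are independent. -/
theorem sum_finrank_Mor_mul_dim_le {m : Type} [Fintype m] [DecidableEq m] {w : Matrix m m A}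
    (hw : w * wᴴ = 1 ∧ wᴴ * w = 1) (F : Finset G.Irred) :
    ∑ γ ∈ F, Module.finrank ℂ (Mor (G.rep γ).mat w) * (G.rep γ).dim ≤ Fintype.card m := by
  let b : ∀ γ : G.Irred, Module.Basis (Fin (Module.finrank ℂ (Mor (G.rep γ).mat w))) ℂ
    (Mor (G.rep γ).mat w) := fun γ => Module.finBasis ℂ _
  let t : (Σ γ : F, Fin (Module.finrank ℂ (Mor (G.rep γ.1).mat w)) × Fin ((G.rep γ.1).dim)) →
      m → ℂ := fun i a => (b i.1.1 i.2.1).1 a i.2.2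
  have ht : LinearIndependent ℂ t := by
    rw [Fintype.linearIndependent_iff]
    intro x hx
    let Y : ∀ γ : F, Fin ((G.rep γ.1).dim) → Mor (G.rep γ.1).mat w := fun γ p =>
      ∑ i, x ⟨γ, (i, p)⟩ • b γ.1 i
    have hY : ∀ a, ∑ γ : F, ∑ p, (Y γ p).1 a p = 0 := fun a => by
      have := congrFun hx a
      rw [Finset.sum_apply, Fintype.sum_sigma] at this
      rw [← Pi.zero_apply (M := fun _ : m => ℂ) a, ← this]
      refine Finset.sum_congr rfl fun γ _ => ?_
      rw [Fintype.sum_prod_type, Finset.sum_comm]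
      refine Finset.sum_congr rfl fun p _ => ?_
      simp [Y, t, Matrix.sum_apply]
    have hmem : ∀ (γ γ' : F) (p : Fin ((G.rep γ.1).dim)) (p' : Fin ((G.rep γ'.1).dim)),
        (Y γ' p').1ᴴ * (Y γ p).1 ∈ Mor (G.rep γ.1).mat (G.rep γ'.1).mat := fun γ γ' p p' =>
      mul_mem_Mor (conjTranspose_mem_Mor (G.rep γ'.1).unitary.1 hw.2 (Y γ' p').2) (Y γ p).2
    have hY0 : ∀ γ q, Y γ q = 0 := fun γ q => by
      -- apply the adjoint of `Y γ q` to the relation and read off the `q`-th coordinate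
      have h1 : ∑ γ' : F, ∑ p, ((Y γ q).1ᴴ * (Y γ' p).1) q p = 0 := by
        have e : ∀ γ' : F, ∑ p, ((Y γ q).1ᴴ * (Y γ' p).1) q p =
            ∑ a, (Y γ q).1ᴴ q a * ∑ p, (Y γ' p).1 a p := fun γ' => by
          simp only [Matrix.mul_apply, Finset.mul_sum]
          exact Finset.sum_comm
        simp only [e]
        rw [Finset.sum_comm]
        simp only [← Finset.mul_sum, hY, mul_zero, Finset.sum_const_zero]
      rw [Finset.sum_eq_single γ, Finset.sum_eq_single q] at h1
      · obtain ⟨c, hc⟩ := (G.rep γ.1).irreducible _ (hmem γ γ q q)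
        rw [hc, Matrix.smul_apply, Matrix.one_apply_eq, smul_eq_mul, mul_one] at h1
        rw [h1, zero_smul] at hc
        exact Subtype.ext (Matrix.conjTranspose_mul_self_eq_zero.1 hc)
      · intro p _ hp
        obtain ⟨c, hc⟩ := (G.rep γ.1).irreducible _ (hmem γ γ p q)
        rw [hc, Matrix.smul_apply, Matrix.one_apply_ne hp.symm, smul_zero]
      · simp
      · intro γ' _ hγ'
        refine Finset.sum_eq_zero fun p _ => ?_
        by_contra h0
        refine hγ' (Subtype.ext (eq_of_matEquiv
          ((G.rep γ'.1).matEquiv_of_ne_zero (G.rep γ.1) (hmem γ' γ p q) fun h => h0 ?_)))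
        rw [h]; rfl
      · simp
    rintro ⟨γ, i, p⟩
    exact Fintype.linearIndependent_iff.1 (b γ.1).linearIndependent
      (fun i => x ⟨γ, (i, p)⟩) (hY0 γ p) i
  have := ht.fintype_card_le_finrank
  simp only [Fintype.card_sigma, Fintype.card_prod, Fintype.card_fin,
    Module.finrank_fintype_fun_eq_card] at this
  rwa [Finset.sum_coe_sort F fun γ =>
    Module.finrank ℂ (Mor (G.rep γ).mat w) * (G.rep γ).dim] at this

/-- The dimension count `∑_γ N_{α,β}^γ d(γ) ≤ d(α) d(β)`. -/
theorem sum_mult_mul_dim_le (α β : G.Irred) (F : Finset G.Irred) :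
    ∑ γ ∈ F, G.mult α β γ * G.dim γ ≤ G.dim α * G.dim β := by
  have := sum_finrank_Mor_mul_dim_le
    (tensorMat_unitary (G.rep α).unitary (G.rep β).unitary) F
  rwa [Fintype.card_prod, Fintype.card_fin, Fintype.card_fin] at this

/-- The dimension count in the other index, which is that of `ᾱ ⊗ γ` by Frobenius reciprocity. -/
theorem sum_mult_mul_dim_le' (α γ : G.Irred) (F : Finset G.Irred) :
    ∑ β ∈ F, G.mult α β γ * G.dim β ≤ G.dim α * G.dim γ := by
  simpa only [mult_conj, dim_conj] using G.sum_mult_mul_dim_le (G.conj α) γ F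

theorem finite_support_mult (α β : G.Irred) : {γ | G.mult α β γ ≠ 0}.Finite := by
  by_contra hinf
  obtain ⟨F, hF, hcard⟩ := Set.Infinite.exists_subset_card_eq hinf (G.dim α * G.dim β + 1)
  have h1 := G.sum_mult_mul_dim_le α β F
  have h2 : F.card ≤ ∑ γ ∈ F, G.mult α β γ * G.dim γ := by
    rw [Finset.card_eq_sum_ones]
    refine Finset.sum_le_sum fun γ hγ => ?_
    have : 0 < G.mult α β γ := Nat.pos_of_ne_zero (hF hγ)
    exact Nat.mul_pos this (dim_pos γ)
  omega

/-! ### Operators on the fusion algebra given by matrices -/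

variable (G) in
/-- The coefficient at a class. -/
def coord (α : G.Irred) : G.FusionAlgebra →ₗ[ℂ] ℂ := Finsupp.lapply α

/-- The finite set of classes with nonzero coefficient. -/
def supp (f : G.FusionAlgebra) : Finset G.Irred := Finsupp.support f

open Classical in
theorem coord_basisElem (α β : G.Irred) : G.coord α (G.basisElem β) = if β = α then 1 else 0 :=
  Finsupp.single_apply

theorem coord_basisElem_self (α : G.Irred) : G.coord α (G.basisElem α) = 1 :=
  Finsupp.single_eq_same

theorem coord_basisElem_of_ne {α β : G.Irred} (h : β ≠ α) : G.coord α (G.basisElem β) = 0 := by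
  rw [coord_basisElem, if_neg h]

theorem ext_coord {f g : G.FusionAlgebra} (h : ∀ α, G.coord α f = G.coord α g) : f = g :=
  Finsupp.ext h

theorem coord_eq_zero {f : G.FusionAlgebra} {α : G.Irred} (h : α ∉ supp f) : G.coord α f = 0 :=
  Finsupp.notMem_support_iff.1 h

theorem eq_sum_coord (f : G.FusionAlgebra) :
    f = ∑ α ∈ supp f, G.coord α f • G.basisElem α := by
  classical
  refine ext_coord fun β => ?_
  simp only [map_sum, map_smul, coord_basisElem, smul_eq_mul, mul_ite, mul_one, mul_zero]
  rw [Finset.sum_ite_eq']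
  split_ifs with h
  · rfl
  · exact coord_eq_zero h

/-- Linear induction on the fusion algebra. -/
theorem fusion_induction {P : G.FusionAlgebra → Prop} (f : G.FusionAlgebra) (zero : P 0)
    (add : ∀ f g, P f → P g → P (f + g)) (smul : ∀ (c : ℂ) f, P f → P (c • f))
    (basis : ∀ α, P (G.basisElem α)) : P f := by
  rw [eq_sum_coord f]
  exact Finset.sum_induction _ P add zero fun α _ => smul _ _ (basis α)

open Classical in
theorem toL2_basisElem (α : G.Irred) : G.toL2 (G.basisElem α) = lp.single 2 α (1 : ℂ) :=
  G.liftBasis_basisElem _ α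

theorem toL2_apply (f : G.FusionAlgebra) (α : G.Irred) : G.toL2 f α = G.coord α f := by
  classical
  refine fusion_induction (P := fun f => G.toL2 f α = G.coord α f) f ?_ ?_ ?_ ?_
  · simp
  · intro f g hf hg
    rw [map_add, map_add, ← hf, ← hg]; rfl
  · intro c f hf
    rw [map_smul, map_smul, ← hf]; rfl
  · intro β
    rw [toL2_basisElem, lp.single_apply, coord_basisElem]
    rcases eq_or_ne α β with rfl | h
    · simp
    · simp [h, h.symm]

theorem toL2_injective : Function.Injective G.toL2 := fun f g h =>
  ext_coord fun α => by rw [← toL2_apply, ← toL2_apply, h]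

theorem norm_toL2_sq {f : G.FusionAlgebra} {S : Finset G.Irred} (hS : supp f ⊆ S) :
    ‖G.toL2 f‖ ^ 2 = ∑ α ∈ S, ‖G.coord α f‖ ^ 2 := by
  classical
  have h := lp.norm_sum_single (E := fun _ : G.Irred => ℂ) (p := 2) (by simp)
    (fun α => G.coord α f) S
  have e : ∑ α ∈ S, lp.single 2 α (G.coord α f) = G.toL2 f := by
    conv_rhs => rw [eq_sum_coord f, Finset.sum_subset hS (fun α _ h => by
      rw [coord_eq_zero h, zero_smul]), map_sum]
    refine Finset.sum_congr rfl fun α _ => ?_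
    rw [map_smul, toL2_basisElem, ← lp.single_smul, smul_eq_mul, mul_one]
  rw [e] at h
  simpa using h

theorem norm_toL2_basisElem (α : G.Irred) : ‖G.toL2 (G.basisElem α)‖ = 1 := by
  classical
  rw [toL2_basisElem, lp.norm_single (by simp), norm_one]

theorem toL2_denseRange : DenseRange G.toL2 := by
  classical
  intro x
  have h := lp.hasSum_single (E := fun _ : G.Irred => ℂ) (p := 2) (by simp) x
  refine mem_closure_of_tendsto h (Filter.Eventually.of_forall fun S => ?_)
  refine ⟨∑ α ∈ S, x α • G.basisElem α, ?_⟩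
  rw [map_sum]
  refine Finset.sum_congr rfl fun α _ => ?_
  rw [map_smul, toL2_basisElem, ← lp.single_smul, smul_eq_mul, mul_one]

/-- Bounded operators agree if they agree on the orthonormal basis. -/
theorem clm_ext {E : Type*} [NormedAddCommGroup E] [NormedSpace ℂ E] {S T : G.L2 →L[ℂ] E}
    (h : ∀ β, S (G.toL2 (G.basisElem β)) = T (G.toL2 (G.basisElem β))) : S = T := by
  refine ContinuousLinearMap.coeFn_injective
    (toL2_denseRange.equalizer S.continuous T.continuous (funext fun f => ?_))
  refine fusion_induction (P := fun f => S (G.toL2 f) = T (G.toL2 f)) f ?_ ?_ ?_ h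
  · simp
  · intro f g hf hg
    simpa using congrArg₂ (· + ·) hf hg
  · intro c f hf
    simpa using congrArg (c • ·) hf

/-- The matrix entries of an operator on the fusion algebra. -/
def entry (T : Module.End ℂ G.FusionAlgebra) (γ β : G.Irred) : ℂ := G.coord γ (T (G.basisElem β))

theorem coord_apply (T : Module.End ℂ G.FusionAlgebra) (ξ : G.FusionAlgebra) (γ : G.Irred) :
    G.coord γ (T ξ) = ∑ β ∈ supp ξ, G.coord β ξ * entry T γ β := by
  conv_lhs => rw [eq_sum_coord ξ]
  simp [entry]

theorem end_ext {S T : Module.End ℂ G.FusionAlgebra} (h : ∀ γ β, entry S γ β = entry T γ β) :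
    S = T :=
  LinearMap.ext fun ξ => ext_coord fun γ => by simp only [coord_apply, h]

/-- Schur's test with the weight `d`, for a kernel `κ` dominating the matrix entries. -/
theorem norm_toL2_apply_le {T : Module.End ℂ G.FusionAlgebra} {κ : G.Irred → G.Irred → ℝ} {C : ℝ}
    (hκ : ∀ γ β, ‖entry T γ β‖ ≤ κ γ β) (hC : 0 ≤ C)
    (hcol : ∀ β (F : Finset G.Irred), ∑ γ ∈ F, κ γ β * G.dim γ ≤ C * G.dim β)
    (hrow : ∀ γ (F : Finset G.Irred), ∑ β ∈ F, κ γ β * G.dim β ≤ C * G.dim γ)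
    (ξ : G.FusionAlgebra) : ‖G.toL2 (T ξ)‖ ≤ C * ‖G.toL2 ξ‖ := by
  have hd : ∀ α : G.Irred, (0 : ℝ) < G.dim α := fun α => Nat.cast_pos.2 (dim_pos α)
  have hκ0 : ∀ γ β, 0 ≤ κ γ β := fun γ β => (norm_nonneg _).trans (hκ γ β)
  have h1 : ∀ γ, ‖G.coord γ (T ξ)‖ ^ 2 ≤
      C * G.dim γ * ∑ β ∈ supp ξ, κ γ β * (‖G.coord β ξ‖ ^ 2 / G.dim β) := fun γ => by
    have e1 : ‖G.coord γ (T ξ)‖ ≤ ∑ β ∈ supp ξ, ‖G.coord β ξ‖ * κ γ β := by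
      rw [coord_apply]
      refine (norm_sum_le _ _).trans (Finset.sum_le_sum fun β _ => ?_)
      rw [norm_mul]
      exact mul_le_mul_of_nonneg_left (hκ γ β) (norm_nonneg _)
    -- Cauchy–Schwarz, with `κ = (κ d)^{1/2} (κ / d)^{1/2}`
    have e2 : (∑ β ∈ supp ξ, ‖G.coord β ξ‖ * κ γ β) ^ 2 ≤
        (∑ β ∈ supp ξ, κ γ β * G.dim β) *
          ∑ β ∈ supp ξ, κ γ β * (‖G.coord β ξ‖ ^ 2 / G.dim β) := by
      refine Finset.sum_sq_le_sum_mul_sum_of_sq_le_mul _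
        (fun β _ => mul_nonneg (hκ0 γ β) (hd β).le)
        (fun β _ => mul_nonneg (hκ0 γ β) (div_nonneg (sq_nonneg _) (hd β).le)) fun β _ => ?_
      have := (hd β).ne'
      refine le_of_eq ?_
      field_simp
    refine (pow_le_pow_left₀ (norm_nonneg _) e1 2).trans (e2.trans ?_)
    exact mul_le_mul_of_nonneg_right (hrow γ _) (Finset.sum_nonneg fun β _ =>
      mul_nonneg (hκ0 γ β) (div_nonneg (sq_nonneg _) (hd β).le))
  have h2 : ‖G.toL2 (T ξ)‖ ^ 2 ≤ (C * ‖G.toL2 ξ‖) ^ 2 := by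
    rw [norm_toL2_sq subset_rfl, mul_pow, norm_toL2_sq (f := ξ) subset_rfl]
    calc ∑ γ ∈ supp (T ξ), ‖G.coord γ (T ξ)‖ ^ 2
        ≤ ∑ γ ∈ supp (T ξ), ∑ β ∈ supp ξ,
            C * (‖G.coord β ξ‖ ^ 2 / G.dim β) * (κ γ β * G.dim γ) := by
          refine Finset.sum_le_sum fun γ _ => (h1 γ).trans_eq ?_
          rw [Finset.mul_sum]
          exact Finset.sum_congr rfl fun β _ => by ring
      _ = ∑ β ∈ supp ξ, C * (‖G.coord β ξ‖ ^ 2 / G.dim β) *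
            ∑ γ ∈ supp (T ξ), κ γ β * G.dim γ := by
          rw [Finset.sum_comm]
          simp only [Finset.mul_sum]
      _ ≤ ∑ β ∈ supp ξ, C * (‖G.coord β ξ‖ ^ 2 / G.dim β) * (C * G.dim β) := by
          refine Finset.sum_le_sum fun β _ => mul_le_mul_of_nonneg_left (hcol β _) ?_
          exact mul_nonneg hC (div_nonneg (sq_nonneg _) (hd β).le)
      _ = C ^ 2 * ∑ β ∈ supp ξ, ‖G.coord β ξ‖ ^ 2 := by
          rw [Finset.mul_sum]
          refine Finset.sum_congr rfl fun β _ => ?_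
          have := (hd β).ne'
          field_simp
  exact abs_le_of_sq_le_sq' h2 (mul_nonneg hC (norm_nonneg _)) |>.2

theorem entry_leftMul_basisElem (α γ β : G.Irred) :
    entry (G.leftMul (G.basisElem α)) γ β = G.mult α β γ := by
  have hfin : (Function.support fun γ => (G.mult α β γ : ℂ) • G.basisElem γ).Finite :=
    (finite_support_mult α β).subset fun γ hγ h0 => hγ (by
      show (G.mult α β γ : ℂ) • G.basisElem γ = 0
      rw [show G.mult α β γ = 0 from h0, Nat.cast_zero, zero_smul])
  rw [entry, leftMul, liftBasis_basisElem, liftBasis_basisElem, finsum_eq_sum _ hfin, map_sum]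
  rw [Finset.sum_eq_single γ]
  · rw [map_smul, coord_basisElem_self, smul_eq_mul, mul_one]
  · intro γ' _ h
    rw [map_smul, coord_basisElem_of_ne h, smul_zero]
  · intro h
    rw [Set.Finite.mem_toFinset, Function.notMem_support] at h
    rw [h, map_zero]

theorem dirac_basisElem (ℓ : G.Irred → ℝ) (β : G.Irred) :
    G.dirac ℓ (G.basisElem β) = (ℓ β : ℂ) • G.basisElem β :=
  G.liftBasis_basisElem _ β

theorem coord_dirac (ℓ : G.Irred → ℝ) (γ : G.Irred) (ξ : G.FusionAlgebra) :
    G.coord γ (G.dirac ℓ ξ) = ℓ γ * G.coord γ ξ := by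
  refine fusion_induction (P := fun ξ => G.coord γ (G.dirac ℓ ξ) = ℓ γ * G.coord γ ξ) ξ
    (by simp) ?_ ?_ ?_
  · intro f g hf hg
    rw [map_add, map_add, map_add, hf, hg, mul_add]
  · intro c f hf
    rw [map_smul, map_smul, map_smul, hf, smul_eq_mul, smul_eq_mul]; ring
  · intro β
    rw [dirac_basisElem, map_smul, smul_eq_mul]
    rcases eq_or_ne β γ with rfl | h
    · rfl
    · rw [coord_basisElem_of_ne h, mul_zero, mul_zero]

/-- A commutator with `D` multiplies the `(γ, β)` entry by `ℓ(γ) - ℓ(β)`. -/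
theorem entry_iterComm (ℓ : G.Irred → ℝ) (k : ℕ) (f : G.FusionAlgebra) (γ β : G.Irred) :
    entry (G.iterComm ℓ k f) γ β = (ℓ γ - ℓ β : ℂ) ^ k * entry (G.leftMul f) γ β := by
  induction k generalizing γ β with
  | zero => simp [iterComm]
  | succ k ih =>
    have e : G.iterComm ℓ (k + 1) f =
        G.dirac ℓ * G.iterComm ℓ k f - G.iterComm ℓ k f * G.dirac ℓ :=
      Function.iterate_succ_apply' _ k _
    rw [e, pow_succ', mul_assoc, ← ih, entry, LinearMap.sub_apply, Module.End.mul_apply,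
      Module.End.mul_apply, map_sub, coord_dirac, dirac_basisElem, map_smul, map_smul, entry,
      smul_eq_mul]
    ring

theorem iterComm_add (ℓ : G.Irred → ℝ) (k : ℕ) (f g : G.FusionAlgebra) :
    G.iterComm ℓ k (f + g) = G.iterComm ℓ k f + G.iterComm ℓ k g := by
  refine end_ext fun γ β => ?_
  have : ∀ S T : Module.End ℂ G.FusionAlgebra, entry (S + T) γ β = entry S γ β + entry T γ β :=
    fun S T => by simp [entry]
  rw [this, entry_iterComm, entry_iterComm, entry_iterComm, map_add, this, mul_add]

theorem entry_smul (c : ℂ) (T : Module.End ℂ G.FusionAlgebra) (γ β : G.Irred) :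
    entry (c • T) γ β = c * entry T γ β := by simp [entry]

theorem iterComm_smul (ℓ : G.Irred → ℝ) (k : ℕ) (c : ℂ) (f : G.FusionAlgebra) :
    G.iterComm ℓ k (c • f) = c • G.iterComm ℓ k f := by
  refine end_ext fun γ β => ?_
  rw [entry_smul, entry_iterComm, entry_iterComm, map_smul, entry_smul]
  ring

/-- The bound `‖δᵏ(α)‖ ≤ ℓ(α)ᵏ d(α)`: on the support of `N_{α,β}^γ` one has
`|ℓ(γ) - ℓ(β)| ≤ ℓ(α)`, by subadditivity for `γ ⊆ α ⊗ β` and for `β ⊆ ᾱ ⊗ γ`. -/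
theorem norm_toL2_iterComm_basisElem_le {ℓ : G.Irred → ℝ} (hℓ : G.IsLength ℓ) (k : ℕ)
    (α : G.Irred) (ξ : G.FusionAlgebra) :
    ‖G.toL2 (G.iterComm ℓ k (G.basisElem α) ξ)‖ ≤ ℓ α ^ k * G.dim α * ‖G.toL2 ξ‖ := by
  have hk : 0 ≤ ℓ α ^ k := pow_nonneg (hℓ.nonneg α) k
  refine norm_toL2_apply_le (κ := fun γ β => ℓ α ^ k * G.mult α β γ) (fun γ β => ?_)
    (mul_nonneg hk (Nat.cast_nonneg _)) (fun β F => ?_) (fun γ F => ?_) ξ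
  · rw [entry_iterComm, entry_leftMul_basisElem, norm_mul, norm_pow, Complex.norm_natCast,
      ← Complex.ofReal_sub, Complex.norm_real, Real.norm_eq_abs]
    rcases Nat.eq_zero_or_pos (G.mult α β γ) with h0 | h0
    · simp [h0]
    · have h1 := hℓ.sub α β γ h0.ne'
      have h2 := hℓ.sub (G.conj α) γ β (by rw [mult_conj]; exact h0.ne')
      rw [hℓ.conj] at h2
      have : |ℓ γ - ℓ β| ≤ ℓ α := abs_le.2 ⟨by linarith, by linarith⟩
      gcongr
  · have h : (∑ γ ∈ F, G.mult α β γ * G.dim γ : ℝ) ≤ G.dim α * G.dim β := by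
      exact_mod_cast sum_mult_mul_dim_le α β F
    simp only [mul_assoc, ← Finset.mul_sum]
    exact mul_le_mul_of_nonneg_left h hk
  · have h : (∑ β ∈ F, G.mult α β γ * G.dim β : ℝ) ≤ G.dim α * G.dim γ := by
      exact_mod_cast sum_mult_mul_dim_le' α γ F
    simp only [mul_assoc, ← Finset.mul_sum]
    exact mul_le_mul_of_nonneg_left h hk

/-- The bound `‖π(α)‖ ≤ d(α)`. -/
theorem norm_toL2_leftMul_basisElem_le (α : G.Irred) (ξ : G.FusionAlgebra) :
    ‖G.toL2 (G.leftMul (G.basisElem α) ξ)‖ ≤ G.dim α * ‖G.toL2 ξ‖ := by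
  -- no commutator is taken, so the zero length function serves
  have h0 : G.IsLength fun _ => 0 :=
    ⟨fun _ => le_rfl, rfl, fun _ => rfl, fun _ _ _ _ => (add_zero (0 : ℝ)).ge⟩
  have h := norm_toL2_iterComm_basisElem_le h0 0 α ξ
  rwa [pow_zero, one_mul] at h

/-! ### The operator norm -/

theorem opENorm_le {T : Module.End ℂ G.FusionAlgebra} {C : ℝ}
    (h : ∀ ξ, ‖G.toL2 (T ξ)‖ ≤ C * ‖G.toL2 ξ‖) (hC : 0 ≤ C) :
    G.opENorm T ≤ ENNReal.ofReal C :=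
  iSup₂_le fun ξ hξ => by
    rw [← ofReal_norm]
    exact ENNReal.ofReal_le_ofReal ((h ξ).trans (mul_le_of_le_one_right hC hξ))

theorem norm_toL2_apply_le_opENorm {T : Module.End ℂ G.FusionAlgebra} (h : G.opENorm T < ⊤)
    (ξ : G.FusionAlgebra) : ‖G.toL2 (T ξ)‖ ≤ (G.opENorm T).toReal * ‖G.toL2 ξ‖ := by
  rcases eq_or_ne (‖G.toL2 ξ‖) 0 with h0 | h0
  · have : ξ = 0 := toL2_injective (by rw [norm_eq_zero.1 h0, map_zero])
    simp [this]
  · have hpos : 0 < ‖G.toL2 ξ‖ := lt_of_le_of_ne (norm_nonneg _) h0.symm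
    have h1 : ‖G.toL2 (T (((‖G.toL2 ξ‖⁻¹ : ℝ) : ℂ) • ξ))‖ₑ ≤ G.opENorm T := by
      refine le_iSup₂ (f := fun ξ (_ : ‖G.toL2 ξ‖ ≤ 1) => ‖G.toL2 (T ξ)‖ₑ) _ ?_
      rw [map_smul, norm_smul, Complex.norm_real, norm_inv, norm_norm, inv_mul_cancel₀ h0]
    have h2 := (ENNReal.toReal_le_toReal enorm_ne_top h.ne).2 h1
    rw [toReal_enorm, map_smul, map_smul, norm_smul, Complex.norm_real, norm_inv, norm_norm,
      inv_mul_le_iff₀ hpos] at h2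
    rwa [mul_comm] at h2

theorem opENorm_add_le (S T : Module.End ℂ G.FusionAlgebra) :
    G.opENorm (S + T) ≤ G.opENorm S + G.opENorm T :=
  iSup₂_le fun ξ hξ => by
    rw [LinearMap.add_apply, map_add]
    exact (enorm_add_le _ _).trans (add_le_add
      (le_iSup₂ (f := fun ξ (_ : ‖G.toL2 ξ‖ ≤ 1) => ‖G.toL2 (S ξ)‖ₑ) ξ hξ)
      (le_iSup₂ (f := fun ξ (_ : ‖G.toL2 ξ‖ ≤ 1) => ‖G.toL2 (T ξ)‖ₑ) ξ hξ))

theorem opENorm_smul (c : ℂ) (T : Module.End ℂ G.FusionAlgebra) :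
    G.opENorm (c • T) = ‖c‖ₑ * G.opENorm T := by
  simp only [opENorm, ENNReal.mul_iSup, LinearMap.smul_apply, map_smul, enorm_smul]

/-- The conjugate-transposed matrix defines the formal adjoint. -/
theorem inner_toL2_apply {S T : Module.End ℂ G.FusionAlgebra}
    (h : ∀ γ β, entry S γ β = star (entry T β γ)) (η ξ : G.FusionAlgebra) :
    inner ℂ (G.toL2 η) (G.toL2 (S ξ)) = inner ℂ (G.toL2 (T η)) (G.toL2 ξ) := by
  classical
  refine fusion_induction
    (P := fun η => inner ℂ (G.toL2 η) (G.toL2 (S ξ)) = inner ℂ (G.toL2 (T η)) (G.toL2 ξ))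
    η (by simp) ?_ ?_ fun γ => ?_
  · intro f g hf hg
    simp only [map_add, inner_add_left, hf, hg]
  · intro c f hf
    simp only [map_smul, inner_smul_left, hf]
  refine fusion_induction
    (P := fun ξ => inner ℂ (G.toL2 (G.basisElem γ)) (G.toL2 (S ξ)) =
      inner ℂ (G.toL2 (T (G.basisElem γ))) (G.toL2 ξ)) ξ (by simp) ?_ ?_ fun β => ?_
  · intro f g hf hg
    simp only [map_add, inner_add_right, hf, hg]
  · intro c f hf
    simp only [map_smul, inner_smul_right, hf]
  · rw [toL2_basisElem, toL2_basisElem, lp.inner_single_left, lp.inner_single_right, toL2_apply,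
      toL2_apply]
    have := h γ β
    simp only [entry] at this
    simp [this]

theorem opENorm_le_of_entry_eq_star {S T : Module.End ℂ G.FusionAlgebra}
    (h : ∀ γ β, entry S γ β = star (entry T β γ)) : G.opENorm S ≤ G.opENorm T := by
  rcases eq_or_ne (G.opENorm T) ⊤ with htop | htop
  · simp [htop]
  have hT := norm_toL2_apply_le_opENorm (lt_top_iff_ne_top.2 htop)
  rw [← ENNReal.ofReal_toReal htop]
  refine opENorm_le (fun ξ => ?_) ENNReal.toReal_nonneg
  have h1 : ‖G.toL2 (S ξ)‖ ^ 2 ≤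
      (G.opENorm T).toReal * ‖G.toL2 (S ξ)‖ * ‖G.toL2 ξ‖ := by
    rw [← inner_self_eq_norm_sq (𝕜 := ℂ), inner_toL2_apply h]
    exact (Complex.re_le_norm _).trans ((norm_inner_le_norm _ _).trans
      (mul_le_mul_of_nonneg_right (hT _) (norm_nonneg _)))
  rcases (norm_nonneg (G.toL2 (S ξ))).eq_or_lt with h0 | h0
  · rw [← h0]
    exact mul_nonneg ENNReal.toReal_nonneg (norm_nonneg _)
  · refine le_of_mul_le_mul_right ?_ h0
    linarith

/-! ### The operator system -/

variable (G) in
/-- The representation of the fusion algebra on `ℓ²(Irred(G))` by left multiplication. -/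
def leftReg : G.FusionAlgebra →ₗ[ℂ] (G.L2 →L[ℂ] G.L2) :=
  G.liftBasis fun α => (G.toL2 ∘ₗ G.leftMul (G.basisElem α)).extendOfNorm G.toL2

theorem leftReg_apply_toL2 (f ξ : G.FusionAlgebra) :
    leftReg G f (G.toL2 ξ) = G.toL2 (f * ξ) := by
  refine fusion_induction (P := fun f => leftReg G f (G.toL2 ξ) = G.toL2 (G.leftMul f ξ)) f
    (by simp) ?_ ?_ fun α => ?_
  · intro f g hf hg
    simp [hf, hg]
  · intro c f hf
    simp [hf]
  · rw [leftReg, liftBasis_basisElem, LinearMap.extendOfNorm_eq toL2_denseRange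
      ⟨G.dim α, norm_toL2_leftMul_basisElem_le α⟩]
    rfl

theorem norm_leftReg_basisElem_le (α : G.Irred) : ‖leftReg G (G.basisElem α)‖ ≤ G.dim α := by
  rw [leftReg, liftBasis_basisElem]
  exact LinearMap.opNorm_extendOfNorm_le toL2_denseRange (Nat.cast_nonneg _)
    (norm_toL2_leftMul_basisElem_le α)

theorem basisElem_mul_one (α : G.Irred) : G.basisElem α * 1 = G.basisElem α := by
  classical
  refine ext_coord fun γ => ?_
  have h := entry_leftMul_basisElem α γ G.triv
  rw [mult_triv_right] at h
  refine Eq.trans h ?_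
  rw [coord_basisElem]
  by_cases h' : α = γ
  · simp [h']
  · simp [h', Ne.symm h']

theorem one_mul_basisElem (α : G.Irred) : 1 * G.basisElem α = G.basisElem α := by
  classical
  refine ext_coord fun γ => ?_
  have h := entry_leftMul_basisElem G.triv γ α
  rw [mult_triv_left] at h
  refine Eq.trans h ?_
  rw [coord_basisElem]
  by_cases h' : α = γ
  · simp [h']
  · simp [h', Ne.symm h']

theorem leftMul_apply_one (f : G.FusionAlgebra) : G.leftMul f 1 = f := by
  refine fusion_induction (P := fun f => G.leftMul f 1 = f) f (by simp) ?_ ?_ basisElem_mul_one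
  · intro f g hf hg
    simp [hf, hg]
  · intro c f hf
    simp [hf]

/-- The element `f` is recovered as `π(f)e`. -/
theorem leftReg_injective : Function.Injective (leftReg G) := fun f g h => by
  have e : leftReg G f (G.toL2 1) = leftReg G g (G.toL2 1) := by rw [h]
  rw [leftReg_apply_toL2, leftReg_apply_toL2] at e
  have e' := toL2_injective e
  rwa [show f * 1 = f from leftMul_apply_one f, show g * 1 = g from leftMul_apply_one g] at e'

theorem leftReg_one : leftReg G 1 = 1 :=
  clm_ext fun β => by rw [leftReg_apply_toL2, one_mul_basisElem]; rfl

theorem star_add_fusion (f g : G.FusionAlgebra) : star (f + g) = star f + star g :=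
  (congrArg (Finsupp.mapDomain G.conj)
    (Finsupp.mapRange_add (hf := star_zero ℂ) (fun _ _ => star_add _ _) f g)).trans
    Finsupp.mapDomain_add

theorem star_smul_fusion (c : ℂ) (f : G.FusionAlgebra) : star (c • f) = star c • star f :=
  (congrArg (Finsupp.mapDomain G.conj)
    (Finsupp.mapRange_smul' (hf := star_zero ℂ) c (star c) f fun x => by simp)).trans
    (Finsupp.mapDomain_smul _ _)

theorem star_basisElem (α : G.Irred) : star (G.basisElem α) = G.basisElem (G.conj α) := by
  show Finsupp.mapDomain G.conj (Finsupp.mapRange star (star_zero ℂ) (Finsupp.single α 1)) = _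
  rw [Finsupp.mapRange_single, star_one, Finsupp.mapDomain_single]
  rfl

/-- Frobenius reciprocity: left multiplication by `f*` has the conjugate-transposed matrix. -/
theorem entry_leftMul_star (f : G.FusionAlgebra) (γ β : G.Irred) :
    entry (G.leftMul (star f)) γ β = star (entry (G.leftMul f) β γ) := by
  refine fusion_induction
    (P := fun f => entry (G.leftMul (star f)) γ β = star (entry (G.leftMul f) β γ)) f ?_ ?_ ?_ ?_
  · have : star (0 : G.FusionAlgebra) = 0 := by simpa using star_smul_fusion 0 (0 : G.FusionAlgebra)
    simp [this, entry]
  · intro f g hf hg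
    simp only [entry] at hf hg ⊢
    simp [star_add_fusion, hf, hg]
  · intro c f hf
    rw [star_smul_fusion, map_smul, map_smul, entry_smul, entry_smul, hf, star_mul']
  · intro α
    rw [star_basisElem, entry_leftMul_basisElem, entry_leftMul_basisElem, mult_conj]
    simp

theorem leftReg_star (f : G.FusionAlgebra) :
    leftReg G (star f) = ContinuousLinearMap.adjoint (leftReg G f) := by
  refine clm_ext fun β => ?_
  refine toL2_denseRange.eq_of_inner_left (𝕜 := ℂ) fun η => ?_
  rw [ContinuousLinearMap.adjoint_inner_left, leftReg_apply_toL2, leftReg_apply_toL2]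
  exact (inner_toL2_apply (fun γ β => by rw [entry_leftMul_star, star_star]) _ η).symm

theorem isOperatorSystem_leftReg : IsOperatorSystem (leftReg G) :=
  ⟨leftReg_injective, leftReg_one, leftReg_star⟩

theorem star_star_fusion (f : G.FusionAlgebra) : star (star f) = f :=
  leftReg_injective (by rw [leftReg_star, leftReg_star, ContinuousLinearMap.adjoint_adjoint])

end CompactQuantumGroup

/-! ### States of an operator system -/

section States

variable {E : Type u} [AddCommGroup E] [Module ℂ E] [One E] [Star E]
  {H : Type v} [NormedAddCommGroup H] [InnerProductSpace ℂ H] [CompleteSpace H]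

/-- A self-adjoint operator `T` satisfies `‖T‖ + T ≥ 0`. -/
theorem isPositive_smul_one_add {T : H →L[ℂ] H} (hT : IsSelfAdjoint T) :
    (((‖T‖ : ℝ) : ℂ) • (1 : H →L[ℂ] H) + T).IsPositive := by
  rw [ContinuousLinearMap.isPositive_def']
  refine ⟨(IsSelfAdjoint.smul (by simp [IsSelfAdjoint]) (IsSelfAdjoint.one _)).add hT, fun x => ?_⟩
  have h1 : ‖inner ℂ (T x) x‖ ≤ ‖T‖ * ‖x‖ ^ 2 := by
    refine (norm_inner_le_norm _ _).trans ?_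
    rw [sq, ← mul_assoc]
    exact mul_le_mul_of_nonneg_right (T.le_opNorm x) (norm_nonneg _)
  have h2 := (abs_le.1 ((Complex.abs_re_le_norm _).trans h1)).1
  have h3 : ContinuousLinearMap.reApplyInnerSelf
      (((‖T‖ : ℝ) : ℂ) • (1 : H →L[ℂ] H) + T) x = ‖T‖ * ‖x‖ ^ 2 + (inner ℂ (T x) x).re := by
    rw [ContinuousLinearMap.reApplyInnerSelf_apply, add_apply, inner_add_left, smul_apply,
      one_apply_eq_self, inner_smul_left, Complex.conj_ofReal, map_add]
    show (((‖T‖ : ℝ) : ℂ) * inner ℂ x x).re + _ = _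
    rw [Complex.re_ofReal_mul, ← inner_self_eq_norm_sq (𝕜 := ℂ)]
    rfl
  rw [h3]
  linarith

variable {ρ : E →ₗ[ℂ] (H →L[ℂ] H)}

theorem StateSpace.norm_apply_le_of_isSelfAdjoint (hρ : IsOperatorSystem ρ) (φ : StateSpace ρ)
    {a : E} (ha : IsSelfAdjoint (ρ a)) : ‖φ.1 a‖ ≤ ‖ρ a‖ := by
  have key : ∀ b : E, IsSelfAdjoint (ρ b) → 0 ≤ ((‖ρ b‖ : ℝ) : ℂ) + φ.1 b := fun b hb => by
    have := φ.2.2 (((‖ρ b‖ : ℝ) : ℂ) • 1 + b) (by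
      rw [map_add, map_smul, hρ.map_one]; exact isPositive_smul_one_add hb)
    rwa [map_add, map_smul, φ.2.1, smul_eq_mul, mul_one] at this
  have h1 := Complex.le_def.1 (key a ha)
  have h2 := Complex.le_def.1 (key (-a) (by rw [map_neg]; exact ha.neg))
  simp only [map_neg, norm_neg, Complex.zero_re, Complex.add_re, Complex.ofReal_re,
    Complex.zero_im, Complex.add_im, Complex.ofReal_im, Complex.neg_re] at h1 h2
  have him : φ.1 a = ((φ.1 a).re : ℂ) := Complex.ext (by simp) (by simp; linarith)
  rw [him, Complex.norm_real, Real.norm_eq_abs]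
  exact abs_le.2 ⟨by linarith, by linarith⟩

/-- States are bounded. The constant `2` comes from splitting into self-adjoint parts. -/
theorem StateSpace.norm_apply_le (hρ : IsOperatorSystem ρ) (φ : StateSpace ρ) (a : E) :
    ‖φ.1 a‖ ≤ 2 * ‖ρ a‖ := by
  have hs : ρ (star a) = star (ρ a) := hρ.map_star a
  have h1 : ‖φ.1 (a + star a)‖ ≤ 2 * ‖ρ a‖ := by
    refine (φ.norm_apply_le_of_isSelfAdjoint hρ ?_).trans ?_
    · rw [map_add, hs]; exact IsSelfAdjoint.add_star_self _
    · rw [map_add, hs, two_mul]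
      exact (norm_add_le _ _).trans_eq (by rw [norm_star])
  have h2 : ‖φ.1 (Complex.I • (a - star a))‖ ≤ 2 * ‖ρ a‖ := by
    refine (φ.norm_apply_le_of_isSelfAdjoint hρ ?_).trans ?_
    · rw [map_smul, map_sub, hs, IsSelfAdjoint, star_smul, star_sub, star_star, Complex.star_def,
        Complex.conj_I, neg_smul, ← smul_neg, neg_sub]
    · rw [map_smul, map_sub, hs, two_mul, norm_smul, Complex.norm_I, one_mul]
      exact (norm_sub_le _ _).trans_eq (by rw [norm_star])
  have h3 : φ.1 a = (1 / 2 : ℂ) *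
      (φ.1 (a + star a) - Complex.I * φ.1 (Complex.I • (a - star a))) := by
    rw [map_smul, map_add, map_sub, smul_eq_mul, ← mul_assoc, Complex.I_mul_I]
    ring
  rw [h3, norm_mul]
  have h4 : ‖φ.1 (a + star a) - Complex.I * φ.1 (Complex.I • (a - star a))‖ ≤
      2 * ‖ρ a‖ + 2 * ‖ρ a‖ := by
    refine (norm_sub_le _ _).trans (add_le_add h1 ?_)
    rwa [norm_mul, Complex.norm_I, one_mul]
  have h5 : ‖(1 / 2 : ℂ)‖ = 1 / 2 := by norm_num
  rw [h5]
  linarith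

end States

/-! ### The Lipschitz seminorm -/

namespace CompactQuantumGroup

variable {A : Type u} [CStarAlgebra A] {G : CompactQuantumGroup A}

theorem lip_add_le (ℓ : G.Irred → ℝ) (k : ℕ) (f g : G.FusionAlgebra) :
    G.lip ℓ k (f + g) ≤ G.lip ℓ k f + G.lip ℓ k g := by
  rw [lip, iterComm_add]
  exact opENorm_add_le _ _

theorem lip_smul (ℓ : G.Irred → ℝ) (k : ℕ) (c : ℂ) (f : G.FusionAlgebra) :
    G.lip ℓ k (c • f) = ‖c‖ₑ * G.lip ℓ k f := by
  rw [lip, iterComm_smul, opENorm_smul, lip]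

theorem lip_lt_top {ℓ : G.Irred → ℝ} (hℓ : G.IsLength ℓ) (k : ℕ) (f : G.FusionAlgebra) :
    G.lip ℓ k f < ⊤ := by
  refine fusion_induction (P := fun f => G.lip ℓ k f < ⊤) f ?_ ?_ ?_ fun α => ?_
  · rw [← zero_smul ℂ (0 : G.FusionAlgebra), lip_smul, enorm_zero, zero_mul]
    exact ENNReal.zero_lt_top
  · exact fun f g hf hg => (lip_add_le ℓ k f g).trans_lt (ENNReal.add_lt_top.2 ⟨hf, hg⟩)
  · intro c f hf
    rw [lip_smul]
    exact ENNReal.mul_lt_top enorm_lt_top hf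
  · exact (opENorm_le (norm_toL2_iterComm_basisElem_le hℓ k α)
      (mul_nonneg (pow_nonneg (hℓ.nonneg α) k) (Nat.cast_nonneg _))).trans_lt ENNReal.ofReal_lt_top

/-- Up to the sign `(-1)ᵏ`, `δᵏ(f*)` is the formal adjoint of `δᵏ(f)`. -/
theorem lip_star_le (ℓ : G.Irred → ℝ) (k : ℕ) (f : G.FusionAlgebra) :
    G.lip ℓ k (star f) ≤ G.lip ℓ k f := by
  have h : G.opENorm (((-1 : ℂ) ^ k) • G.iterComm ℓ k f) = G.lip ℓ k f := by
    rw [opENorm_smul, ← ofReal_norm, norm_pow, norm_neg, norm_one, one_pow, ENNReal.ofReal_one,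
      one_mul, lip]
  rw [← h]
  refine opENorm_le_of_entry_eq_star fun γ β => ?_
  rw [entry_smul, entry_iterComm, entry_iterComm, entry_leftMul_star, ← mul_assoc, ← mul_pow,
    star_mul']
  simp

theorem lip_star (ℓ : G.Irred → ℝ) (k : ℕ) (f : G.FusionAlgebra) :
    G.lip ℓ k (star f) = G.lip ℓ k f :=
  (lip_star_le ℓ k f).antisymm (by
    have h := lip_star_le ℓ k (star f)
    rwa [star_star_fusion] at h)

/-- The vector `δᵏ(f)e` has coordinates `ℓ(α)ᵏ f_α`. -/
theorem coord_iterComm_one {ℓ : G.Irred → ℝ} (hℓ : G.IsLength ℓ) (k : ℕ) (f : G.FusionAlgebra)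
    (α : G.Irred) : G.coord α (G.iterComm ℓ k f 1) = (ℓ α : ℂ) ^ k * G.coord α f := by
  have h := entry_iterComm ℓ k f α G.triv
  rw [hℓ.triv, Complex.ofReal_zero, sub_zero] at h
  refine h.trans ?_
  rw [show entry (G.leftMul f) α G.triv = G.coord α (G.leftMul f 1) from rfl, leftMul_apply_one]

/-- The lower bound `‖δᵏ(f)e‖ ≤ L(f)`, in coordinates. -/
theorem sum_norm_coord_sq_le {ℓ : G.Irred → ℝ} (hℓ : G.IsLength ℓ) (k : ℕ) (f : G.FusionAlgebra)
    (S : Finset G.Irred) :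
    ∑ α ∈ S, ‖G.coord α f‖ ^ 2 * ℓ α ^ (2 * k) ≤ (G.lip ℓ k f).toReal ^ 2 := by
  classical
  have h1 := norm_toL2_apply_le_opENorm (lip_lt_top hℓ k f) 1
  rw [show ‖G.toL2 1‖ = 1 from norm_toL2_basisElem G.triv, mul_one] at h1
  refine le_trans ?_ (pow_le_pow_left₀ (norm_nonneg _) h1 2)
  rw [norm_toL2_sq (Finset.subset_union_right (s₁ := S))]
  refine le_trans (Finset.sum_le_sum fun α _ => ?_)
    (Finset.sum_le_sum_of_subset_of_nonneg Finset.subset_union_left fun _ _ _ => sq_nonneg _)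
  rw [coord_iterComm_one hℓ, norm_mul, norm_pow, Complex.norm_real, Real.norm_eq_abs, mul_pow,
    ← pow_mul, mul_comm k 2, pow_mul |ℓ α|, sq_abs, ← pow_mul, mul_comm]

theorem lip_one (ℓ : G.Irred → ℝ) {k : ℕ} (hk : k ≠ 0) : G.lip ℓ k 1 = 0 := by
  have h : G.iterComm ℓ k 1 = (0 : ℂ) • (0 : Module.End ℂ G.FusionAlgebra) := by
    refine end_ext fun γ β => ?_
    rw [entry_iterComm, entry_smul, zero_mul,
      show entry (G.leftMul 1) γ β = G.coord γ (1 * G.basisElem β) from rfl, one_mul_basisElem]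
    rcases eq_or_ne β γ with rfl | h
    · rw [sub_self, zero_pow hk, zero_mul]
    · rw [coord_basisElem_of_ne h, mul_zero]
  rw [lip, h, opENorm_smul, enorm_zero, zero_mul]

theorem lip_eq_zero_iff {ℓ : G.Irred → ℝ} (hℓ : G.IsLength ℓ) (hproper : G.IsProperLength ℓ)
    {k : ℕ} (hk : k ≠ 0) (f : G.FusionAlgebra) :
    G.lip ℓ k f = 0 ↔ ∃ c : ℂ, f = c • (1 : G.FusionAlgebra) := by
  constructor
  · intro h
    refine ⟨G.coord G.triv f, ext_coord fun α => ?_⟩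
    rw [map_smul, show (1 : G.FusionAlgebra) = G.basisElem G.triv from rfl, smul_eq_mul]
    rcases eq_or_ne G.triv α with rfl | hα
    · rw [coord_basisElem_self, mul_one]
    · rw [coord_basisElem_of_ne hα, mul_zero]
      have h1 := sum_norm_coord_sq_le hℓ k f {α}
      rw [Finset.sum_singleton, h, ENNReal.toReal_zero, zero_pow two_ne_zero] at h1
      have h2 : 0 < ℓ α ^ (2 * k) :=
        pow_pos ((hℓ.nonneg α).lt_of_ne fun h0 => hα (hproper.2 α h0.symm).symm) _
      have h3 : ‖G.coord α f‖ ^ 2 ≤ 0 := nonpos_of_mul_nonpos_left h1 h2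
      exact norm_eq_zero.1 (pow_eq_zero_iff two_ne_zero |>.1 (h3.antisymm (sq_nonneg _)))
  · rintro ⟨c, rfl⟩
    rw [lip_smul, lip_one ℓ hk, mul_zero]

theorem isLipSeminorm_lip {ℓ : G.Irred → ℝ} (hℓ : G.IsLength ℓ) (hproper : G.IsProperLength ℓ)
    {k : ℕ} (hk : k ≠ 0) : IsLipSeminorm (leftReg G) (G.lip ℓ k) where
  add_le := lip_add_le ℓ k
  smul := lip_smul ℓ k
  dense_dom a ε hε := ⟨a, lip_lt_top hℓ k a, by rwa [sub_self, norm_zero]⟩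
  map_star := lip_star ℓ k
  ker := lip_eq_zero_iff hℓ hproper hk

/-! ### Growth -/

/-- Polynomial growth of order `s < k` makes `∑ d(α)² ℓ(α)⁻²ᵏ` finite: the classes with
`⌈ℓ(α)⌉ = n` contribute `O(n^(s - 2k))`, and `s - 2k < -1`. The term at `e` is `0⁻¹ = 0`. -/
theorem summable_dim_sq_mul_inv {ℓ : G.Irred → ℝ} (hℓ : G.IsLength ℓ)
    (hproper : G.IsProperLength ℓ) {s : ℝ} (hgrowth : G.HasPolynomialGrowth ℓ s) {k : ℕ}
    (hk : s < k) : Summable fun α => (G.dim α : ℝ) ^ 2 * (ℓ α ^ (2 * k))⁻¹ := by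
  obtain ⟨hs, c, hc, hgr⟩ := hgrowth
  have hk1 : (1 : ℝ) ≤ k := by
    have : 0 < k := by exact_mod_cast hs.trans_lt hk
    exact_mod_cast this
  set ν : G.Irred → ℕ := fun α => ⌈ℓ α⌉₊ with hν
  have hfib : ∀ n : ℕ, ∑' α : ν ⁻¹' {n},
      (G.dim α : ℝ≥0∞) ^ 2 * ENNReal.ofReal (((ν α : ℝ) ^ (2 * k))⁻¹) ≤
        ENNReal.ofReal (c * (n : ℝ) ^ (s - 2 * k)) := fun n => by
    have e : ∀ α : ν ⁻¹' {n}, (G.dim α : ℝ≥0∞) ^ 2 * ENNReal.ofReal (((ν α : ℝ) ^ (2 * k))⁻¹) =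
        (G.dim α : ℝ≥0∞) ^ 2 * ENNReal.ofReal (((n : ℝ) ^ (2 * k))⁻¹) := fun α => by
      rw [show ν α = n from α.2]
    rw [tsum_congr e, ENNReal.tsum_mul_right]
    rcases Nat.eq_zero_or_pos n with rfl | hn
    · have : 2 * k ≠ 0 := by
        have : 0 < k := by exact_mod_cast hs.trans_lt hk
        lia
      simp [this]
    have hn' : (0 : ℝ) < n := Nat.cast_pos.2 hn
    have hpow : (n : ℝ) ^ (2 * (k : ℝ)) = (n : ℝ) ^ (2 * k) := by
      exact_mod_cast Real.rpow_natCast (n : ℝ) (2 * k)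
    have hset : ν ⁻¹' {n} = {α | (n : ℝ) - 1 < ℓ α ∧ ℓ α ≤ n} := by
      ext α
      rw [Set.mem_preimage, Set.mem_singleton_iff, Nat.ceil_eq_iff hn.ne', Nat.cast_pred hn]
      rfl
    rw [hset]
    refine (mul_le_mul_left (hgr n hn) _).trans_eq ?_
    rw [← ENNReal.ofReal_mul (mul_nonneg hc (Real.rpow_nonneg hn'.le _)), mul_assoc,
      Real.rpow_sub hn', div_eq_mul_inv, hpow]
  have hsum : Summable fun n : ℕ => c * (n : ℝ) ^ (s - 2 * k) :=
    (Real.summable_nat_rpow.2 (by linarith)).mul_left c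
  have hfin : ∑' α, (G.dim α : ℝ≥0∞) ^ 2 * ENNReal.ofReal (((ν α : ℝ) ^ (2 * k))⁻¹) ≠ ⊤ := by
    rw [← ENNReal.tsum_fiberwise _ ν]
    exact ((ENNReal.tsum_le_tsum hfib).trans_lt hsum.tsum_ofReal_lt_top).ne
  have h1 := (ENNReal.summable_toReal hfin).mul_left (2 ^ (2 * k))
  refine h1.of_norm_bounded_eventually ?_
  -- `⌈ℓ(α)⌉ ≤ 2 ℓ(α)` as soon as `ℓ(α) > 1`
  filter_upwards [(hproper.1 1).compl_mem_cofinite] with α hα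
  have hα' : 1 < ℓ α := not_le.1 hα
  have h2 : (ν α : ℝ) ≤ 2 * ℓ α := by
    have := Nat.ceil_lt_add_one (hℓ.nonneg α)
    simp only [hν]; linarith
  have h3 : (0 : ℝ) < ν α := lt_of_lt_of_le (by linarith) (Nat.le_ceil (ℓ α))
  have h4 : (0 : ℝ) < ℓ α := by linarith
  rw [Real.norm_of_nonneg (by positivity), ENNReal.toReal_mul,
    ENNReal.toReal_ofReal (by positivity), ENNReal.toReal_pow, ENNReal.toReal_natCast,
    mul_left_comm]
  refine mul_le_mul_of_nonneg_left ?_ (sq_nonneg _)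
  rw [← div_eq_mul_inv, inv_eq_one_div, div_le_div_iff₀ (by positivity) (by positivity), one_mul,
    ← mul_pow]
  exact pow_le_pow_left₀ h3.le h2 _

end CompactQuantumGroup

/-! ### The Monge–Kantorovich metric -/

section Metric

variable {E : Type u} [AddCommGroup E] [Module ℂ E] [One E] [Star E]
  {H : Type v} [NormedAddCommGroup H] [InnerProductSpace ℂ H]
  {ρ : E →ₗ[ℂ] (H →L[ℂ] H)} {L : E → ℝ≥0∞}

/-- The difference of two states at `a` is at most `L(a)` times their distance; when `L(a) = 0`,
`a` is scalar and the states agree at `a`. -/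
theorem IsLipSeminorm.enorm_sub_le_mul_mkDist (hL : IsLipSeminorm ρ L) {a : E} (ha : L a < ⊤)
    (φ ψ : StateSpace ρ) : ‖φ.1 a - ψ.1 a‖ₑ ≤ L a * mkDist ρ L φ ψ := by
  rcases eq_or_ne (L a) 0 with h0 | h0
  · obtain ⟨c, rfl⟩ := (hL.ker a).1 h0
    rw [map_smul, map_smul, φ.2.1, ψ.2.1, sub_self, enorm_zero]
    exact zero_le
  · have hr : 0 < (L a).toReal := ENNReal.toReal_pos h0 ha.ne
    have hc : ‖(((L a).toReal⁻¹ : ℝ) : ℂ)‖ₑ = (L a)⁻¹ := by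
      rw [← ofReal_norm, Complex.norm_real, Real.norm_of_nonneg (inv_nonneg.2 hr.le),
        ENNReal.ofReal_inv_of_pos hr, ENNReal.ofReal_toReal ha.ne]
    have h1 := le_iSup₂ (f := fun a (_ : L a ≤ 1) => ‖φ.1 a - ψ.1 a‖ₑ)
      ((((L a).toReal⁻¹ : ℝ) : ℂ) • a) (by
        rw [hL.smul, hc, ENNReal.inv_mul_cancel h0 ha.ne])
    rw [map_smul, map_smul, ← smul_sub, enorm_smul, hc] at h1
    exact (ENNReal.inv_mul_le_iff h0 ha.ne).1 h1

variable [CompleteSpace H]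

/-- A Lipschitz seminorm that is finite everywhere gives a compact quantum metric space as soon as
weak* convergence of states implies convergence for the Monge–Kantorovich distance. -/
theorem isCompactQuantumMetricSpace_of_tendsto (hρ : IsOperatorSystem ρ) (hL : IsLipSeminorm ρ L)
    (hfin : ∀ a, L a < ⊤) (hdist : ∀ φ ψ : StateSpace ρ, mkDist ρ L φ ψ < ⊤)
    (h : ∀ ψ : StateSpace ρ, Filter.Tendsto (fun φ => mkDist ρ L φ ψ)
      (@nhds _ (weakStar ρ) ψ) (nhds 0)) : IsCompactQuantumMetricSpace ρ L where
  operatorSystem := hρ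
  lipSeminorm := hL
  dist_lt_top := hdist
  eq_of_dist φ ψ h0 := Subtype.ext <| LinearMap.ext fun a => by
    have := hL.enorm_sub_le_mul_mkDist (hfin a) φ ψ
    rw [h0, mul_zero, nonpos_iff_eq_zero, enorm_eq_zero] at this
    exact sub_eq_zero.1 this
  topology_eq := by
    refine le_antisymm ?_ ?_
    · rw [← continuous_iff_le_induced]
      let := mkMetric ρ L
      refine continuous_pi fun a => continuous_iff_continuousAt.2 fun ψ => ?_
      refine tendsto_iff_edist_tendsto_0.2 ?_
      have h1 : Filter.Tendsto (fun φ : StateSpace ρ => L a * edist φ ψ) (nhds ψ) (nhds 0) := by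
        have := ENNReal.Tendsto.const_mul (a := L a)
          (tendsto_iff_edist_tendsto_0.1 (Filter.tendsto_id (x := nhds ψ))) (Or.inr (hfin a).ne)
        rwa [mul_zero] at this
      refine tendsto_of_tendsto_of_tendsto_of_le_of_le tendsto_const_nhds h1
        (fun _ => zero_le) fun φ => ?_
      show edist (φ.1 a) (ψ.1 a) ≤ _
      rw [edist_eq_enorm_sub]
      exact hL.enorm_sub_le_mul_mkDist (hfin a) φ ψ
    · refine le_of_nhds_le_nhds fun ψ => ?_
      have h1 := h ψ
      let := mkMetric ρ L
      exact tendsto_iff_edist_tendsto_0.2 h1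

end Metric

namespace CompactQuantumGroup

variable {A : Type u} [CStarAlgebra A] {G : CompactQuantumGroup A}

theorem norm_state_basisElem_le (φ : StateSpace (leftReg G)) (α : G.Irred) :
    ‖φ.1 (G.basisElem α)‖ ≤ 2 * G.dim α :=
  (φ.norm_apply_le isOperatorSystem_leftReg _).trans
    (mul_le_mul_of_nonneg_left (norm_leftReg_basisElem_le α) zero_le_two)

theorem norm_state_sub_sq_mul_le {ℓ : G.Irred → ℝ} (hℓ : G.IsLength ℓ) (k : ℕ)
    (φ ψ : StateSpace (leftReg G)) (α : G.Irred) :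
    ‖φ.1 (G.basisElem α) - ψ.1 (G.basisElem α)‖ ^ 2 * (ℓ α ^ (2 * k))⁻¹ ≤
      16 * ((G.dim α : ℝ) ^ 2 * (ℓ α ^ (2 * k))⁻¹) := by
  have h1 : ‖φ.1 (G.basisElem α) - ψ.1 (G.basisElem α)‖ ≤ 4 * G.dim α :=
    (norm_sub_le _ _).trans (by
      linarith [norm_state_basisElem_le φ α, norm_state_basisElem_le ψ α])
  have h2 := pow_le_pow_left₀ (norm_nonneg _) h1 2
  rw [← mul_assoc]
  exact mul_le_mul_of_nonneg_right (h2.trans_eq (by ring))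
    (inv_nonneg.2 (pow_nonneg (hℓ.nonneg α) _))

/-- The Cauchy–Schwarz inequality for the weights `ℓ(α)²ᵏ`; the class `e`, where the weight
vanishes, does not contribute since states agree there. -/
theorem mkDist_le {ℓ : G.Irred → ℝ} (hℓ : G.IsLength ℓ) (hproper : G.IsProperLength ℓ) (k : ℕ)
    (φ ψ : StateSpace (leftReg G))
    (hsum : Summable fun α =>
      ‖φ.1 (G.basisElem α) - ψ.1 (G.basisElem α)‖ ^ 2 * (ℓ α ^ (2 * k))⁻¹) :
    mkDist (leftReg G) (G.lip ℓ k) φ ψ ≤ ENNReal.ofReal (√(∑' α,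
      ‖φ.1 (G.basisElem α) - ψ.1 (G.basisElem α)‖ ^ 2 * (ℓ α ^ (2 * k))⁻¹)) := by
  refine iSup₂_le fun f hf => ?_
  rw [← ofReal_norm]
  refine ENNReal.ofReal_le_ofReal (Real.le_sqrt_of_sq_le ?_)
  have hw : ∀ α, 0 ≤ ℓ α ^ (2 * k) := fun α => pow_nonneg (hℓ.nonneg α) _
  have e : φ.1 f - ψ.1 f = ∑ α ∈ supp f,
      G.coord α f * (φ.1 (G.basisElem α) - ψ.1 (G.basisElem α)) := by
    conv_lhs => rw [eq_sum_coord f]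
    simp only [map_sum, map_smul, smul_eq_mul, mul_sub, Finset.sum_sub_distrib]
  have h1 : ‖φ.1 f - ψ.1 f‖ ≤ ∑ α ∈ supp f,
      ‖G.coord α f‖ * ‖φ.1 (G.basisElem α) - ψ.1 (G.basisElem α)‖ := by
    rw [e]
    exact (norm_sum_le _ _).trans_eq (by simp only [norm_mul])
  refine (pow_le_pow_left₀ (norm_nonneg _) h1 2).trans ?_
  refine (Finset.sum_sq_le_sum_mul_sum_of_sq_le_mul _
    (f := fun α => ‖G.coord α f‖ ^ 2 * ℓ α ^ (2 * k))
    (g := fun α => ‖φ.1 (G.basisElem α) - ψ.1 (G.basisElem α)‖ ^ 2 * (ℓ α ^ (2 * k))⁻¹)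
    (fun α _ => mul_nonneg (sq_nonneg _) (hw α))
    (fun α _ => mul_nonneg (sq_nonneg _) (inv_nonneg.2 (hw α))) fun α _ => ?_).trans ?_
  · rcases eq_or_ne α G.triv with rfl | hα
    · have h0 : φ.1 (G.basisElem G.triv) = ψ.1 (G.basisElem G.triv) := φ.2.1.trans ψ.2.1.symm
      simp [h0]
    · have : ℓ α ^ (2 * k) ≠ 0 := pow_ne_zero _ fun h0 => hα (hproper.2 α h0)
      refine le_of_eq ?_
      field_simp
  · have h2 : (G.lip ℓ k f).toReal ≤ 1 := by
      simpa using (ENNReal.toReal_le_toReal (lip_lt_top hℓ k f).ne ENNReal.one_ne_top).2 hf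
    have h3 : ∑ α ∈ supp f, ‖G.coord α f‖ ^ 2 * ℓ α ^ (2 * k) ≤ 1 :=
      (sum_norm_coord_sq_le hℓ k f _).trans (pow_le_one₀ ENNReal.toReal_nonneg h2)
    have h4 := hsum.sum_le_tsum (supp f) fun α _ => mul_nonneg (sq_nonneg _) (inv_nonneg.2 (hw α))
    calc _ ≤ 1 * _ := mul_le_mul_of_nonneg_right h3 (Finset.sum_nonneg fun α _ =>
          mul_nonneg (sq_nonneg _) (inv_nonneg.2 (hw α)))
      _ ≤ _ := by rwa [one_mul]

/-- On states, `|φ(α) - ψ(α)|² ℓ(α)⁻²ᵏ` is dominated by the summable family `16 d(α)² ℓ(α)⁻²ᵏ`, so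
dominated convergence turns weak* convergence into convergence for the distance. -/
theorem isCompactQuantumMetricSpace_lip {ℓ : G.Irred → ℝ} (hℓ : G.IsLength ℓ)
    (hproper : G.IsProperLength ℓ) {s : ℝ} (hgrowth : G.HasPolynomialGrowth ℓ s) {k : ℕ}
    (hk : s < k) : IsCompactQuantumMetricSpace (leftReg G) (G.lip ℓ k) := by
  have hk0 : k ≠ 0 := by
    rintro rfl
    exact absurd hk (not_lt.2 (by simpa using hgrowth.1))
  have hw : ∀ α, 0 ≤ (ℓ α ^ (2 * k))⁻¹ := fun α => inv_nonneg.2 (pow_nonneg (hℓ.nonneg α) _)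
  have hdom := (summable_dim_sq_mul_inv hℓ hproper hgrowth hk).mul_left 16
  have hsum : ∀ φ ψ : StateSpace (leftReg G), Summable fun α =>
      ‖φ.1 (G.basisElem α) - ψ.1 (G.basisElem α)‖ ^ 2 * (ℓ α ^ (2 * k))⁻¹ := fun φ ψ =>
    hdom.of_nonneg_of_le (fun α => mul_nonneg (sq_nonneg _) (hw α))
      (norm_state_sub_sq_mul_le hℓ k φ ψ)
  refine isCompactQuantumMetricSpace_of_tendsto isOperatorSystem_leftReg
    (isLipSeminorm_lip hℓ hproper hk0) (lip_lt_top hℓ k)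
    (fun φ ψ => (mkDist_le hℓ hproper k φ ψ (hsum φ ψ)).trans_lt ENNReal.ofReal_lt_top)
    fun ψ => ?_
  let := weakStar (leftReg G)
  have heval : ∀ f, Filter.Tendsto (fun φ : StateSpace (leftReg G) => φ.1 f) (nhds ψ)
      (nhds (ψ.1 f)) := fun f =>
    ((continuous_apply f).comp continuous_induced_dom).tendsto ψ
  have hlim : Filter.Tendsto (fun φ : StateSpace (leftReg G) => ∑' α,
      ‖φ.1 (G.basisElem α) - ψ.1 (G.basisElem α)‖ ^ 2 * (ℓ α ^ (2 * k))⁻¹) (nhds ψ)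
      (nhds (∑' _ : G.Irred, (0 : ℝ))) := by
    refine tendsto_tsum_of_dominated_convergence hdom (fun α => ?_)
      (Filter.Eventually.of_forall fun φ α => ?_)
    · have := (((heval (G.basisElem α)).sub_const (ψ.1 (G.basisElem α))).norm.pow 2).mul_const
        ((ℓ α ^ (2 * k))⁻¹)
      simpa using this
    · rw [Real.norm_of_nonneg (mul_nonneg (sq_nonneg _) (hw α))]
      exact norm_state_sub_sq_mul_le hℓ k φ ψ α
  have hlim' := ENNReal.tendsto_ofReal hlim.sqrt
  rw [tsum_zero, Real.sqrt_zero, ENNReal.ofReal_zero] at hlim'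
  exact tendsto_of_tendsto_of_tendsto_of_le_of_le tendsto_const_nhds hlim' (fun _ => zero_le)
    fun φ => mkDist_le hℓ hproper k φ ψ (hsum φ ψ)

end CompactQuantumGroup

end CQG

end

theorem mainTheorem2 {A : Type*} [CStarAlgebra A] (G : CQG.CompactQuantumGroup A)
    (ℓ : G.Irred → ℝ) (hℓ : G.IsLength ℓ) (hproper : G.IsProperLength ℓ)
    (s : ℝ) (hgrowth : G.HasPolynomialGrowth ℓ s) (k : ℕ) (hk : s < k) :
    ∃ ρ : G.FusionAlgebra →ₗ[ℂ] (G.L2 →L[ℂ] G.L2),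
      (∀ f ξ : G.FusionAlgebra, ρ f (G.toL2 ξ) = G.toL2 (f * ξ)) ∧
      (∀ f : G.FusionAlgebra, G.lip ℓ k f < ⊤) ∧
      CQG.IsCompactQuantumMetricSpace ρ (G.lip ℓ k) :=
  ⟨CQG.CompactQuantumGroup.leftReg G, CQG.CompactQuantumGroup.leftReg_apply_toL2,
    CQG.CompactQuantumGroup.lip_lt_top hℓ k,
    CQG.CompactQuantumGroup.isCompactQuantumMetricSpace_lip hℓ hproper hgrowth hk⟩
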